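/- Let $n\ge 2$, let $\theta\in\mathbb R^n$ with $\theta_i>0$ for all $i$, let $\omega\in\mathbb C$ with $\operatorname{Im}\omega>0$, and let $\mu_p,\rho_p:\mathbb R^n\to\mathbb R$ be continuous, $1$-periodic in each variable and bounded below and above by positive constants. Put $D_\theta=\theta\cdot\nabla$ (in the sense of distributions), $\Omega^\#=(0,1)^{n-1}\times(0,\infty)$, $H^1_\theta(\Omega^\#)=\{U\in L^2(\Omega^\#): D_\theta U\in L^2(\Omega^\#)\}$ with its graph norm, and, for $1\le i\le n$ and $a\in\{0,1\}$, $\Sigma^\#_{i,a}=\{y: y_i=a,\ y_j\in(0,1)\ (j<n,\ j\ne i),\ y_n>0 \text{ if } i\neq n\}$. Traces of functions of $H^1_\theta(\Omega^\#)$ on $\Sigma^\#_{i,a}$ are elements of $L^2_{\mathrm{loc}}(\Sigma^\#_{i,a})$, defined by extending by continuity the restriction map on $\mathscr C^\infty_0(\overline{\Omega^\#})$; the faces $\Sigma^\#_{i,0}$ and $\Sigma^\#_{i,1}$ are identified by translation along the $i$-th unit vector $e_i$. For $\varphi\in L^2(\Sigma^\#_{n,0})$ the half-guide problem consists in finding $U\in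 H^1_\theta(\Omega^\#)$ such that $$-D_\theta(\mu_p D_\theta U)-\rho_p\,\omega^2\,U=0\ \text{ in }\Omega^\#,\qquad U|_{\Sigma^\#_{n,0}}=\varphi,$$ $$U|_{\Sigma^\#_{i,0}}=U|_{\Sigma^\#_{i,1}},\qquad (\mu_pD_\theta U)|_{\Sigma^\#_{i,0}}=(\mu_pD_\theta U)|_{\Sigma^\#_{i,1}}\qquad(1\le i\le n-1).$$ It has, for every such $\varphi$, exactly one solution $U^+_\theta(\varphi)$, and $\mathcal P\varphi:=U^+_\theta(\varphi)|_{\Sigma^\#_{n,1}}$ defines a bounded linear operator $\mathcal P$ on $L^2(\Sigma^\#_{n,0})$ (with $\Sigma^\#_{n,1}$ identified with $\Sigma^\#_{n,0}$), the propagation operator. For every $\varphi\in L^2(\Sigma^\#_{n,0})$ and every $\ell\in\mathbb N$, $$U^+_\theta(\varphi)(y+\ell e_n)=U^+_\theta(\mathcal P^\ell\varphi)(y)\qquad\text{for almost every } y\in\Omega^\#.$$ Moreover, the spectral radius of $\mathcal P$ is strictly less than one. -/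

import Mathlib

open MeasureTheory Filter Topology
open scoped ENNReal

namespace HalfGuide

/-- The space `ℝⁿ` with `n = d + 1`. The coordinate `Fin.last d` is the longitudinal variable `yₙ`,
the coordinates `Fin.castSucc i` are the transverse ones. -/
abbrev Space (d : ℕ) : Type := Fin (d + 1) → ℝ

/-- The half-cylinder `(0,1)ⁿ⁻¹ × (0,∞)`. -/
def guide (d : ℕ) : Set (Space d) :=
  {y | ∀ j, 0 < y j ∧ (j ≠ Fin.last d → y j < 1)}

/-- The cross-section of the half-cylinder by `{yᵢ = a}`, in the coordinates `yⱼ`, `j ≠ i`: each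
transverse coordinate runs through `(0,1)` and the longitudinal one through `(0,∞)`. In particular
`face (Fin.last d)` is the open unit cube `(0,1)ⁿ⁻¹`. -/
def face {d : ℕ} (i : Fin (d + 1)) : Set (Fin d → ℝ) :=
  {z | ∀ j, 0 < z j ∧ (i.succAbove j ≠ Fin.last d → z j < 1)}

/-- The point of `ℝⁿ` whose `i`-th coordinate is `a` and whose other coordinates are `z`. -/
def facePoint {d : ℕ} (i : Fin (d + 1)) (a : ℝ) (z : Fin d → ℝ) : Space d :=
  Fin.insertNth (α := fun _ => ℝ) i a z

/-- `L²` of the half-cylinder. -/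
abbrev GuideL2 (d : ℕ) : Type := Lp ℂ 2 (volume.restrict (guide d))

/-- `L²` of the cross-section `{yₙ = a}`, that is, `L²((0,1)ⁿ⁻¹)`; it does not depend on `a`. -/
abbrev SectionL2 (d : ℕ) : Type := Lp ℂ 2 (volume.restrict (face (Fin.last d)))

/-- Compactly supported smooth functions on `ℝⁿ`. -/
def IsTest {d : ℕ} (V : Space d → ℂ) : Prop :=
  ContDiff ℝ ((⊤ : ℕ∞) : WithTop ℕ∞) V ∧ HasCompactSupport V

/-- The directional derivative `θ · ∇V` of a smooth function. -/
noncomputable def dirDeriv {d : ℕ} (θ : Space d) (V : Space d → ℂ) (y : Space d) : ℂ :=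
  fderiv ℝ V y θ

/-- `G = θ · ∇U` in the sense of distributions in the half-cylinder. -/
def HasWeakDirDeriv {d : ℕ} (θ : Space d) (U G : Space d → ℂ) : Prop :=
  ∀ V : Space d → ℂ, IsTest V → tsupport V ⊆ guide d →
    ∫ y in guide d, U y * dirDeriv θ V y = -∫ y in guide d, G y * V y

/-- `U` is in the directional Sobolev space of the half-cylinder, with directional derivative `G`:
`U, G ∈ L²` and `G = θ · ∇U` in the sense of distributions. -/
structure HasH1Deriv {d : ℕ} (θ : Space d) (U G : Space d → ℂ) : Prop where
  memLp : MemLp U 2 (volume.restrict (guide d))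
  memLp_deriv : MemLp G 2 (volume.restrict (guide d))
  weakDeriv : HasWeakDirDeriv θ U G

/-- `g ∈ L²_loc` of the cross-section is the trace of `U` on `{yᵢ = a}`. The trace operator is the
extension by continuity of the restriction of smooth compactly supported functions: `U` is the limit
in the directional Sobolev space of such functions, whose restrictions converge to `g` in `L²_loc`
of the (relatively open) cross-section. -/
def HasTrace {d : ℕ} (θ : Space d) (i : Fin (d + 1)) (a : ℝ) (U : Space d → ℂ)
    (g : (Fin d → ℝ) → ℂ) : Prop :=
  (∀ K : Set (Fin d → ℝ), IsCompact K → K ⊆ face i → MemLp g 2 (volume.restrict K)) ∧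
  ∃ G : Space d → ℂ, HasH1Deriv θ U G ∧
    ∃ V : ℕ → Space d → ℂ, (∀ k, IsTest (V k)) ∧
      Tendsto (fun k => eLpNorm (fun y => V k y - U y) 2 (volume.restrict (guide d)))
        atTop (𝓝 0) ∧
      Tendsto (fun k => eLpNorm (fun y => dirDeriv θ (V k) y - G y) 2 (volume.restrict (guide d)))
        atTop (𝓝 0) ∧
      ∀ K : Set (Fin d → ℝ), IsCompact K → K ⊆ face i →
        Tendsto (fun k => eLpNorm (fun z => V k (facePoint i a z) - g z) 2 (volume.restrict K))
          atTop (𝓝 0)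

/-- `U` has the same trace on `{yᵢ = 0}`
and on `{yᵢ = 1}`, for every transverse coordinate `yᵢ`. -/
def HasPeriodicTraces {d : ℕ} (θ : Space d) (U : Space d → ℂ) : Prop :=
  ∀ i : Fin d, ∃ g : (Fin d → ℝ) → ℂ,
    HasTrace θ i.castSucc 0 U g ∧ HasTrace θ i.castSucc 1 U g

/-- `U` is a solution of the half-guide problem with boundary data `φ`: with `D = θ · ∇` and
`G = D U ∈ L²`,
* `-D (μ D U) - ρ ω² U = 0` in the sense of distributions in the half-cylinder;
* the trace of `U` on `{yₙ = 0}` is `φ`;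
* `U`, and also `μ D U`, has equal traces on opposite lateral faces. -/
def IsSolution {d : ℕ} (θ : Space d) (μ ρ : Space d → ℝ) (ω : ℂ)
    (φ : SectionL2 d) (U : GuideL2 d) : Prop :=
  ∃ G : Space d → ℂ, HasH1Deriv θ U G ∧
    HasWeakDirDeriv θ (fun y => (μ y : ℂ) * G y) (fun y => -((ρ y : ℂ) * ω ^ 2 * U y)) ∧
    HasTrace θ (Fin.last d) 0 U φ ∧
    HasPeriodicTraces θ U ∧
    HasPeriodicTraces θ (fun y => (μ y : ℂ) * G y)

/-- `P` is the propagation operator: it maps `φ` to the trace on `{yₙ = 1}` of the solution of the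
half-guide problem with boundary data `φ`. -/
def IsPropagationOperator {d : ℕ} (θ : Space d) (μ ρ : Space d → ℝ) (ω : ℂ)
    (P : SectionL2 d →L[ℂ] SectionL2 d) : Prop :=
  ∀ (φ : SectionL2 d) (U : GuideL2 d), IsSolution θ μ ρ ω φ U → HasTrace θ (Fin.last d) 1 U (P φ)

end HalfGuide

open scoped InnerProductSpace

namespace HalfGuide

variable {d : ℕ}

/-! ### Geometry of the half-cylinder -/

/-! The problem is treated through an equivalent weak formulation on the Hilbert space `perSpace θ`:
the closure of the smooth functions that are periodic in the transverse variables, in the graph norm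
of `D = θ · ∇` augmented by the norms of the traces on `yₙ = 0` and `yₙ = 1`. A weak solution
`IsWeakSol` is a pair `(U, G)` satisfying Green's formula with boundary term `φ`, for which `μ G`
has periodic derivative `-ρ ω² U`.

Existence and uniqueness. The unknown is the flux `F = μ D U`, with derivative `F' = -ρ ω² U`. Since
`D U = F / μ` and `U = -F' / (ρ ω²)`, Green's formula for `U` is a variational equation for `F`, in
which the Dirichlet datum `φ` appears as a natural boundary term; no lifting of `φ` is needed. After
multiplication by `ω` the imaginary part of the form is definite because `Im ω > 0`
(`Coeffs.exists_coercive`), so a Lax–Milgram argument yields a bounded solution operator `S`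
(`Coeffs.exists_solution_operator`). That every periodic weakly differentiable pair lies in the
closure of the test functions is `exists_lift`: the part of the pair orthogonal to the test
functions would satisfy `D A = B`, `D B = A` with `B` of zero trace, and translation along `θ`
excludes this in `L²`.

Equivalence with the original problem. Lateral traces are only `L²_loc` on the faces, so Green's
formula is available at first only for test functions vanishing near the edges where faces meet. The
edges have codimension two: a cutoff at scale `ε` has directional derivative `O(1/ε)` on a set of
volume `O(ε²)`, and its contribution disappears in the limit (`TendstoH1.green_perTest`). Existence
and uniqueness of traces come from integrating along lines in the direction `θ`, which is
transversal to all faces (`exists_weighted_trace_estimate`).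

Propagation. Periodicity of the coefficients makes `U(· + eₙ)` the solution with datum `P φ`, and
uniqueness gives the iterated identity. For the spectral radius, let `N(φ) = ‖U‖² + ‖D U‖²` over the
whole half-cylinder. Then `N(φ) - N(P φ)` is the same quantity over the first cell, which bounds
`‖φ‖²` from above up to a constant by the trace estimate. As `N(φ) ≤ B ‖φ‖²`, each application of
`P` decreases `N` by a fixed factor (`spectralRadius_lt_one_of_dissipation`). -/

lemma isOpen_guide : IsOpen (guide d) := by
  have : guide d = ⋂ j : Fin (d + 1), {y : Space d | 0 < y j ∧ (j ≠ Fin.last d → y j < 1)} := by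
    ext y; simp [guide]
  rw [this]
  refine isOpen_iInter_of_finite fun j => ?_
  by_cases h : j = Fin.last d
  · simpa [h] using isOpen_lt continuous_const (continuous_apply (Fin.last d))
  · simpa [h, Set.ofPred_and] using (isOpen_lt continuous_const (continuous_apply j)).inter
      (isOpen_lt (continuous_apply j) continuous_const)

lemma measurableSet_guide : MeasurableSet (guide d) := isOpen_guide.measurableSet

lemma isOpen_face (i : Fin (d + 1)) : IsOpen (face i) := by
  have : face i = ⋂ j : Fin d, {z : Fin d → ℝ | 0 < z j ∧
      (i.succAbove j ≠ Fin.last d → z j < 1)} := by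
    ext y; simp [face]
  rw [this]
  refine isOpen_iInter_of_finite fun j => ?_
  by_cases h : i.succAbove j = Fin.last d
  · simpa [h] using isOpen_lt continuous_const (continuous_apply j)
  · simpa [h, Set.ofPred_and] using (isOpen_lt continuous_const (continuous_apply j)).inter
      (isOpen_lt (continuous_apply j) continuous_const)

lemma measurableSet_face (i : Fin (d + 1)) : MeasurableSet (face i) := (isOpen_face i).measurableSet

/-- The upper corner of the box `(0,1)ⁿ⁻¹ × (0,R)`. -/
def topCorner (d : ℕ) (R : ℝ) : Space d := fun j => if j = Fin.last d then R else 1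

@[simp] lemma topCorner_last (R : ℝ) : topCorner d R (Fin.last d) = R := by simp [topCorner]

lemma topCorner_of_ne {j : Fin (d + 1)} (hj : j ≠ Fin.last d) (R : ℝ) : topCorner d R j = 1 := by
  simp [topCorner, hj]

@[simp] lemma topCorner_castSucc (j : Fin d) (R : ℝ) : topCorner d R j.castSucc = 1 :=
  topCorner_of_ne (Fin.castSucc_lt_last j).ne R

lemma topCorner_pos {R : ℝ} (hR : 0 < R) (j : Fin (d + 1)) : 0 < topCorner d R j := by
  unfold topCorner; split_ifs <;> simp [hR]

lemma guide_inter (R : ℝ) : guide d ∩ {y | y (Fin.last d) < R} =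
    Set.pi Set.univ fun j => Set.Ioo 0 (topCorner d R j) := by
  ext y
  simp only [guide, Set.mem_inter_iff, Set.mem_ofPred_eq, Set.mem_pi, Set.mem_univ, Set.mem_Ioo,
    true_implies]
  constructor
  · rintro ⟨h, hR⟩ j
    refine ⟨(h j).1, ?_⟩
    by_cases hj : j = Fin.last d
    · subst hj; simpa using hR
    · rw [topCorner_of_ne hj]; exact (h j).2 hj
  · intro h
    refine ⟨fun j => ⟨(h j).1, fun hj => ?_⟩, by simpa using (h (Fin.last d)).2⟩
    simpa [topCorner_of_ne hj] using (h j).2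

lemma face_inter (i : Fin (d + 1)) (R : ℝ) :
    face i ∩ {z | ∀ j, i.succAbove j = Fin.last d → z j < R} =
    Set.pi Set.univ fun j => Set.Ioo 0 (topCorner d R (i.succAbove j)) := by
  ext y
  simp only [face, Set.mem_inter_iff, Set.mem_ofPred_eq, Set.mem_pi, Set.mem_univ, Set.mem_Ioo,
    true_implies]
  constructor
  · rintro ⟨h, hR⟩ j
    refine ⟨(h j).1, ?_⟩
    by_cases hj : i.succAbove j = Fin.last d
    · rw [hj]; simpa using hR j hj
    · rw [topCorner_of_ne hj]; exact (h j).2 hj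
  · intro h
    refine ⟨fun j => ⟨(h j).1, fun hj => ?_⟩, fun j hj => ?_⟩
    · simpa [topCorner_of_ne hj] using (h j).2
    · simpa [hj] using (h j).2

lemma mem_face_last {z : Fin d → ℝ} : z ∈ face (Fin.last d) ↔ ∀ j, 0 < z j ∧ z j < 1 := by
  simp [face, (Fin.castSucc_lt_last _).ne]

lemma facePoint_self (i : Fin (d + 1)) (a : ℝ) (z : Fin d → ℝ) : facePoint i a z i = a := by
  simp [facePoint]

lemma facePoint_succAbove (i : Fin (d + 1)) (a : ℝ) (z : Fin d → ℝ) (j : Fin d) :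
    facePoint i a z (i.succAbove j) = z j := by
  simp [facePoint]

lemma facePoint_last_castSucc (a : ℝ) (z : Fin d → ℝ) (j : Fin d) :
    facePoint (Fin.last d) a z j.castSucc = z j := by
  rw [← Fin.succAbove_last]; exact facePoint_succAbove _ a z j

lemma facePoint_add_smul (i : Fin (d + 1)) (a t : ℝ) (z : Fin d → ℝ) (θ : Space d) :
    facePoint i a z + t • θ = facePoint i (a + t * θ i) (z + t • fun j => θ (i.succAbove j)) := by
  ext k
  rcases Fin.eq_self_or_eq_succAbove i k with rfl | ⟨j, rfl⟩
  · simp [facePoint_self]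
  · simp [facePoint_succAbove]

lemma facePoint_add_single (i : Fin (d + 1)) (a b : ℝ) (z : Fin d → ℝ) :
    facePoint i a z + Pi.single i b = facePoint i (a + b) z := by
  ext k
  rcases Fin.eq_self_or_eq_succAbove i k with rfl | ⟨j, rfl⟩
  · simp [facePoint_self]
  · simp [facePoint_succAbove, Fin.succAbove_ne]

lemma continuous_facePoint (i : Fin (d + 1)) :
    Continuous fun p : ℝ × (Fin d → ℝ) => facePoint i p.1 p.2 := by
  refine continuous_pi fun k => ?_
  rcases Fin.eq_self_or_eq_succAbove i k with rfl | ⟨j, rfl⟩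
  · simpa [facePoint_self] using continuous_fst
  · simp only [facePoint_succAbove]; fun_prop

lemma continuous_facePoint_right (i : Fin (d + 1)) (a : ℝ) : Continuous (facePoint i a) :=
  (continuous_facePoint i).comp (by fun_prop : Continuous fun z : Fin d → ℝ => (a, z))

lemma facePoint_mem_guide {i : Fin (d + 1)} {a : ℝ} {z : Fin d → ℝ} :
    facePoint i a z ∈ guide d ↔ (0 < a ∧ (i ≠ Fin.last d → a < 1)) ∧ z ∈ face i := by
  constructor
  · intro h
    refine ⟨by simpa [facePoint_self] using h i, fun j => ?_⟩
    simpa [facePoint_succAbove] using h (i.succAbove j)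
  · rintro ⟨h1, h2⟩ k
    rcases Fin.eq_self_or_eq_succAbove i k with rfl | ⟨j, rfl⟩
    · simpa [facePoint_self] using h1
    · simpa [facePoint_succAbove] using h2 j

/-! ### The divergence theorem -/

lemma dirDeriv_eq_sum (θ : Space d) (V : Space d → ℂ) (y : Space d) :
    dirDeriv θ V y = ∑ i, (θ i : ℂ) * fderiv ℝ V y (Pi.single i 1) := by
  have : θ = ∑ i, θ i • (Pi.single i (1 : ℝ) : Space d) := by
    ext k; simp [Finset.sum_apply, Pi.single_apply]
  rw [dirDeriv]
  conv_lhs => rw [this]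
  simp [map_sum]

lemma continuous_dirDeriv (θ : Space d) {V : Space d → ℂ} (hV : ContDiff ℝ 1 V) :
    Continuous (dirDeriv θ V) :=
  (hV.continuous_fderiv one_ne_zero).clm_apply continuous_const

/-- Functions vanishing at large height see only a bounded box, where the divergence theorem
applies; the open and closed boxes differ by a null set. -/
lemma setIntegral_guide_eq {f : Space d → ℂ} {R : ℝ}
    (hf : ∀ y, R ≤ y (Fin.last d) → f y = 0) :
    ∫ y in guide d, f y = ∫ y in Set.Icc 0 (topCorner d R), f y := by
  have h1 : ∫ y in guide d, f y = ∫ y in guide d ∩ {y | y (Fin.last d) < R}, f y := by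
    apply setIntegral_eq_of_subset_of_forall_sdiff_eq_zero measurableSet_guide Set.inter_subset_left
    rintro y ⟨h, h'⟩
    exact hf y (by simpa [h] using h')
  rw [h1, guide_inter, volume_pi]
  exact setIntegral_congr_set Measure.univ_pi_Ioo_ae_eq_Icc

lemma setIntegral_face_eq (i : Fin (d + 1)) {f : (Fin d → ℝ) → ℂ} {R : ℝ}
    (hf : ∀ z j, i.succAbove j = Fin.last d → R ≤ z j → f z = 0) :
    ∫ z in face i, f z = ∫ z in Set.Icc 0 (topCorner d R ∘ i.succAbove), f z := by
  have h1 : ∫ y in face i, f y =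
      ∫ y in face i ∩ {z | ∀ j, i.succAbove j = Fin.last d → z j < R}, f y := by
    apply setIntegral_eq_of_subset_of_forall_sdiff_eq_zero (measurableSet_face i)
      Set.inter_subset_left
    rintro y ⟨h, h'⟩
    have h'' : ¬ ∀ j, i.succAbove j = Fin.last d → y j < R := fun h2 => h' ⟨h, h2⟩
    push Not at h''
    obtain ⟨j, hj, hR⟩ := h''
    exact hf y j hj hR
  rw [h1, face_inter, volume_pi]
  exact setIntegral_congr_set Measure.univ_pi_Ioo_ae_eq_Icc

lemma dirDeriv_eq_zero_of_le {θ : Space d} {V : Space d → ℂ} {R : ℝ}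
    (hV : ∀ y, R ≤ y (Fin.last d) → V y = 0) {y : Space d} (hy : R < y (Fin.last d)) :
    dirDeriv θ V y = 0 := by
  have : V =ᶠ[𝓝 y] fun _ => 0 := by
    filter_upwards [(isOpen_lt continuous_const (continuous_apply (Fin.last d))).mem_nhds hy]
      with x hx using hV x (le_of_lt hx)
  rw [dirDeriv, this.fderiv_eq]; simp

/-- The divergence theorem in the half-cylinder. -/
theorem integral_dirDeriv (θ : Space d) {V : Space d → ℂ} (hV : ContDiff ℝ 1 V) {R : ℝ}
    (hR : ∀ y, R ≤ y (Fin.last d) → V y = 0) :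
    ∫ y in guide d, dirDeriv θ V y =
      (∑ i : Fin d, (θ i.castSucc : ℂ) * ((∫ z in face i.castSucc, V (facePoint i.castSucc 1 z)) -
        ∫ z in face i.castSucc, V (facePoint i.castSucc 0 z)))
      - θ (Fin.last d) * ∫ z in face (Fin.last d), V (facePoint (Fin.last d) 0 z) := by
  -- The height is strictly above `R`, so that the derivative vanishes from there on as well as `V`,
  -- and positive, so that the box is nondegenerate. The top face then contributes nothing.
  set R' := max R 0 + 1 with hR'
  have hR0 : 0 < R' := by positivity
  have hRR : R < R' := by have := le_max_left R 0; linarith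
  have hV' : ∀ y, R' ≤ y (Fin.last d) → V y = 0 := fun y h => hR y (by linarith)
  rw [setIntegral_guide_eq (R := R')
    (fun y hy => dirDeriv_eq_zero_of_le hR (hRR.trans_le hy))]
  have hle : (0 : Space d) ≤ topCorner d R' := fun j => (topCorner_pos hR0 j).le
  have key := integral_divergence_of_hasFDerivAt_off_countable' (0 : Space d) (topCorner d R') hle
    (fun i y => (θ i : ℂ) * V y) (fun i y => (θ i : ℂ) • fderiv ℝ V y) ∅ Set.countable_empty
    (fun i => (continuous_const.mul hV.continuous).continuousOn)
    (fun x _ i => ((hV.differentiable one_ne_zero x).hasFDerivAt).const_mul _)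
    (by
      have : Continuous fun x => ∑ i, ((θ i : ℂ) • fderiv ℝ V x) (Pi.single i 1) := by
        have h1 := hV.continuous_fderiv one_ne_zero
        refine continuous_finsetSum _ fun i _ => ?_
        exact (h1.clm_apply continuous_const).const_smul (θ i : ℂ)
      exact this.continuousOn.integrableOn_compact isCompact_Icc)
  have e1 : ∀ y, ∑ i, ((θ i : ℂ) • fderiv ℝ V y) (Pi.single i 1) = dirDeriv θ V y := by
    intro y; rw [dirDeriv_eq_sum]; simp
  simp only [e1] at key
  rw [key, Fin.sum_univ_castSucc, sub_eq_add_neg (∑ i : Fin d, _)]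
  congr 1
  · refine Finset.sum_congr rfl fun i _ => ?_
    have hf : ∀ a : ℝ, ∀ z j, i.castSucc.succAbove j = Fin.last d → R' ≤ z j →
        V (facePoint i.castSucc a z) = 0 := by
      intro a z j hj hz
      apply hV'
      rw [← hj, facePoint_succAbove]; exact hz
    rw [setIntegral_face_eq _ (hf 1), setIntegral_face_eq _ (hf 0), mul_sub,
      ← integral_const_mul, ← integral_const_mul]
    simp only [topCorner_castSucc]
    rfl
  · rw [topCorner_last]
    have hz : ∀ z, V ((Fin.last d).insertNth (α := fun _ => ℝ) R' z) = 0 := fun z =>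
      hV' _ (by simp)
    have hf : ∀ z j, (Fin.last d).succAbove j = Fin.last d → R' ≤ z j →
        V (facePoint (Fin.last d) 0 z) = 0 := by
      intro z j hj; exact absurd hj (Fin.succAbove_ne _ _)
    rw [setIntegral_face_eq _ hf, ← integral_const_mul]
    simp only [hz, mul_zero, integral_zero, zero_sub]
    rfl

/-! ### Directional derivatives of smooth functions -/

lemma dirDeriv_mul (θ : Space d) {V W : Space d → ℂ} {y : Space d}
    (hV : DifferentiableAt ℝ V y) (hW : DifferentiableAt ℝ W y) :
    dirDeriv θ (fun x => V x * W x) y = V y * dirDeriv θ W y + W y * dirDeriv θ V y := by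
  simp only [dirDeriv]
  rw [fderiv_fun_mul hV hW]
  simp

lemma dirDeriv_add (θ : Space d) {V W : Space d → ℂ} {y : Space d}
    (hV : DifferentiableAt ℝ V y) (hW : DifferentiableAt ℝ W y) :
    dirDeriv θ (fun x => V x + W x) y = dirDeriv θ V y + dirDeriv θ W y := by
  simp only [dirDeriv]
  rw [fderiv_fun_add hV hW]
  simp

lemma dirDeriv_sub (θ : Space d) {V W : Space d → ℂ} {y : Space d}
    (hV : DifferentiableAt ℝ V y) (hW : DifferentiableAt ℝ W y) :
    dirDeriv θ (fun x => V x - W x) y = dirDeriv θ V y - dirDeriv θ W y := by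
  simp only [dirDeriv]
  rw [fderiv_fun_sub hV hW]
  simp

lemma dirDeriv_const_mul (θ : Space d) (c : ℂ) {V : Space d → ℂ} {y : Space d}
    (hV : DifferentiableAt ℝ V y) :
    dirDeriv θ (fun x => c * V x) y = c * dirDeriv θ V y := by
  simp only [dirDeriv]
  rw [fderiv_const_mul hV]
  simp

lemma dirDeriv_conj (θ : Space d) {V : Space d → ℂ} {y : Space d}
    (hV : DifferentiableAt ℝ V y) :
    dirDeriv θ (fun x => (starRingEnd ℂ) (V x)) y = (starRingEnd ℂ) (dirDeriv θ V y) := by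
  have h := (Complex.conjCLE.toContinuousLinearMap.hasFDerivAt (x := V y)).comp y hV.hasFDerivAt
  have h2 : HasFDerivAt (fun x => (starRingEnd ℂ) (V x))
    (Complex.conjCLE.toContinuousLinearMap.comp (fderiv ℝ V y)) y := h
  simp only [dirDeriv]
  rw [h2.fderiv]
  simp

lemma dirDeriv_comp_add (θ : Space d) (V : Space d → ℂ) (v y : Space d) :
    dirDeriv θ (fun x => V (x + v)) y = dirDeriv θ V (y + v) := by
  simp only [dirDeriv]
  rw [fderiv_comp_add_right]

lemma contDiff_dirDeriv (θ : Space d) {V : Space d → ℂ}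
    (hV : ContDiff ℝ ((⊤ : ℕ∞) : WithTop ℕ∞) V) :
    ContDiff ℝ ((⊤ : ℕ∞) : WithTop ℕ∞) (dirDeriv θ V) :=
  (hV.fderiv_right (m := ((⊤ : ℕ∞) : WithTop ℕ∞)) (by simp)).clm_apply contDiff_const

lemma hasDerivAt_line (θ : Space d) {V : Space d → ℂ} (y : Space d) (t : ℝ)
    (hV : DifferentiableAt ℝ V (y + t • θ)) :
    HasDerivAt (fun s : ℝ => V (y + s • θ)) (dirDeriv θ V (y + t • θ)) t := by
  have h1 : HasDerivAt (fun s : ℝ => y + s • θ) θ t := by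
    simpa using ((hasDerivAt_id t).smul_const θ).const_add y
  exact hV.hasFDerivAt.comp_hasDerivAt t h1

/-! ### Smooth periodic test functions -/

/-- Smooth functions on `ℝⁿ` that are `1`-periodic in the transverse variables and vanish for large
`yₙ`. -/
structure PerTest (V : Space d → ℂ) : Prop where
  smooth : ContDiff ℝ ((⊤ : ℕ∞) : WithTop ℕ∞) V
  periodic : ∀ y (i : Fin d), V (y + Pi.single i.castSucc 1) = V y
  vanish : ∃ R, ∀ y, R ≤ y (Fin.last d) → V y = 0

/-- Periodic test functions that vanish near `{yₙ = 0}`. -/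
structure PerTest₀ (V : Space d → ℂ) : Prop extends PerTest V where
  vanish_bot : ∃ ε > 0, ∀ y, y (Fin.last d) ≤ ε → V y = 0

namespace PerTest

variable {V W : Space d → ℂ}

lemma contDiff_one (hV : PerTest V) : ContDiff ℝ 1 V := hV.smooth.of_le (by
  exact_mod_cast le_top)

lemma differentiable (hV : PerTest V) : Differentiable ℝ V :=
  hV.contDiff_one.differentiable one_ne_zero

lemma continuous (hV : PerTest V) : Continuous V := hV.smooth.continuous

lemma add (hV : PerTest V) (hW : PerTest W) : PerTest (fun y => V y + W y) where
  smooth := hV.smooth.add hW.smooth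
  periodic y i := by simp only [hV.periodic, hW.periodic]
  vanish := by
    obtain ⟨R, hR⟩ := hV.vanish
    obtain ⟨R', hR'⟩ := hW.vanish
    exact ⟨max R R', fun y hy => by
      rw [hR y ((le_max_left _ _).trans hy), hR' y ((le_max_right _ _).trans hy), add_zero]⟩

lemma mul (hV : PerTest V) (hW : PerTest W) : PerTest (fun y => V y * W y) where
  smooth := hV.smooth.mul hW.smooth
  periodic y i := by simp only [hV.periodic, hW.periodic]
  vanish := by
    obtain ⟨R, hR⟩ := hV.vanish
    exact ⟨R, fun y hy => by rw [hR y hy, zero_mul]⟩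

lemma const_mul (c : ℂ) (hV : PerTest V) : PerTest (fun y => c * V y) where
  smooth := contDiff_const.mul hV.smooth
  periodic y i := by simp only [hV.periodic]
  vanish := by
    obtain ⟨R, hR⟩ := hV.vanish
    exact ⟨R, fun y hy => by rw [hR y hy, mul_zero]⟩

lemma zero : PerTest (fun _ : Space d => (0 : ℂ)) where
  smooth := contDiff_const
  periodic _ _ := rfl
  vanish := ⟨0, fun _ _ => rfl⟩

lemma conj (hV : PerTest V) : PerTest (fun y => (starRingEnd ℂ) (V y)) where
  smooth := Complex.conjCLE.contDiff.comp hV.smooth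
  periodic y i := by simp only [hV.periodic]
  vanish := by
    obtain ⟨R, hR⟩ := hV.vanish
    exact ⟨R, fun y hy => by rw [hR y hy, map_zero]⟩

lemma dirDeriv (θ : Space d) (hV : PerTest V) : PerTest (HalfGuide.dirDeriv θ V) where
  smooth := contDiff_dirDeriv θ hV.smooth
  periodic y i := by
    rw [← dirDeriv_comp_add]
    congr 1
    ext x
    exact hV.periodic x i
  vanish := by
    obtain ⟨R, hR⟩ := hV.vanish
    exact ⟨R + 1, fun y hy => dirDeriv_eq_zero_of_le hR (by linarith)⟩

lemma comp_add (v : Space d) (hV : PerTest V) : PerTest (fun y => V (y + v)) where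
  smooth := hV.smooth.comp (contDiff_id.add contDiff_const)
  periodic y i := by rw [add_right_comm, hV.periodic]
  vanish := by
    obtain ⟨R, hR⟩ := hV.vanish
    exact ⟨R - v (Fin.last d), fun y hy => hR _ (by simp; linarith)⟩

end PerTest

namespace PerTest₀

variable {V W : Space d → ℂ}

lemma dirDeriv (θ : Space d) (hV : PerTest₀ V) : PerTest₀ (HalfGuide.dirDeriv θ V) where
  toPerTest := hV.toPerTest.dirDeriv θ
  vanish_bot := by
    obtain ⟨ε, hε, h⟩ := hV.vanish_bot
    refine ⟨ε / 2, by positivity, fun y hy => ?_⟩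
    have : V =ᶠ[𝓝 y] fun _ => 0 := by
      filter_upwards [(isOpen_lt (continuous_apply (Fin.last d)) continuous_const).mem_nhds
        (show y (Fin.last d) < ε by linarith)] with x hx using h x (le_of_lt hx)
    rw [HalfGuide.dirDeriv, this.fderiv_eq]; simp

lemma comp_sub {v : Space d} (hv : 0 ≤ v (Fin.last d)) (hV : PerTest₀ V) :
    PerTest₀ (fun y => V (y - v)) where
  toPerTest := by simpa [sub_eq_add_neg] using hV.toPerTest.comp_add (-v)
  vanish_bot := by
    obtain ⟨ε, hε, h⟩ := hV.vanish_bot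
    exact ⟨ε, hε, fun y hy => h _ (by simp; linarith)⟩

end PerTest₀

/-! ### Reduction modulo the transverse lattice; boundedness and integrability -/

/-- The representative of `y` modulo integer translations in the transverse directions. -/
noncomputable def wrap (y : Space d) : Space d :=
  fun j => if j = Fin.last d then y j else Int.fract (y j)

@[simp] lemma wrap_last (y : Space d) : wrap y (Fin.last d) = y (Fin.last d) := by simp [wrap]

@[simp] lemma wrap_castSucc (y : Space d) (i : Fin d) :
    wrap y i.castSucc = Int.fract (y i.castSucc) := by
  simp [wrap, (Fin.castSucc_lt_last i).ne]

lemma sum_single_castSucc_apply (m : Fin d → ℤ) (i : Fin d) :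
    (∑ i : Fin d, m i • (Pi.single i.castSucc 1 : Space d)) i.castSucc = m i := by
  simp [Finset.sum_apply, Pi.single_apply]

lemma sum_single_last_apply (m : Fin d → ℤ) :
    (∑ i : Fin d, m i • (Pi.single i.castSucc 1 : Space d)) (Fin.last d) = 0 := by
  simp [Finset.sum_apply, (Fin.castSucc_lt_last _).ne']

lemma wrap_add_sum (y : Space d) :
    wrap y + ∑ i : Fin d, ⌊y i.castSucc⌋ • (Pi.single i.castSucc 1 : Space d) = y := by
  ext j
  refine Fin.lastCases ?_ (fun i => ?_) j
  · rw [Pi.add_apply, sum_single_last_apply]; simp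
  · rw [Pi.add_apply, sum_single_castSucc_apply]; simp

lemma PerTest.apply_wrap {V : Space d → ℂ} (hV : PerTest V) (y : Space d) : V (wrap y) = V y := by
  have key : ∀ (s : Finset (Fin d)) (m : Fin d → ℤ) (y : Space d),
      V (y + ∑ i ∈ s, m i • (Pi.single i.castSucc 1 : Space d)) = V y := by
    intro s m
    induction s using Finset.induction_on with
    | empty => simp
    | insert a s ha ih =>
      intro y
      have hp : Function.Periodic V (Pi.single a.castSucc 1) := fun y => hV.periodic y a
      rw [Finset.sum_insert ha, ← add_assoc, ih]
      exact hp.zsmul (m a) y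
  conv_rhs => rw [← wrap_add_sum y]
  rw [key]

/-- Modulo transverse integer translations, the slab between height `L` and the vanishing height
lies in a compact box. The lower bound `L` is needed because nothing constrains `V` as `yₙ → -∞`. -/
lemma PerTest.bounded {V : Space d → ℂ} (hV : PerTest V) (L : ℝ) :
    ∃ M, 0 ≤ M ∧ ∀ y, L ≤ y (Fin.last d) → ‖V y‖ ≤ M := by
  obtain ⟨R, hR⟩ := hV.vanish
  let lo : Space d := fun j => if j = Fin.last d then L else 0
  obtain ⟨M, hM⟩ := (isCompact_Icc (a := lo) (b := topCorner d R)).exists_bound_of_continuousOn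
    hV.continuous.continuousOn
  refine ⟨max M 0, le_max_right _ _, fun y hy => ?_⟩
  by_cases h : R ≤ y (Fin.last d)
  · rw [hR y h]; simp
  · refine le_trans ?_ (le_max_left _ _)
    rw [← hV.apply_wrap]
    push Not at h
    refine hM _ ⟨fun j => ?_, fun j => ?_⟩
    · by_cases hj : j = Fin.last d
      · subst hj; simpa [lo] using hy
      · simp [lo, hj, wrap, Int.fract_nonneg]
    · by_cases hj : j = Fin.last d
      · subst hj; simpa [lo] using h.le
      · simp [topCorner, hj, wrap, (Int.fract_lt_one _).le]

lemma memLp_guide {f : Space d → ℂ} (hf : Continuous f) {R : ℝ}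
    (hR : ∀ y, R ≤ y (Fin.last d) → f y = 0) (p : ℝ≥0∞) :
    MemLp f p (volume.restrict (guide d)) := by
  set K : Set (Space d) := Set.Icc 0 (topCorner d R) with hK
  obtain ⟨M, hM⟩ := (isCompact_Icc (a := (0 : Space d)) (b := topCorner d R)).exists_bound_of_continuousOn
    hf.continuousOn
  have hKm : MeasurableSet K := measurableSet_Icc
  have : IsFiniteMeasure (volume.restrict K) := ⟨by
    simpa using isCompact_Icc.measure_lt_top⟩
  have h1 : MemLp f p (volume.restrict K) :=
    MemLp.of_bound hf.aestronglyMeasurable M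
      ((ae_restrict_iff' hKm).2 (Eventually.of_forall fun y hy => hM y hy))
  have h2 : MemLp (K.indicator f) p volume := (memLp_indicator_iff_restrict hKm).2 h1
  refine (h2.restrict (guide d)).ae_eq ?_
  refine (ae_restrict_iff' measurableSet_guide).2 (Eventually.of_forall fun y hy => ?_)
  by_cases h : y ∈ K
  · simp [h]
  · rw [Set.indicator_of_notMem h, hR]
    by_contra h'
    push Not at h'
    refine h ⟨fun j => (hy j).1.le, fun j => ?_⟩
    by_cases hj : j = Fin.last d
    · subst hj; simpa using h'.le
    · rw [topCorner_of_ne hj]; exact ((hy j).2 hj).le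

lemma PerTest.memLp {V : Space d → ℂ} (hV : PerTest V) (p : ℝ≥0∞) :
    MemLp V p (volume.restrict (guide d)) := by
  obtain ⟨R, hR⟩ := hV.vanish
  exact memLp_guide hV.continuous hR p

lemma volume_face_last : volume (face (Fin.last d)) = 1 := by
  have h := face_inter (Fin.last d) 0
  simp only [Fin.succAbove_ne, false_imp_iff, implies_true] at h
  have h2 : face (Fin.last d) = Set.pi Set.univ fun _ : Fin d => Set.Ioo (0 : ℝ) 1 := by
    simpa [Set.ofPred_true] using h
  rw [h2, Real.volume_pi_Ioo]
  simp

instance : IsFiniteMeasure (volume.restrict (face (Fin.last d))) := ⟨by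
  simp [volume_face_last]⟩

lemma memLp_face {f : Space d → ℂ} (hf : Continuous f) (a : ℝ) (p : ℝ≥0∞) :
    MemLp (fun z => f (facePoint (Fin.last d) a z)) p (volume.restrict (face (Fin.last d))) := by
  have hc : Continuous fun z => f (facePoint (Fin.last d) a z) :=
    hf.comp (continuous_facePoint_right _ _)
  obtain ⟨M, hM⟩ := (isCompact_Icc (a := (0 : Fin d → ℝ)) (b := 1)).exists_bound_of_continuousOn
    hc.continuousOn
  refine MemLp.of_bound hc.aestronglyMeasurable M
    ((ae_restrict_iff' (measurableSet_face _)).2 (Eventually.of_forall fun z hz => hM z ?_))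
  rw [mem_face_last] at hz
  exact ⟨fun j => (hz j).1.le, fun j => (hz j).2.le⟩

/-! ### Green's formula and the bottom trace of periodic functions -/

/-- The divergence theorem for periodic functions. -/
lemma PerTest.integral_dirDeriv (θ : Space d) {V : Space d → ℂ} (hV : PerTest V) :
    ∫ y in guide d, HalfGuide.dirDeriv θ V y =
      -(θ (Fin.last d) * ∫ z in face (Fin.last d), V (facePoint (Fin.last d) 0 z)) := by
  obtain ⟨R, hR⟩ := hV.vanish
  rw [HalfGuide.integral_dirDeriv θ hV.contDiff_one hR]
  have : ∀ i : Fin d, ∀ z, V (facePoint i.castSucc 1 z) = V (facePoint i.castSucc 0 z) := by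
    intro i z
    rw [← hV.periodic (facePoint i.castSucc 0 z) i, facePoint_add_single, zero_add]
  simp [this]

lemma PerTest.green (θ : Space d) {V W : Space d → ℂ} (hV : PerTest V) (hW : PerTest W) :
    (∫ y in guide d, V y * HalfGuide.dirDeriv θ W y) +
      (∫ y in guide d, HalfGuide.dirDeriv θ V y * W y) =
      -(θ (Fin.last d) * ∫ z in face (Fin.last d),
        V (facePoint (Fin.last d) 0 z) * W (facePoint (Fin.last d) 0 z)) := by
  rw [← (hV.mul hW).integral_dirDeriv θ, ← integral_add]
  · refine integral_congr_ae (Eventually.of_forall fun y => ?_)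
    simp only
    rw [dirDeriv_mul θ (hV.differentiable y) (hW.differentiable y)]; ring
  · exact memLp_one_iff_integrable.1 ((hV.mul (hW.dirDeriv θ)).memLp 1)
  · exact memLp_one_iff_integrable.1 (((hV.dirDeriv θ).mul hW).memLp 1)

/-- A smooth cutoff that is `1` for `yₙ ≤ 0` and `0` for `yₙ ≥ 1`. -/
noncomputable def cellCutoff (y : Space d) : ℂ := (Real.smoothTransition (1 - y (Fin.last d)) : ℝ)

lemma perTest_cellCutoff : PerTest (cellCutoff (d := d)) where
  smooth := by
    have h1 : ContDiff ℝ ((⊤ : ℕ∞) : WithTop ℕ∞) fun y : Space d => 1 - y (Fin.last d) := by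
      fun_prop
    exact Complex.ofRealCLM.contDiff.comp (Real.smoothTransition.contDiff.comp h1)
  periodic y i := by
    simp [cellCutoff, (Fin.castSucc_lt_last i).ne']
  vanish := ⟨1, fun y hy => by
    simp [cellCutoff, Real.smoothTransition.zero_of_nonpos (sub_nonpos.2 hy)]⟩

/-- The unit cell `(0,1)ⁿ`. -/
def cell (d : ℕ) : Set (Space d) := guide d ∩ {y | y (Fin.last d) < 1}

lemma measurableSet_cell : MeasurableSet (cell d) :=
  measurableSet_guide.inter (measurableSet_lt (measurable_pi_apply _) measurable_const)

/-- Green's formula for `V` and its conjugate has boundary term `-θₙ ∫ |V|²`, and the interior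
integrand is at most `2 |V| |D V|`. -/
lemma trace_estimate_cell_aux (θ : Space d) (hθ : 0 < θ (Fin.last d)) {V : Space d → ℂ}
    (hV : PerTest V) :
    θ (Fin.last d) * ∫ z in face (Fin.last d), ‖V (facePoint (Fin.last d) 0 z)‖ ^ 2 ≤
      ∫ y in guide d, (‖V y‖ ^ 2 + ‖HalfGuide.dirDeriv θ V y‖ ^ 2) := by
  have h := hV.green θ hV.conj
  rw [← integral_add (memLp_one_iff_integrable.1 ((hV.mul (hV.conj.dirDeriv θ)).memLp 1))
    (memLp_one_iff_integrable.1 (((hV.dirDeriv θ).mul hV.conj).memLp 1))] at h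
  have h1 : (∫ z in face (Fin.last d), V (facePoint (Fin.last d) 0 z) *
      (starRingEnd ℂ) (V (facePoint (Fin.last d) 0 z))) =
      ((∫ z in face (Fin.last d), ‖V (facePoint (Fin.last d) 0 z)‖ ^ 2 : ℝ) : ℂ) := by
    rw [← integral_complex_ofReal]
    refine integral_congr_ae (Eventually.of_forall fun z => ?_)
    simp [Complex.mul_conj, Complex.normSq_eq_norm_sq]
  rw [h1] at h
  have h2 := congrArg norm h
  rw [norm_neg, norm_mul, Complex.norm_real, Complex.norm_real, Real.norm_of_nonneg hθ.le,
    Real.norm_of_nonneg (integral_nonneg fun _ => by positivity)] at h2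
  rw [← h2]
  refine (norm_integral_le_integral_norm _).trans ?_
  have hi : ∀ {F : Space d → ℂ}, PerTest F →
      Integrable (fun y => ‖F y‖ ^ 2) (volume.restrict (guide d)) := fun hF => by
    simpa using (hF.memLp 2).integrable_norm_pow (by norm_num)
  refine integral_mono ?_ ((hi hV).add (hi (hV.dirDeriv θ))) fun y => ?_
  · exact (memLp_one_iff_integrable.1
      (((hV.mul (hV.conj.dirDeriv θ)).add ((hV.dirDeriv θ).mul hV.conj)).memLp 1)).norm
  · simp only
    rw [dirDeriv_conj θ (hV.differentiable y)]
    refine (norm_add_le _ _).trans ?_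
    simp only [norm_mul, RCLike.norm_conj]
    nlinarith [sq_nonneg (‖V y‖ - ‖HalfGuide.dirDeriv θ V y‖)]

/-- The trace on `{yₙ = 0}` of a periodic function is controlled by its graph norm in the cell. -/
theorem exists_trace_estimate_cell (θ : Space d) (hθ : 0 < θ (Fin.last d)) :
    ∃ C, 0 ≤ C ∧ ∀ V : Space d → ℂ, PerTest V →
      ∫ z in face (Fin.last d), ‖V (facePoint (Fin.last d) 0 z)‖ ^ 2 ≤
        C * ∫ y in cell d, (‖V y‖ ^ 2 + ‖dirDeriv θ V y‖ ^ 2) := by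
  -- Multiplication by a cutoff equal to `1` on the bottom face and `0` for `yₙ ≥ 1` localizes the
  -- global estimate to one cell.
  have hκ := perTest_cellCutoff (d := d)
  obtain ⟨M, hM0, hM⟩ := hκ.bounded 0
  obtain ⟨N, hN0, hN⟩ := (hκ.dirDeriv θ).bounded 0
  -- The constant collects `|κV|² ≤ M²|V|²` and `|D(κV)|² ≤ 2M²|DV|² + 2N²|V|²`, where `M` and `N`
  -- bound the cutoff `κ` and its derivative.
  set C' := M ^ 2 + 2 * M ^ 2 + 2 * N ^ 2 with hC'
  refine ⟨C' / θ (Fin.last d), by positivity, fun V hV => ?_⟩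
  rw [div_mul_eq_mul_div, le_div_iff₀ hθ, mul_comm]
  have h := trace_estimate_cell_aux θ hθ (hκ.mul hV)
  have hone : ∀ z, cellCutoff (facePoint (Fin.last d) 0 z) = 1 := fun z => by
    simp [cellCutoff, facePoint_self]
  simp only [hone, one_mul] at h
  refine h.trans ?_
  have hzero : ∀ y : Space d, 1 ≤ y (Fin.last d) → cellCutoff y = 0 := fun y hy => by
    simp [cellCutoff, Real.smoothTransition.zero_of_nonpos (sub_nonpos.2 hy)]
  have hi : ∀ {F : Space d → ℂ}, PerTest F →
      Integrable (fun y => ‖F y‖ ^ 2) (volume.restrict (guide d)) := fun hF => by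
    simpa using (hF.memLp 2).integrable_norm_pow (by norm_num)
  have hsub : ∫ y in guide d, (‖cellCutoff y * V y‖ ^ 2 +
      ‖dirDeriv θ (fun y => cellCutoff y * V y) y‖ ^ 2) =
      ∫ y in cell d, (‖cellCutoff y * V y‖ ^ 2 +
      ‖dirDeriv θ (fun y => cellCutoff y * V y) y‖ ^ 2) := by
    have hae : ∀ᵐ y ∂(volume : Measure (Space d)), y (Fin.last d) ≠ 1 :=
      Measure.ae_eval_ne (fun _ : Fin (d + 1) => (volume : Measure ℝ)) (Fin.last d) 1
    refine (setIntegral_eq_of_subset_of_ae_sdiff_eq_zero measurableSet_guide.nullMeasurableSet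
      Set.inter_subset_left ?_)
    filter_upwards [hae] with y hy hmem
    have hlt : 1 < y (Fin.last d) := by
      rcases lt_trichotomy (y (Fin.last d)) 1 with h | h | h
      · exact absurd ⟨hmem.1, h⟩ hmem.2
      · exact absurd h hy
      · exact h
    rw [dirDeriv_eq_zero_of_le (R := 1) (fun x hx => by rw [hzero x hx, zero_mul]) hlt,
      hzero y hlt.le]
    simp
  rw [hsub, ← integral_const_mul]
  have hres : ∀ {f : Space d → ℝ}, Integrable f (volume.restrict (guide d)) →
      Integrable f (volume.restrict (cell d)) := fun hf =>
    IntegrableOn.mono_set hf Set.inter_subset_left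
  refine setIntegral_mono_on ?_ ?_ measurableSet_cell ?_
  · exact hres ((hi (hκ.mul hV)).add (hi ((hκ.mul hV).dirDeriv θ)))
  · exact hres (((hi hV).add (hi (hV.dirDeriv θ))).const_mul _)
  · rintro y ⟨hy, -⟩
    have hy0 : 0 ≤ y (Fin.last d) := (hy _).1.le
    rw [dirDeriv_mul θ (hκ.differentiable y) (hV.differentiable y)]
    have a1 := hM y hy0
    have a2 := hN y hy0
    set k := ‖cellCutoff y‖ with hk
    set k' := ‖dirDeriv θ cellCutoff y‖ with hk'
    set v := ‖V y‖ with hv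
    set v' := ‖dirDeriv θ V y‖ with hv'
    have b1 : ‖cellCutoff y * V y‖ ^ 2 ≤ M ^ 2 * v ^ 2 := by
      rw [norm_mul, mul_pow]; gcongr
    have b2 : ‖cellCutoff y * dirDeriv θ V y + V y * dirDeriv θ cellCutoff y‖ ^ 2 ≤
        (M * v' + v * N) ^ 2 := by
      gcongr
      refine (norm_add_le _ _).trans ?_
      rw [norm_mul, norm_mul]
      gcongr
    have b3 : (M * v' + v * N) ^ 2 ≤ 2 * M ^ 2 * v' ^ 2 + 2 * N ^ 2 * v ^ 2 := by
      nlinarith [sq_nonneg (M * v' - v * N)]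
    have b4 : 0 ≤ (M * v) ^ 2 := sq_nonneg _
    have b5 : 0 ≤ (M * v') ^ 2 := sq_nonneg _
    have b6 : 0 ≤ (N * v') ^ 2 := sq_nonneg _
    rw [hC']
    nlinarith

/-! ### Periodization -/

lemma wrap_of_mem {y : Space d} (hy : ∀ i : Fin d, 0 < y i.castSucc ∧ y i.castSucc < 1) :
    wrap y = y := by
  ext j
  refine Fin.lastCases ?_ (fun i => ?_) j
  · simp
  · rw [wrap_castSucc, Int.fract_eq_self]
    exact ⟨(hy i).1.le, (hy i).2⟩

lemma guide_castSucc {y : Space d} (hy : y ∈ guide d) (i : Fin d) :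
    0 < y i.castSucc ∧ y i.castSucc < 1 :=
  ⟨(hy _).1, (hy _).2 (Fin.castSucc_lt_last i).ne⟩

lemma exists_margin {K : Set (Space d)} (hK : IsCompact K)
    (hKs : ∀ y ∈ K, ∀ i : Fin d, 0 < y i.castSucc ∧ y i.castSucc < 1) :
    ∃ ε > 0, ∀ y ∈ K, ∀ i : Fin d, ε ≤ y i.castSucc ∧ y i.castSucc ≤ 1 - ε := by
  have h : ∀ i : Fin d, ∃ ε > 0, ∀ y ∈ K, ε ≤ y i.castSucc ∧ y i.castSucc ≤ 1 - ε := by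
    intro i
    rcases K.eq_empty_or_nonempty with rfl | hne
    · exact ⟨1, one_pos, by simp⟩
    obtain ⟨a, ha, ha'⟩ := hK.exists_isMinOn hne (continuous_apply i.castSucc).continuousOn
    obtain ⟨b, hb, hb'⟩ := hK.exists_isMaxOn hne (continuous_apply i.castSucc).continuousOn
    refine ⟨min (a i.castSucc) (1 - b i.castSucc), lt_min (hKs a ha i).1
      (by linarith [(hKs b hb i).2]), fun y hy => ⟨(min_le_left _ _).trans (ha' hy), ?_⟩⟩
    have h1 : y i.castSucc ≤ b i.castSucc := hb' hy
    have h2 := min_le_right (a i.castSucc) (1 - b i.castSucc)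
    linarith
  choose ε hε h using h
  rcases isEmpty_or_nonempty (Fin d) with he | he
  · exact ⟨1, one_pos, fun y _ i => he.elim i⟩
  · obtain ⟨i₀, hi₀⟩ := Finite.exists_min ε
    refine ⟨ε i₀, hε i₀, fun y hy i => ?_⟩
    have := h i y hy
    have := hi₀ i
    constructor <;> linarith

/-- A smooth function supported in `(0,1)ⁿ⁻¹ × ℝ` extends periodically to a smooth function. -/
lemma perTest_comp_wrap {V : Space d → ℂ} (hV : IsTest V)
    (hs : ∀ y ∈ tsupport V, ∀ i : Fin d, 0 < y i.castSucc ∧ y i.castSucc < 1) :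
    PerTest (fun y => V (wrap y)) where
  smooth := by
    obtain ⟨ε, hε, hK⟩ := exists_margin hV.2 hs
    refine contDiff_iff_contDiffAt.2 fun y => ?_
    -- If some transverse coordinate of `y` is an integer, points near `y` wrap to within `ε` of a
    -- lateral face, outside the support, and the function is locally zero. Otherwise the integer
    -- parts are locally constant and wrapping is locally a fixed translation.
    by_cases h : ∃ i : Fin d, Int.fract (y i.castSucc) = 0
    · obtain ⟨i, hi⟩ := h
      have hloc : (fun x => V (wrap x)) =ᶠ[𝓝 y] fun _ => 0 := by
        have h1 : ∀ᶠ x in 𝓝 y, |x i.castSucc - y i.castSucc| < min ε 1 := by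
          have : ContinuousAt (fun x : Space d => |x i.castSucc - y i.castSucc|) y :=
            (((continuous_apply i.castSucc).sub continuous_const).abs).continuousAt
          exact this.eventually_lt_const (by simpa using hε)
        filter_upwards [h1] with x hx
        by_contra hne
        have hmem : wrap x ∈ tsupport V := subset_tsupport _ hne
        have hb := hK _ hmem i
        rw [wrap_castSucc] at hb
        have hy : y i.castSucc = ⌊y i.castSucc⌋ := by
          have := Int.self_sub_floor (y i.castSucc); linarith
        have hx1 := (hx.trans_le (min_le_left _ _))
        have hx2 := (hx.trans_le (min_le_right _ _))
        rw [abs_lt] at hx1 hx2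
        rcases le_or_gt (y i.castSucc) (x i.castSucc) with hle | hlt
        · have : Int.fract (x i.castSucc) = x i.castSucc - y i.castSucc := by
            rw [Int.fract_eq_iff]
            exact ⟨by linarith, by linarith, ⌊y i.castSucc⌋, by rw [← hy]; ring⟩
          linarith
        · have : Int.fract (x i.castSucc) = x i.castSucc - y i.castSucc + 1 := by
            rw [Int.fract_eq_iff]
            exact ⟨by linarith, by linarith, ⌊y i.castSucc⌋ - 1, by push_cast; rw [← hy]; ring⟩
          linarith
      exact contDiffAt_const.congr_of_eventuallyEq hloc
    · push Not at h
      have hloc : (fun x => V (wrap x)) =ᶠ[𝓝 y] fun x =>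
          V (x - ∑ i : Fin d, ⌊y i.castSucc⌋ • (Pi.single i.castSucc 1 : Space d)) := by
        have h1 : ∀ᶠ x in 𝓝 y, ∀ i : Fin d, ⌊x i.castSucc⌋ = ⌊y i.castSucc⌋ := by
          refine eventually_all.2 fun i => ?_
          have hpos : 0 < Int.fract (y i.castSucc) := (Int.fract_nonneg _).lt_of_ne' (h i)
          have ho : IsOpen {x : Space d | (⌊y i.castSucc⌋ : ℝ) < x i.castSucc ∧
              x i.castSucc < ⌊y i.castSucc⌋ + 1} := by
            simpa [Set.ofPred_and] using
              (isOpen_lt continuous_const (continuous_apply i.castSucc)).inter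
                (isOpen_lt (continuous_apply i.castSucc) continuous_const)
          filter_upwards [ho.mem_nhds (show y ∈ _ from
            ⟨by have := Int.self_sub_floor (y i.castSucc); linarith, Int.lt_floor_add_one _⟩)]
            with x hx
          exact Int.floor_eq_iff.2 ⟨hx.1.le, hx.2⟩
        filter_upwards [h1] with x hx
        congr 1
        conv_rhs => rw [← wrap_add_sum x]
        simp only [hx, add_sub_cancel_right]
      refine ContDiffAt.congr_of_eventuallyEq ?_ hloc
      exact (hV.1.comp (contDiff_id.sub contDiff_const)).contDiffAt
  periodic y i := by
    congr 1
    ext j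
    refine Fin.lastCases ?_ (fun k => ?_) j
    · simp [(Fin.castSucc_lt_last i).ne']
    · rcases eq_or_ne k i with rfl | hk
      · simp
      · simp [hk]
  vanish := by
    obtain ⟨R, hR⟩ := (hV.2.image (continuous_apply (Fin.last d))).bddAbove
    refine ⟨R + 1, fun y hy => ?_⟩
    by_contra hne
    have h : wrap y (Fin.last d) ≤ R := hR ⟨_, subset_tsupport _ hne, rfl⟩
    rw [wrap_last] at h
    linarith

lemma perTest₀_comp_wrap {V : Space d → ℂ} (hV : IsTest V) (hs : tsupport V ⊆ guide d) :
    PerTest₀ (fun y => V (wrap y)) where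
  toPerTest := perTest_comp_wrap hV fun y hy i => guide_castSucc (hs hy) i
  vanish_bot := by
    rcases (tsupport V).eq_empty_or_nonempty with h | hne
    · exact ⟨1, one_pos, fun y _ => by
        have := tsupport_eq_empty_iff.1 h; simp [this]⟩
    obtain ⟨a, ha, ha'⟩ := hV.2.isCompact.exists_isMinOn hne
      (continuous_apply (Fin.last d)).continuousOn
    have hpos : 0 < a (Fin.last d) := (hs ha _).1
    refine ⟨a (Fin.last d) / 2, by positivity, fun y hy => ?_⟩
    by_contra hV
    have h : a (Fin.last d) ≤ wrap y (Fin.last d) := ha' (subset_tsupport _ hV)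
    rw [wrap_last] at h
    linarith

lemma dirDeriv_comp_wrap (θ : Space d) (V : Space d → ℂ) {y : Space d} (hy : y ∈ guide d) :
    dirDeriv θ (fun y => V (wrap y)) y = dirDeriv θ V y := by
  have : (fun x => V (wrap x)) =ᶠ[𝓝 y] V := by
    filter_upwards [isOpen_guide.mem_nhds hy] with x hx
    rw [wrap_of_mem (guide_castSucc hx)]
  rw [dirDeriv, dirDeriv, this.fderiv_eq]

/-! ### The weak formulation -/

/-- `G` is the directional derivative of `U`, periodically extended, in the half-space. -/
def PerWeak (θ : Space d) (U G : Space d → ℂ) : Prop :=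
  ∀ V : Space d → ℂ, PerTest₀ V →
    (∫ y in guide d, U y * dirDeriv θ V y) + ∫ y in guide d, G y * V y = 0

/-- A test function supported in the half-cylinder agrees there with its periodization, which is an
admissible periodic test function vanishing near the bottom. -/
lemma PerWeak.hasWeakDirDeriv {θ : Space d} {U G : Space d → ℂ} (h : PerWeak θ U G) :
    HasWeakDirDeriv θ U G := by
  intro V hV hs
  have := h _ (perTest₀_comp_wrap hV hs)
  rw [← add_eq_zero_iff_eq_neg, ← this]
  congr 1
  · refine setIntegral_congr_fun measurableSet_guide fun y hy => ?_
    simp only [dirDeriv_comp_wrap θ V hy]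
  · refine setIntegral_congr_fun measurableSet_guide fun y hy => ?_
    simp only [wrap_of_mem (guide_castSucc hy)]

/-- An `L²` function orthogonal to the periodic test functions vanishing near the bottom is zero. -/
lemma ae_eq_zero_of_forall_perTest₀ {X : Space d → ℂ} (hX : MemLp X 2 (volume.restrict (guide d)))
    (h : ∀ V : Space d → ℂ, PerTest₀ V → ∫ y in guide d, X y * V y = 0) :
    ∀ᵐ y ∂volume.restrict (guide d), X y = 0 := by
  rw [ae_restrict_iff' measurableSet_guide]
  refine isOpen_guide.ae_eq_zero_of_integral_contDiff_smul_eq_zero ?_ ?_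
  · refine (locallyIntegrableOn_iff (isOpen_guide.isLocallyClosed)).2 fun K hK hKc => ?_
    have h1 : MemLp X 2 (volume.restrict K) := hX.mono_measure (Measure.restrict_mono hK le_rfl)
    have : IsFiniteMeasure (volume.restrict K) := ⟨by simpa using hKc.measure_lt_top⟩
    exact h1.integrable (by norm_num)
  · intro g hg hgc hgs
    have hV : IsTest (fun y : Space d => (g y : ℂ)) :=
      ⟨Complex.ofRealCLM.contDiff.comp hg, hgc.comp_left (g := fun x : ℝ => (x : ℂ)) (by simp)⟩
    have hts : tsupport (fun y : Space d => (g y : ℂ)) ⊆ guide d := by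
      refine (closure_mono ?_).trans hgs
      intro y hy
      simpa using hy
    have := h _ (perTest₀_comp_wrap hV hts)
    have h0 : ∫ y, g y • X y = ∫ y in guide d, g y • X y := by
      symm
      refine setIntegral_eq_integral_of_forall_compl_eq_zero fun y hy => ?_
      have : g y = 0 := by
        by_contra hne
        exact hy (hgs (subset_tsupport _ hne))
      simp [this]
    rw [h0, ← this]
    refine setIntegral_congr_fun measurableSet_guide fun y hy => ?_
    simp only [wrap_of_mem (guide_castSucc hy), Complex.real_smul, mul_comm]

/-- Any smooth function with compact support in the open section is the bottom value of a periodic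
test function: it is multiplied by a bump in `yₙ` and periodized, so the fundamental lemma of the
calculus of variations applies. -/
lemma ae_eq_zero_of_forall_perTest_face {X : (Fin d → ℝ) → ℂ}
    (hX : MemLp X 2 (volume.restrict (face (Fin.last d))))
    (h : ∀ V : Space d → ℂ, PerTest V →
      ∫ z in face (Fin.last d), X z * V (facePoint (Fin.last d) 0 z) = 0) :
    ∀ᵐ z ∂volume.restrict (face (Fin.last d)), X z = 0 := by
  rw [ae_restrict_iff' (measurableSet_face _)]
  refine (isOpen_face _).ae_eq_zero_of_integral_contDiff_smul_eq_zero ?_ ?_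
  · exact IntegrableOn.locallyIntegrableOn (hX.integrable (by norm_num))
  · intro g hg hgc hgs
    let β : ContDiffBump (0 : ℝ) := ⟨1, 2, one_pos, one_lt_two⟩
    let V : Space d → ℂ := fun y =>
      ((g (fun j => y j.castSucc) * β (y (Fin.last d)) : ℝ) : ℂ)
    have hcs : HasCompactSupport V := by
      refine HasCompactSupport.intro (K := (fun p : ℝ × (Fin d → ℝ) => facePoint (Fin.last d) p.1 p.2)
        '' (Metric.closedBall 0 2 ×ˢ tsupport g)) (((isCompact_closedBall _ _).prod hgc).image
          (continuous_facePoint _)) fun y hy => ?_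
      by_contra hne
      have hne' : g (fun j => y j.castSucc) ≠ 0 ∧ β (y (Fin.last d)) ≠ 0 := by
        constructor <;> (intro h0; apply hne; simp [V, h0])
      refine hy ⟨(y (Fin.last d), fun j => y j.castSucc), ⟨?_, subset_tsupport _ hne'.1⟩, ?_⟩
      · have : y (Fin.last d) ∈ Function.support β := hne'.2
        rw [β.support_eq] at this
        exact Metric.ball_subset_closedBall this
      · ext j
        refine Fin.lastCases ?_ (fun i => ?_) j
        · simp [facePoint_self]
        · simp [facePoint_last_castSucc]
    have hV : IsTest V := by
      refine ⟨Complex.ofRealCLM.contDiff.comp (ContDiff.mul ?_ ?_), hcs⟩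
      · exact hg.comp (contDiff_pi.2 fun j => contDiff_apply ℝ ℝ j.castSucc)
      · exact β.contDiff.comp (contDiff_apply ℝ ℝ (Fin.last d))
    have hs : ∀ y ∈ tsupport V, ∀ i : Fin d, 0 < y i.castSucc ∧ y i.castSucc < 1 := by
      intro y hy
      have hc : Continuous fun y : Space d => (fun j : Fin d => y j.castSucc) := by fun_prop
      have h1 : tsupport V ⊆ (fun y : Space d => (fun j : Fin d => y j.castSucc)) ⁻¹' tsupport g := by
        refine closure_minimal (fun y hy => subset_tsupport _ ?_) ((isClosed_tsupport g).preimage hc)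
        intro h0
        exact hy (by simp [V, h0])
      exact mem_face_last.1 (hgs (h1 hy))
    have := h _ (perTest_comp_wrap hV hs)
    have h0 : ∫ y, g y • X y = ∫ y in face (Fin.last d), g y • X y := by
      symm
      refine setIntegral_eq_integral_of_forall_compl_eq_zero fun y hy => ?_
      have : g y = 0 := by
        by_contra hne
        exact hy (hgs (subset_tsupport _ hne))
      simp [this]
    rw [h0, ← this]
    refine setIntegral_congr_fun (measurableSet_face _) fun z hz => ?_
    have hw : wrap (facePoint (Fin.last d) 0 z) = facePoint (Fin.last d) 0 z :=
      wrap_of_mem fun i => by rw [facePoint_last_castSucc]; exact mem_face_last.1 hz i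
    have hβ : β 0 = 1 := β.one_of_mem_closedBall (by simp [β])
    simp only [hw, V, facePoint_self, facePoint_last_castSucc, hβ, Complex.real_smul]
    simp [mul_comm]

/-! ### Density of the periodic test functions -/

lemma integrable_mul_guide {U V : Space d → ℂ} (hU : MemLp U 2 (volume.restrict (guide d)))
    (hV : MemLp V 2 (volume.restrict (guide d))) :
    Integrable (fun y => U y * V y) (volume.restrict (guide d)) :=
  hU.integrable_mul hV

/-- Continuous cutoff, `1` for `yₙ ≤ R` and `0` for `yₙ ≥ R + 1`. -/
noncomputable def ramp (R : ℝ) (y : Space d) : ℂ := ((max 0 (min 1 (R + 1 - y (Fin.last d))) : ℝ) : ℂ)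

lemma memLp_ramp (R : ℝ) (p : ℝ≥0∞) : MemLp (ramp (d := d) R) p (volume.restrict (guide d)) := by
  refine memLp_guide (R := R + 1) ?_ (fun y hy => ?_) p
  · unfold ramp; fun_prop
  · have : min 1 (R + 1 - y (Fin.last d)) ≤ 0 := (min_le_right _ _).trans (by linarith)
    simp [ramp, max_eq_left this]

lemma ramp_eq_one {R : ℝ} {y : Space d} (hy : y (Fin.last d) ≤ R) : ramp R y = 1 := by
  have : min 1 (R + 1 - y (Fin.last d)) = 1 := min_eq_left (by linarith)
  simp [ramp, this]

/-- Differentiation under the integral sign. Moving the test function along the flow of `θ` turns a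
weak equation for `X` into an ordinary differential equation for a scalar pairing. -/
lemma hasDerivAt_integral_translate (θ : Space d) {X h : Space d → ℂ}
    (hX : MemLp X 2 (volume.restrict (guide d))) (hh : PerTest h) (σ₀ : ℝ) :
    HasDerivAt (fun σ : ℝ => ∫ y in guide d, X y * h (y + σ • θ))
      (∫ y in guide d, X y * dirDeriv θ h (y + σ₀ • θ)) σ₀ := by
  -- `L` bounds the vertical displacement for all `σ` within distance `1` of `σ₀`: the translates
  -- are evaluated only at heights at least `-L` and have derivatives vanishing above `R + L`, which
  -- gives a common majorant.
  set L := (|σ₀| + 1) * |θ (Fin.last d)| with hL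
  obtain ⟨R, hR⟩ := (hh.dirDeriv θ).vanish
  obtain ⟨M, hM0, hM⟩ := (hh.dirDeriv θ).bounded (-L)
  have hσ : ∀ σ ∈ Metric.ball σ₀ 1, |σ * θ (Fin.last d)| ≤ L := by
    intro σ hσ
    rw [Metric.mem_ball, Real.dist_eq] at hσ
    rw [abs_mul, hL]
    gcongr
    have := abs_sub_abs_le_abs_sub σ σ₀
    linarith
  refine (hasDerivAt_integral_of_dominated_loc_of_deriv_le (s := Metric.ball σ₀ 1)
    (F := fun σ y => X y * h (y + σ • θ)) (F' := fun σ y => X y * dirDeriv θ h (y + σ • θ))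
    (bound := fun y => M * ‖X y * ramp (R + L) y‖)
    (Metric.ball_mem_nhds _ one_pos) ?_ ?_ ?_ ?_ ?_ ?_).2
  · refine Eventually.of_forall fun σ => ?_
    exact hX.1.mul (hh.comp_add (σ • θ)).continuous.aestronglyMeasurable
  · exact integrable_mul_guide hX ((hh.comp_add (σ₀ • θ)).memLp 2)
  · exact hX.1.mul ((hh.dirDeriv θ).comp_add (σ₀ • θ)).continuous.aestronglyMeasurable
  · refine (ae_restrict_iff' measurableSet_guide).2 (Eventually.of_forall fun y hy σ hs => ?_)
    have h1 := abs_le.1 (hσ σ hs)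
    have hy0 : 0 < y (Fin.last d) := (hy _).1
    have e : (y + σ • θ) (Fin.last d) = y (Fin.last d) + σ * θ (Fin.last d) := by simp
    by_cases hc : y (Fin.last d) ≤ R + L
    · rw [ramp_eq_one hc, mul_one, norm_mul, mul_comm]
      gcongr
      exact hM _ (by rw [e]; linarith [h1.1])
    · rw [hR _ (by rw [e]; linarith [h1.1])]
      simp only [mul_zero, norm_zero]
      positivity
  · exact (integrable_mul_guide hX (memLp_ramp (R + L) 2)).norm.const_mul M
  · refine Eventually.of_forall fun y σ _ => ?_
    exact (hasDerivAt_line θ y σ (hh.differentiable _)).const_mul (X y)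

lemma volume_guide_inter {R : ℝ} :
    volume (guide d ∩ {y | y (Fin.last d) < R}) = ENNReal.ofReal R := by
  rw [guide_inter, Real.volume_pi_Ioo, Fin.prod_univ_castSucc]
  simp

/-- A linear growth bound for the pairing with upward translates. -/
lemma exists_integral_translate_bound (θ : Space d) (hθ : 0 < θ (Fin.last d)) {X h : Space d → ℂ}
    (hX : MemLp X 2 (volume.restrict (guide d))) (hh : PerTest₀ h) :
    ∃ a b : ℝ, ∀ τ : ℝ, 0 ≤ τ → ‖∫ y in guide d, X y * h (y + (-τ) • θ)‖ ≤ a + b * τ := by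
  obtain ⟨R, hR⟩ := hh.vanish
  obtain ⟨ε, hε, hbot⟩ := hh.vanish_bot
  obtain ⟨M, hM0, hM⟩ := hh.toPerTest.bounded 0
  have hMall : ∀ y, ‖h y‖ ≤ M := fun y => by
    by_cases hy : 0 ≤ y (Fin.last d)
    · exact hM y hy
    · rw [hbot y (by push Not at hy; linarith)]; simpa using hM0
  have hXi : Integrable (fun y => ‖X y‖ ^ 2) (volume.restrict (guide d)) := by
    simpa using hX.integrable_norm_pow (by norm_num)
  refine ⟨(∫ y in guide d, ‖X y‖ ^ 2) + M ^ 2 * |R|, M ^ 2 * θ (Fin.last d), fun τ hτ => ?_⟩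
  -- The translate vanishes above `T`, and the part of the cylinder below `T` has volume linear in
  -- `τ`; integrating `|X h| ≤ |X|² + M²` over it gives the bound.
  set T := R + τ * θ (Fin.last d) with hT
  have h1 : ∫ y in guide d, X y * h (y + (-τ) • θ) =
      ∫ y in guide d ∩ {y | y (Fin.last d) < T}, X y * h (y + (-τ) • θ) := by
    refine (setIntegral_eq_of_subset_of_forall_sdiff_eq_zero measurableSet_guide
      Set.inter_subset_left ?_)
    rintro y ⟨hy, hy'⟩
    have : T ≤ y (Fin.last d) := by
      by_contra hlt; exact hy' ⟨hy, not_le.1 hlt⟩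
    rw [hR, mul_zero]
    simp; linarith
  rw [h1]
  have hfin : volume (guide d ∩ {y | y (Fin.last d) < T}) ≠ ∞ := by simp [volume_guide_inter]
  refine (norm_integral_le_integral_norm _).trans ?_
  have h2 : ∫ y in guide d ∩ {y | y (Fin.last d) < T}, ‖X y * h (y + (-τ) • θ)‖ ≤
      ∫ y in guide d ∩ {y | y (Fin.last d) < T}, (‖X y‖ ^ 2 + M ^ 2) := by
    refine integral_mono ?_ ?_ fun y => ?_
    · exact (IntegrableOn.mono_set (integrable_mul_guide hX
        ((hh.toPerTest.comp_add ((-τ) • θ)).memLp 2)) Set.inter_subset_left).norm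
    · exact (IntegrableOn.mono_set hXi Set.inter_subset_left).add (integrableOn_const hfin)
    · simp only [norm_mul]
      have := hMall (y + (-τ) • θ)
      nlinarith [sq_nonneg (‖X y‖ - ‖h (y + (-τ) • θ)‖), norm_nonneg (X y),
        norm_nonneg (h (y + (-τ) • θ))]
  refine h2.trans ?_
  rw [integral_add (IntegrableOn.mono_set hXi Set.inter_subset_left) (integrableOn_const hfin)]
  have h3 : ∫ y in guide d ∩ {y | y (Fin.last d) < T}, ‖X y‖ ^ 2 ≤ ∫ y in guide d, ‖X y‖ ^ 2 :=
    setIntegral_mono_set hXi (Eventually.of_forall fun _ => by positivity)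
      Set.inter_subset_left.eventuallyLE
  have h4 : ∫ y in guide d ∩ {y : Space d | y (Fin.last d) < T}, M ^ 2 ≤
      M ^ 2 * (|R| + τ * θ (Fin.last d)) := by
    rw [setIntegral_const, measureReal_def, volume_guide_inter, smul_eq_mul, mul_comm]
    gcongr
    rw [ENNReal.toReal_ofReal']
    refine max_le ?_ (by positivity)
    linarith [le_abs_self R]
  linarith

/-- The `L²` solutions of `D X = X` that are periodic vanish. -/
lemma ae_eq_zero_of_grow (θ : Space d) (hθ : 0 < θ (Fin.last d)) {X : Space d → ℂ}
    (hX : MemLp X 2 (volume.restrict (guide d)))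
    (h : ∀ V, PerTest₀ V → (∫ y in guide d, X y * dirDeriv θ V y) + ∫ y in guide d, X y * V y = 0) :
    ∀ᵐ y ∂volume.restrict (guide d), X y = 0 := by
  refine ae_eq_zero_of_forall_perTest₀ hX fun V hV => ?_
  set f : ℝ → ℂ := fun τ => ∫ y in guide d, X y * V (y + (-τ) • θ) with hf
  have hd : ∀ τ, HasDerivAt f (-∫ y in guide d, X y * dirDeriv θ V (y + (-τ) • θ)) τ := by
    intro τ
    have := (hasDerivAt_integral_translate θ hX hV.toPerTest (-τ)).scomp τ (hasDerivAt_neg τ)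
    rw [neg_smul, one_smul] at this
    exact this
  -- Upward translates still vanish near the bottom, so the equation may be tested on them and `f' =
  -- f`. Hence `f τ = exp τ * f 0`, which linear growth allows only for `f 0 = 0`.
  have hd' : ∀ τ, 0 ≤ τ → HasDerivAt f (f τ) τ := by
    intro τ hτ
    have hV' : PerTest₀ fun y => V (y + (-τ) • θ) := by
      simpa [sub_eq_add_neg] using hV.comp_sub (v := τ • θ) (by simp; positivity)
    have := h _ hV'
    simp only [dirDeriv_comp_add] at this
    have h2 := hd τ
    rwa [eq_neg_of_add_eq_zero_left this, neg_neg] at h2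
  have hconst : ∀ τ, 0 ≤ τ → ((Real.exp (-τ) : ℝ) : ℂ) * f τ = f 0 := by
    intro τ hτ
    have hg : ∀ s, 0 ≤ s → HasDerivAt (fun s : ℝ => ((Real.exp (-s) : ℝ) : ℂ) * f s) 0 s := by
      intro s hs
      have h1 : HasDerivAt (fun s : ℝ => ((Real.exp (-s) : ℝ) : ℂ)) ((-Real.exp (-s) : ℝ) : ℂ) s := by
        have := ((Real.hasDerivAt_exp (-s)).comp s (hasDerivAt_neg s)).ofReal_comp
        simpa using this
      have := h1.mul (hd' s hs)
      have e : ((-Real.exp (-s) : ℝ) : ℂ) * f s + ((Real.exp (-s) : ℝ) : ℂ) * f s = 0 := by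
        push_cast; ring
      rw [e] at this
      exact this
    have := constant_of_has_deriv_right_zero (a := 0) (b := τ)
      (fun s hs => (hg s hs.1).continuousAt.continuousWithinAt)
      (fun s hs => (hg s hs.1).hasDerivWithinAt) τ ⟨hτ, le_rfl⟩
    simpa using this
  obtain ⟨a, b, hab⟩ := exists_integral_translate_bound θ hθ hX hV
  have hlim : Tendsto (fun τ : ℝ => a * Real.exp (-τ) + b * (τ ^ 1 * Real.exp (-τ))) atTop (𝓝 0) := by
    have h1 := Real.tendsto_pow_mul_exp_neg_atTop_nhds_zero 1
    have h0 := Real.tendsto_pow_mul_exp_neg_atTop_nhds_zero 0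
    simpa using (h0.const_mul a).add (h1.const_mul b)
  have hle : ‖f 0‖ ≤ 0 := by
    refine ge_of_tendsto hlim ((eventually_ge_atTop 0).mono fun τ hτ => ?_)
    rw [← hconst τ hτ, norm_mul, Complex.norm_real, Real.norm_of_nonneg (Real.exp_pos _).le]
    have := mul_le_mul_of_nonneg_left (hab τ hτ) (Real.exp_pos (-τ)).le
    refine this.trans (le_of_eq ?_)
    ring
  have := norm_le_zero_iff.1 hle
  simpa [hf] using this

/-- The `L²` solutions of `D X = -X` that are periodic and have zero trace vanish. -/
lemma ae_eq_zero_of_decay (θ : Space d) (hθ : 0 < θ (Fin.last d)) {X : Space d → ℂ}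
    (hX : MemLp X 2 (volume.restrict (guide d)))
    (h : ∀ V, PerTest V → ∫ y in guide d, X y * dirDeriv θ V y = ∫ y in guide d, X y * V y) :
    ∀ᵐ y ∂volume.restrict (guide d), X y = 0 := by
  refine ae_eq_zero_of_forall_perTest₀ hX fun V hV => ?_
  set f : ℝ → ℂ := fun τ => ∫ y in guide d, X y * V (y + τ • θ) with hf
  -- The equation holds against all periodic test functions, which encodes the zero trace and makes
  -- downward translates admissible. Again `f' = f`, but now `f` is zero once the translate has left
  -- the half-cylinder.
  have hd' : ∀ τ, HasDerivAt f (f τ) τ := by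
    intro τ
    have := h _ (hV.toPerTest.comp_add (τ • θ))
    simp only [dirDeriv_comp_add] at this
    have h2 := hasDerivAt_integral_translate θ hX hV.toPerTest τ
    rwa [this] at h2
  have hconst : ∀ τ, 0 ≤ τ → ((Real.exp (-τ) : ℝ) : ℂ) * f τ = f 0 := by
    intro τ hτ
    have hg : ∀ s, HasDerivAt (fun s : ℝ => ((Real.exp (-s) : ℝ) : ℂ) * f s) 0 s := by
      intro s
      have h1 : HasDerivAt (fun s : ℝ => ((Real.exp (-s) : ℝ) : ℂ)) ((-Real.exp (-s) : ℝ) : ℂ) s := by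
        have := ((Real.hasDerivAt_exp (-s)).comp s (hasDerivAt_neg s)).ofReal_comp
        simpa using this
      have := h1.mul (hd' s)
      have e : ((-Real.exp (-s) : ℝ) : ℂ) * f s + ((Real.exp (-s) : ℝ) : ℂ) * f s = 0 := by
        push_cast; ring
      rw [e] at this
      exact this
    have := constant_of_has_deriv_right_zero (a := 0) (b := τ)
      (fun s _ => (hg s).continuousAt.continuousWithinAt)
      (fun s _ => (hg s).hasDerivWithinAt) τ ⟨hτ, le_rfl⟩
    simpa using this
  obtain ⟨R, hR⟩ := hV.vanish
  set τ := |R| / θ (Fin.last d) with hτ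
  have hz : f τ = 0 := by
    simp only [hf]
    rw [← integral_zero (Space d) ℂ (μ := volume.restrict (guide d))]
    refine setIntegral_congr_fun measurableSet_guide fun y hy => ?_
    have hy0 : 0 < y (Fin.last d) := (hy _).1
    have : V (y + τ • θ) = 0 := hR _ (by
      simp only [Pi.add_apply, Pi.smul_apply, smul_eq_mul, hτ]
      rw [div_mul_cancel₀ _ hθ.ne']
      linarith [le_abs_self R])
    simp [this]
  have := hconst τ (by positivity)
  rw [hz, mul_zero] at this
  simpa [hf] using this.symm

/-- A weakly differentiable pair orthogonal to all periodic test functions is zero. -/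
theorem ae_eq_zero_of_orthogonal (θ : Space d) (hθ : 0 < θ (Fin.last d)) {A B : Space d → ℂ}
    (hA : MemLp A 2 (volume.restrict (guide d))) (hB : MemLp B 2 (volume.restrict (guide d)))
    (h1 : PerWeak θ A B)
    (h2 : ∀ V, PerTest V → (∫ y in guide d, A y * V y) + ∫ y in guide d, B y * dirDeriv θ V y = 0) :
    (∀ᵐ y ∂volume.restrict (guide d), A y = 0) ∧ ∀ᵐ y ∂volume.restrict (guide d), B y = 0 := by
  -- The hypotheses say `D A = B` and `D B = A`, the latter with zero bottom trace. Thus `A + B`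
  -- satisfies `D X = X` and vanishes; then `A = -B`, so that `D B = -B` with zero trace.
  have hX : ∀ᵐ y ∂volume.restrict (guide d), A y + B y = 0 := by
    refine ae_eq_zero_of_grow θ hθ (hA.add hB) fun V hV => ?_
    have e1 := h1 V hV
    have e2 := h2 V hV.toPerTest
    have hV2 := hV.toPerTest.memLp 2
    have hDV2 := (hV.toPerTest.dirDeriv θ).memLp 2
    simp only [add_mul]
    rw [integral_add (integrable_mul_guide hA hDV2) (integrable_mul_guide hB hDV2),
      integral_add (integrable_mul_guide hA hV2) (integrable_mul_guide hB hV2)]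
    linear_combination e1 + e2
  have hBz : ∀ᵐ y ∂volume.restrict (guide d), B y = 0 := by
    refine ae_eq_zero_of_decay θ hθ hB fun V hV => ?_
    have e2 := h2 V hV
    have e3 : ∫ y in guide d, A y * V y = -∫ y in guide d, B y * V y := by
      rw [← integral_neg]
      refine integral_congr_ae ?_
      filter_upwards [hX] with y hy
      rw [eq_neg_of_add_eq_zero_left hy]; ring
    rw [e3] at e2
    linear_combination e2
  refine ⟨?_, hBz⟩
  filter_upwards [hX, hBz] with y h h'
  simpa [h'] using h

/-! ### `L²` tools -/

section L2

variable {α : Type*} [MeasurableSpace α] {m : Measure α}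

lemma integral_mul_eq_inner {F : α → ℂ} (hF : MemLp F 2 m) (U : Lp ℂ 2 m) :
    ∫ y, U y * F y ∂m = ⟪(hF.star).toLp _, U⟫_ℂ := by
  rw [L2.inner_def]
  refine integral_congr_ae ?_
  filter_upwards [hF.star.coeFn_toLp] with y hy
  rw [hy]
  simp

lemma continuous_integral_mul {F : α → ℂ} (hF : MemLp F 2 m) :
    Continuous fun U : Lp ℂ 2 m => ∫ y, U y * F y ∂m := by
  simp only [integral_mul_eq_inner hF]
  fun_prop

lemma norm_sq_eq_integral (U : Lp ℂ 2 m) : ‖U‖ ^ 2 = ∫ y, ‖U y‖ ^ 2 ∂m := by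
  have h : ⟪U, U⟫_ℂ = ((∫ y, ‖U y‖ ^ 2 ∂m : ℝ) : ℂ) := by
    rw [L2.inner_def, ← integral_complex_ofReal]
    refine integral_congr_ae (Eventually.of_forall fun y => ?_)
    simp
  rw [inner_self_eq_norm_sq_to_K] at h
  exact Complex.ofReal_injective (by simpa using h)

lemma integrable_norm_sq {F : α → ℂ} (hF : MemLp F 2 m) : Integrable (fun y => ‖F y‖ ^ 2) m := by
  simpa using hF.integrable_norm_pow (by norm_num)

/-- Multiplication by a bounded function on `L²`. -/
noncomputable def mulOp {a : α → ℂ} (ha : MemLp a ∞ m) : Lp ℂ 2 m →L[ℂ] Lp ℂ 2 m :=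
  (ContinuousLinearMap.mul ℂ ℂ).holderL m ∞ 2 2 (ha.toLp _)

lemma coeFn_mulOp {a : α → ℂ} (ha : MemLp a ∞ m) (U : Lp ℂ 2 m) :
    mulOp ha U =ᵐ[m] fun y => a y * U y := by
  have h : mulOp ha U =ᵐ[m] fun y => (ContinuousLinearMap.mul ℂ ℂ) (ha.toLp a y) (U y) :=
    ContinuousLinearMap.coeFn_holder (r := 2) (ContinuousLinearMap.mul ℂ ℂ) (ha.toLp _) U
  filter_upwards [h, ha.coeFn_toLp] with y h1 h2
  rw [h1, h2]
  rfl

end L2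

/-! ### The Hilbert space of periodic functions with their traces -/

/-- Pairs consisting of a function and its directional derivative. -/
abbrev PairL2 (d : ℕ) : Type := WithLp 2 (GuideL2 d × GuideL2 d)

/-- Pairs consisting of the traces on `{yₙ = 0}` and `{yₙ = 1}`. -/
abbrev TraceL2 (d : ℕ) : Type := WithLp 2 (SectionL2 d × SectionL2 d)

/-- Functions together with their directional derivative and their traces. -/
abbrev Ambient (d : ℕ) : Type := WithLp 2 (PairL2 d × TraceL2 d)

/-- The trace on `{yₙ = a}` of a continuous function. -/
noncomputable def sectionTrace {V : Space d → ℂ} (hV : Continuous V) (a : ℝ) : SectionL2 d :=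
  (memLp_face hV a 2).toLp _

lemma coeFn_sectionTrace {V : Space d → ℂ} (hV : Continuous V) (a : ℝ) :
    sectionTrace hV a =ᵐ[volume.restrict (face (Fin.last d))]
      fun z => V (facePoint (Fin.last d) a z) :=
  MemLp.coeFn_toLp _

/-- A periodic test function as an element of the ambient Hilbert space. -/
noncomputable def embed (θ : Space d) {V : Space d → ℂ} (hV : PerTest V) : Ambient d :=
  WithLp.toLp 2 (WithLp.toLp 2 ((hV.memLp 2).toLp _, ((hV.dirDeriv θ).memLp 2).toLp _),
    WithLp.toLp 2 (sectionTrace hV.continuous 0, sectionTrace hV.continuous 1))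

lemma embed_add (θ : Space d) {V W : Space d → ℂ} (hV : PerTest V) (hW : PerTest W) :
    embed θ (hV.add hW) = embed θ hV + embed θ hW := by
  have e : dirDeriv θ (fun y => V y + W y) = dirDeriv θ V + dirDeriv θ W := by
    ext y; exact dirDeriv_add θ (hV.differentiable y) (hW.differentiable y)
  unfold embed
  rw [← WithLp.toLp_add, Prod.mk_add_mk, ← WithLp.toLp_add, ← WithLp.toLp_add, Prod.mk_add_mk,
    Prod.mk_add_mk]
  simp only [e, sectionTrace]
  rfl

lemma embed_smul (θ : Space d) (c : ℂ) {V : Space d → ℂ} (hV : PerTest V) :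
    embed θ (hV.const_mul c) = c • embed θ hV := by
  have e : dirDeriv θ (fun y => c * V y) = c • dirDeriv θ V := by
    ext y; exact dirDeriv_const_mul θ c (hV.differentiable y)
  unfold embed
  rw [← WithLp.toLp_smul, Prod.smul_mk, ← WithLp.toLp_smul, ← WithLp.toLp_smul, Prod.smul_mk,
    Prod.smul_mk]
  simp only [e, sectionTrace]
  rfl

/-- The subspace of periodic test functions. -/
noncomputable def testSubmodule (θ : Space d) : Submodule ℂ (Ambient d) where
  carrier := {x | ∃ V, ∃ hV : PerTest V, embed θ hV = x}
  add_mem' := by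
    rintro _ _ ⟨V, hV, rfl⟩ ⟨W, hW, rfl⟩
    exact ⟨_, hV.add hW, embed_add θ hV hW⟩
  zero_mem' := ⟨_, (PerTest.zero).const_mul 0, by rw [embed_smul θ 0 PerTest.zero, zero_smul]⟩
  smul_mem' := by
    rintro c _ ⟨V, hV, rfl⟩
    exact ⟨_, hV.const_mul c, embed_smul θ c hV⟩

/-- The Hilbert space of periodic functions with square integrable directional derivative, together
with their traces. -/
noncomputable def perSpace (θ : Space d) : Submodule ℂ (Ambient d) :=
  (testSubmodule θ).topologicalClosure

instance (θ : Space d) : CompleteSpace (perSpace θ) :=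
  inferInstanceAs (CompleteSpace (testSubmodule θ).topologicalClosure)

/-- Function, derivative and both traces are coordinates of the ambient space, hence continuous, so
closed relations among them need only be checked on smooth functions. -/
lemma perSpace_induction (θ : Space d) {p : Ambient d → Prop} (hp : IsClosed {x | p x})
    (h : ∀ V, ∀ hV : PerTest V, p (embed θ hV)) {x : Ambient d} (hx : x ∈ perSpace θ) : p x := by
  have h1 : (testSubmodule θ : Set (Ambient d)) ⊆ {x | p x} := by
    rintro _ ⟨V, hV, rfl⟩
    exact h V hV
  exact closure_minimal h1 hp hx

/-- The projections of the ambient space. -/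
noncomputable def funL : Ambient d →L[ℂ] GuideL2 d :=
  (WithLp.fstL 2 ℂ (GuideL2 d) (GuideL2 d)).comp (WithLp.fstL 2 ℂ (PairL2 d) (TraceL2 d))

noncomputable def derivL : Ambient d →L[ℂ] GuideL2 d :=
  (WithLp.sndL 2 ℂ (GuideL2 d) (GuideL2 d)).comp (WithLp.fstL 2 ℂ (PairL2 d) (TraceL2 d))

noncomputable def trace0L : Ambient d →L[ℂ] SectionL2 d :=
  (WithLp.fstL 2 ℂ (SectionL2 d) (SectionL2 d)).comp (WithLp.sndL 2 ℂ (PairL2 d) (TraceL2 d))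

noncomputable def trace1L : Ambient d →L[ℂ] SectionL2 d :=
  (WithLp.sndL 2 ℂ (SectionL2 d) (SectionL2 d)).comp (WithLp.sndL 2 ℂ (PairL2 d) (TraceL2 d))

section

variable (θ : Space d) {V : Space d → ℂ} (hV : PerTest V)

lemma funL_embed : funL (embed θ hV) = (hV.memLp 2).toLp := rfl

lemma derivL_embed : derivL (embed θ hV) = ((hV.dirDeriv θ).memLp 2).toLp := rfl

lemma trace0L_embed : trace0L (embed θ hV) = sectionTrace hV.continuous 0 := rfl

lemma trace1L_embed : trace1L (embed θ hV) = sectionTrace hV.continuous 1 := rfl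

end

lemma norm_sq_ambient (x : Ambient d) :
    ‖x‖ ^ 2 = ‖funL x‖ ^ 2 + ‖derivL x‖ ^ 2 + (‖trace0L x‖ ^ 2 + ‖trace1L x‖ ^ 2) := by
  rw [WithLp.prod_norm_sq_eq_of_L2, WithLp.prod_norm_sq_eq_of_L2, WithLp.prod_norm_sq_eq_of_L2]
  rfl

/-- Green's formula. -/
lemma perSpace_green (θ : Space d) {x : Ambient d} (hx : x ∈ perSpace θ) {V : Space d → ℂ}
    (hV : PerTest V) :
    (∫ y in guide d, funL x y * dirDeriv θ V y) + (∫ y in guide d, derivL x y * V y) =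
      -(θ (Fin.last d) * ∫ z in face (Fin.last d),
        trace0L x z * V (facePoint (Fin.last d) 0 z)) := by
  refine perSpace_induction θ (p := fun x => (∫ y in guide d, funL x y * dirDeriv θ V y) +
    (∫ y in guide d, derivL x y * V y) = -(θ (Fin.last d) * ∫ z in face (Fin.last d),
        trace0L x z * V (facePoint (Fin.last d) 0 z))) ?_ ?_ hx
  · refine isClosed_eq (((continuous_integral_mul ((hV.dirDeriv θ).memLp 2)).comp
      funL.continuous).add ((continuous_integral_mul (hV.memLp 2)).comp derivL.continuous)) ?_
    exact (continuous_const.mul ((continuous_integral_mul (memLp_face hV.continuous 0 2)).comp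
      trace0L.continuous)).neg
  · intro W hW
    rw [funL_embed, derivL_embed, trace0L_embed]
    refine Eq.trans ?_ ((hW.green θ hV).trans ?_)
    · congr 1
      · refine integral_congr_ae ?_
        filter_upwards [(hW.memLp 2).coeFn_toLp] with y hy
        rw [hy]
      · refine integral_congr_ae ?_
        filter_upwards [((hW.dirDeriv θ).memLp 2).coeFn_toLp] with y hy
        rw [hy]
    · congr 2
      refine integral_congr_ae ?_
      filter_upwards [coeFn_sectionTrace hW.continuous 0] with y hy
      rw [hy]

lemma perSpace_perWeak (θ : Space d) {x : Ambient d} (hx : x ∈ perSpace θ) :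
    PerWeak θ (funL x) (derivL x) := by
  intro V hV
  obtain ⟨ε, hε, h0⟩ := hV.vanish_bot
  rw [perSpace_green θ hx hV.toPerTest]
  have : ∀ z, V (facePoint (Fin.last d) 0 z) = 0 := fun z =>
    h0 _ (by rw [facePoint_self]; exact hε.le)
  simp [this]

lemma memLp_indicator_one {s : Set (Space d)} (hs : MeasurableSet s) :
    MemLp (s.indicator fun _ => (1 : ℂ)) ∞ (volume.restrict (guide d)) :=
  memLp_top_of_bound ((aestronglyMeasurable_const).indicator hs) 1
    (Eventually.of_forall fun y => by
      by_cases h : y ∈ s <;> simp [h])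

/-- Writing a local `L²` norm as the norm of a bounded operator makes it continuous in `U`, as
density arguments require. -/
lemma norm_sq_mulOp_indicator {s : Set (Space d)} (hs : MeasurableSet s) (hsg : s ⊆ guide d)
    (U : GuideL2 d) :
    ‖mulOp (memLp_indicator_one hs) U‖ ^ 2 = ∫ y in s, ‖U y‖ ^ 2 := by
  rw [norm_sq_eq_integral]
  have h1 : ∫ y in guide d, ‖mulOp (memLp_indicator_one hs) U y‖ ^ 2 =
      ∫ y in guide d, s.indicator (fun y => ‖U y‖ ^ 2) y := by
    refine integral_congr_ae ?_
    filter_upwards [coeFn_mulOp (memLp_indicator_one hs) U] with y hy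
    rw [hy]
    by_cases h : y ∈ s <;> simp [h]
  rw [h1, setIntegral_indicator hs, Set.inter_eq_right.2 hsg]

lemma continuous_setIntegral_norm_sq {s : Set (Space d)} (hs : MeasurableSet s)
    (hsg : s ⊆ guide d) : Continuous fun U : GuideL2 d => ∫ y in s, ‖U y‖ ^ 2 := by
  simp only [← norm_sq_mulOp_indicator hs hsg]
  fun_prop

lemma cell_subset_guide : cell d ⊆ guide d := Set.inter_subset_left

lemma norm_sq_sectionTrace {V : Space d → ℂ} (hV : Continuous V) (a : ℝ) :
    ‖sectionTrace hV a‖ ^ 2 = ∫ z in face (Fin.last d), ‖V (facePoint (Fin.last d) a z)‖ ^ 2 := by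
  rw [norm_sq_eq_integral]
  refine integral_congr_ae ?_
  filter_upwards [coeFn_sectionTrace hV a] with z hz
  rw [hz]

lemma setIntegral_norm_sq_toLp {V : Space d → ℂ} (hV : MemLp V 2 (volume.restrict (guide d)))
    {s : Set (Space d)} (hsg : s ⊆ guide d) :
    ∫ y in s, ‖hV.toLp V y‖ ^ 2 = ∫ y in s, ‖V y‖ ^ 2 := by
  refine integral_congr_ae ?_
  filter_upwards [ae_restrict_of_ae_restrict_of_subset hsg hV.coeFn_toLp] with y hy
  rw [hy]

lemma integral_add_norm_sq {U G : Space d → ℂ} (hU : MemLp U 2 (volume.restrict (guide d)))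
    (hG : MemLp G 2 (volume.restrict (guide d))) {s : Set (Space d)} (hsg : s ⊆ guide d) :
    ∫ y in s, (‖U y‖ ^ 2 + ‖G y‖ ^ 2) = (∫ y in s, ‖U y‖ ^ 2) + ∫ y in s, ‖G y‖ ^ 2 :=
  integral_add (IntegrableOn.mono_set (integrable_norm_sq hU) hsg)
    (IntegrableOn.mono_set (integrable_norm_sq hG) hsg)

/-- The right-hand side involves only the first cell. This is what makes the energy lost under a
shift by one period control the boundary datum. -/
theorem exists_trace0_bound (θ : Space d) (hθ : 0 < θ (Fin.last d)) :
    ∃ C, 0 ≤ C ∧ ∀ x ∈ perSpace θ, ‖trace0L x‖ ^ 2 ≤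
      C * ((∫ y in cell d, ‖funL x y‖ ^ 2) + ∫ y in cell d, ‖derivL x y‖ ^ 2) := by
  obtain ⟨C, hC, h⟩ := exists_trace_estimate_cell θ hθ
  refine ⟨C, hC, fun x hx => perSpace_induction θ (p := fun x => ‖trace0L x‖ ^ 2 ≤
      C * ((∫ y in cell d, ‖funL x y‖ ^ 2) + ∫ y in cell d, ‖derivL x y‖ ^ 2)) ?_ ?_ hx⟩
  · have hc := continuous_setIntegral_norm_sq measurableSet_cell (cell_subset_guide (d := d))
    exact isClosed_le (by fun_prop) (continuous_const.mul ((hc.comp funL.continuous).add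
      (hc.comp derivL.continuous)))
  · intro V hV
    rw [funL_embed, derivL_embed, trace0L_embed, norm_sq_sectionTrace,
      setIntegral_norm_sq_toLp _ cell_subset_guide, setIntegral_norm_sq_toLp _ cell_subset_guide,
      ← integral_add_norm_sq (hV.memLp 2) ((hV.dirDeriv θ).memLp 2) cell_subset_guide]
    exact h V hV

/-! ### Longitudinal shifts -/

/-- The unit vector in the longitudinal direction. -/
abbrev eLast (d : ℕ) : Space d := Pi.single (Fin.last d) 1

/-- The part `{yₙ > 1}` of the half-cylinder. -/
def upper (d : ℕ) : Set (Space d) := guide d ∩ {y | 1 < y (Fin.last d)}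

lemma measurableSet_upper : MeasurableSet (upper d) :=
  measurableSet_guide.inter (measurableSet_lt measurable_const (measurable_pi_apply _))

lemma upper_subset_guide : upper d ⊆ guide d := Set.inter_subset_left

lemma add_eLast_mem_upper {y : Space d} : y + eLast d ∈ upper d ↔ y ∈ guide d := by
  constructor
  · rintro ⟨h, h1⟩ j
    by_cases hj : j = Fin.last d
    · subst hj
      refine ⟨?_, fun h => absurd rfl h⟩
      have h1' : 1 < (y + eLast d) (Fin.last d) := h1
      simpa [eLast] using h1'
    · simpa [eLast, hj] using h j
  · intro h
    refine ⟨fun j => ?_, ?_⟩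
    · by_cases hj : j = Fin.last d
      · subst hj
        refine ⟨?_, fun h => absurd rfl h⟩
        have := (h (Fin.last d)).1
        simp [eLast]; linarith
      · simpa [eLast, hj] using h j
    · show 1 < (y + eLast d) (Fin.last d)
      have := (h (Fin.last d)).1
      simp [eLast]; linarith

lemma measurePreserving_add_eLast :
    MeasurePreserving (fun y : Space d => y + eLast d) (volume.restrict (guide d))
      (volume.restrict (upper d)) := by
  have h := (measurePreserving_add_right (volume : Measure (Space d)) (eLast d)).restrict_preimage
    (measurableSet_upper (d := d))
  have e : (fun y : Space d => y + eLast d) ⁻¹' upper d = guide d := by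
    ext y; exact add_eLast_mem_upper
  rwa [e] at h

lemma integral_comp_add_eLast {E : Type*} [NormedAddCommGroup E] [NormedSpace ℝ E]
    (f : Space d → E) :
    ∫ y in guide d, f (y + eLast d) = ∫ y in upper d, f y :=
  measurePreserving_add_eLast.integral_comp (measurableEmbedding_addRight _) f

lemma memLp_comp_add_eLast {f : Space d → ℂ} {p : ℝ≥0∞} (hf : MemLp f p (volume.restrict (guide d))) :
    MemLp (fun y => f (y + eLast d)) p (volume.restrict (guide d)) :=
  (hf.mono_measure (Measure.restrict_mono upper_subset_guide le_rfl)).comp_measurePreserving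
    measurePreserving_add_eLast

lemma integral_cell_add_upper {f : Space d → ℝ} (hf : Integrable f (volume.restrict (guide d))) :
    (∫ y in cell d, f y) + ∫ y in upper d, f y = ∫ y in guide d, f y := by
  have hdisj : Disjoint (cell d) (upper d) := by
    rw [Set.disjoint_left]
    rintro y ⟨-, h1⟩ ⟨-, h2⟩
    exact lt_asymm (show y (Fin.last d) < 1 from h1) h2
  rw [← setIntegral_union hdisj measurableSet_upper
    (IntegrableOn.mono_set hf cell_subset_guide) (IntegrableOn.mono_set hf upper_subset_guide)]
  refine setIntegral_congr_set ?_
  have hae : ∀ᵐ y ∂(volume : Measure (Space d)), y (Fin.last d) ≠ 1 :=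
    Measure.ae_eval_ne (fun _ : Fin (d + 1) => (volume : Measure ℝ)) (Fin.last d) 1
  filter_upwards [hae] with y hy
  refine propext ⟨?_, fun h => ?_⟩
  · rintro (h | h)
    · exact h.1
    · exact h.1
  · rcases lt_or_gt_of_ne hy with h' | h'
    · exact Or.inl ⟨h, h'⟩
    · exact Or.inr ⟨h, h'⟩

/-- The shift by one period. -/
noncomputable def shift (U : GuideL2 d) : GuideL2 d := (memLp_comp_add_eLast (Lp.memLp U)).toLp _

lemma coeFn_shift (U : GuideL2 d) :
    shift U =ᵐ[volume.restrict (guide d)] fun y => U (y + eLast d) := MemLp.coeFn_toLp _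

lemma norm_sq_shift (U : GuideL2 d) : ‖shift U‖ ^ 2 = ∫ y in upper d, ‖U y‖ ^ 2 := by
  rw [norm_sq_eq_integral, ← integral_comp_add_eLast]
  refine integral_congr_ae ?_
  filter_upwards [coeFn_shift U] with y hy
  rw [hy]

lemma norm_sq_cell_add_shift (U : GuideL2 d) :
    (∫ y in cell d, ‖U y‖ ^ 2) + ‖shift U‖ ^ 2 = ‖U‖ ^ 2 := by
  rw [norm_sq_shift, integral_cell_add_upper (integrable_norm_sq (Lp.memLp U)),
    norm_sq_eq_integral]

/-- The shift is moved onto the other factor, leaving a pairing of `U` itself with a fixed function,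
which is continuous in `U`. -/
lemma integral_shift_mul (U : Space d → ℂ) (F : Space d → ℂ) :
    ∫ y in guide d, U (y + eLast d) * F y =
      ∫ y in guide d, U y * (upper d).indicator (fun y => F (y - eLast d)) y := by
  have h1 := integral_comp_add_eLast (fun y => U y * F (y - eLast d))
  simp only [add_sub_cancel_right] at h1
  rw [h1, ← Set.inter_eq_right.2 (upper_subset_guide (d := d)), ← setIntegral_indicator
    measurableSet_upper]
  refine integral_congr_ae (Eventually.of_forall fun y => ?_)
  by_cases h : y ∈ upper d
  · simp [h, Set.inter_eq_right.2 (upper_subset_guide (d := d))]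
  · simp [h, Set.inter_eq_right.2 (upper_subset_guide (d := d))]

lemma memLp_indicator_comp_sub {V : Space d → ℂ} (hV : PerTest V) :
    MemLp ((upper d).indicator fun y => V (y - eLast d)) 2 (volume.restrict (guide d)) := by
  have h : PerTest fun y => V (y - eLast d) := by
    simpa [sub_eq_add_neg] using hV.comp_add (-eLast d)
  exact (h.memLp 2).indicator measurableSet_upper

lemma PerTest.green_shift (θ : Space d) {W V : Space d → ℂ} (hW : PerTest W) (hV : PerTest V) :
    (∫ y in guide d, W (y + eLast d) * HalfGuide.dirDeriv θ V y) +
      (∫ y in guide d, HalfGuide.dirDeriv θ W (y + eLast d) * V y) =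
      -(θ (Fin.last d) * ∫ z in face (Fin.last d),
        W (facePoint (Fin.last d) 1 z) * V (facePoint (Fin.last d) 0 z)) := by
  have h := (hW.comp_add (eLast d)).green θ hV
  simpa only [dirDeriv_comp_add, eLast, facePoint_add_single, zero_add] using h

/-- Green's formula in `{yₙ > 1}`. -/
lemma perSpace_green_shift (θ : Space d) {x : Ambient d} (hx : x ∈ perSpace θ) {V : Space d → ℂ}
    (hV : PerTest V) :
    (∫ y in guide d, shift (funL x) y * dirDeriv θ V y) +
      (∫ y in guide d, shift (derivL x) y * V y) =
      -(θ (Fin.last d) * ∫ z in face (Fin.last d),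
        trace1L x z * V (facePoint (Fin.last d) 0 z)) := by
  have hs : ∀ (U : GuideL2 d) (F : Space d → ℂ), ∫ y in guide d, shift U y * F y =
      ∫ y in guide d, U y * (upper d).indicator (fun y => F (y - eLast d)) y := by
    intro U F
    rw [← integral_shift_mul]
    refine integral_congr_ae ?_
    filter_upwards [coeFn_shift U] with y hy
    rw [hy]
  rw [hs, hs]
  refine perSpace_induction θ (p := fun x => (∫ y in guide d, funL x y * (upper d).indicator
      (fun y => dirDeriv θ V (y - eLast d)) y) + (∫ y in guide d, derivL x y * (upper d).indicator
      (fun y => V (y - eLast d)) y) = -(θ (Fin.last d) * ∫ z in face (Fin.last d),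
        trace1L x z * V (facePoint (Fin.last d) 0 z))) ?_ ?_ hx
  · refine isClosed_eq (((continuous_integral_mul
      (memLp_indicator_comp_sub (hV.dirDeriv θ))).comp funL.continuous).add
      ((continuous_integral_mul (memLp_indicator_comp_sub hV)).comp derivL.continuous)) ?_
    exact (continuous_const.mul ((continuous_integral_mul (memLp_face hV.continuous 0 2)).comp
      trace1L.continuous)).neg
  · intro W hW
    rw [funL_embed, derivL_embed, trace1L_embed]
    refine Eq.trans ?_ ((hW.green_shift θ hV).trans ?_)
    · rw [integral_shift_mul, integral_shift_mul]
      congr 1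
      · refine integral_congr_ae ?_
        filter_upwards [(hW.memLp 2).coeFn_toLp] with y hy
        rw [hy]
      · refine integral_congr_ae ?_
        filter_upwards [((hW.dirDeriv θ).memLp 2).coeFn_toLp] with y hy
        rw [hy]
    · congr 2
      refine integral_congr_ae ?_
      filter_upwards [coeFn_sectionTrace hW.continuous 1] with y hy
      rw [hy]

/-- This is the bottom estimate for the function translated by `eₙ`, with the integral over its cell
enlarged to the whole half-cylinder. -/
theorem exists_trace1_bound (θ : Space d) (hθ : 0 < θ (Fin.last d)) :
    ∃ C, 0 ≤ C ∧ ∀ x ∈ perSpace θ, ‖trace1L x‖ ^ 2 ≤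
      C * (‖funL x‖ ^ 2 + ‖derivL x‖ ^ 2) := by
  obtain ⟨C, hC, h⟩ := exists_trace_estimate_cell θ hθ
  refine ⟨C, hC, fun x hx => perSpace_induction θ (p := fun x => ‖trace1L x‖ ^ 2 ≤
      C * (‖funL x‖ ^ 2 + ‖derivL x‖ ^ 2)) ?_ ?_ hx⟩
  · exact isClosed_le (by fun_prop) (by fun_prop)
  · intro V hV
    have hV' := hV.comp_add (eLast d)
    have h1 := h _ hV'
    simp only [dirDeriv_comp_add, eLast, facePoint_add_single, zero_add] at h1
    rw [funL_embed, derivL_embed, trace1L_embed, norm_sq_sectionTrace, norm_sq_eq_integral,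
      norm_sq_eq_integral, setIntegral_norm_sq_toLp _ le_rfl, setIntegral_norm_sq_toLp _ le_rfl,
      ← integral_add_norm_sq (hV.memLp 2) ((hV.dirDeriv θ).memLp 2) le_rfl]
    refine h1.trans (mul_le_mul_of_nonneg_left ?_ hC)
    have hi := (integrable_norm_sq (hV.memLp 2)).add
      (integrable_norm_sq ((hV.dirDeriv θ).memLp 2))
    have hi' : Integrable (fun y => ‖V (y + eLast d)‖ ^ 2 + ‖dirDeriv θ V (y + eLast d)‖ ^ 2)
        (volume.restrict (guide d)) :=
      (integrable_norm_sq (memLp_comp_add_eLast (hV.memLp 2))).add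
      (integrable_norm_sq (memLp_comp_add_eLast ((hV.dirDeriv θ).memLp 2)))
    calc _ ≤ ∫ y in guide d, (‖V (y + eLast d)‖ ^ 2 + ‖dirDeriv θ V (y + eLast d)‖ ^ 2) :=
          setIntegral_mono_set hi' (Eventually.of_forall fun _ => by positivity)
            cell_subset_guide.eventuallyLE
      _ = ∫ y in upper d, (‖V y‖ ^ 2 + ‖dirDeriv θ V y‖ ^ 2) :=
          integral_comp_add_eLast (fun y => ‖V y‖ ^ 2 + ‖dirDeriv θ V y‖ ^ 2)
      _ ≤ _ := setIntegral_mono_set hi (Eventually.of_forall fun _ => by positivity)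
            upper_subset_guide.eventuallyLE

/-! ### The weak problem -/

lemma inner_toLp {α : Type*} [MeasurableSpace α] {m : Measure α} {F : α → ℂ} (hF : MemLp F 2 m)
    (U : Lp ℂ 2 m) : ⟪hF.toLp F, U⟫_ℂ = ∫ y, U y * (starRingEnd ℂ) (F y) ∂m := by
  rw [L2.inner_def]
  refine integral_congr_ae ?_
  filter_upwards [hF.coeFn_toLp] with y hy
  rw [hy, RCLike.inner_apply]

/-- Lax–Milgram, with coercivity in modulus. -/
lemma exists_inverse_of_coercive {E : Type*} [NormedAddCommGroup E] [InnerProductSpace ℂ E]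
    [CompleteSpace E] (A : E →L[ℂ] E) {c : ℝ} (hc : 0 < c)
    (h : ∀ x, c * ‖x‖ ^ 2 ≤ ‖⟪x, A x⟫_ℂ‖) :
    ∃ B : E →L[ℂ] E, (∀ x, B (A x) = x) ∧ ∀ x, A (B x) = x := by
  have hAu : IsUnit A := by
    refine ContinuousLinearMap.isUnit_of_forall_le_norm_inner_map A (c := c.toNNReal)
      (Real.toNNReal_pos.2 hc) fun x => ?_
    rw [norm_inner_symm, Real.coe_toNNReal _ hc.le, mul_comm]
    exact h x
  obtain ⟨u, hu⟩ := hAu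
  refine ⟨(↑u⁻¹ : E →L[ℂ] E), fun x => ?_, fun x => ?_⟩
  · rw [← mul_apply_eq_comp, ← hu, Units.inv_mul]; rfl
  · rw [← hu, ← mul_apply_eq_comp, Units.mul_inv]; rfl

/-- The Hilbert space of periodic functions with square integrable directional derivative. -/
def PerH (θ : Space d) : Type := perSpace θ

noncomputable instance (θ : Space d) : NormedAddCommGroup (PerH θ) :=
  inferInstanceAs (NormedAddCommGroup (perSpace θ))

noncomputable instance (θ : Space d) : InnerProductSpace ℂ (PerH θ) :=
  inferInstanceAs (InnerProductSpace ℂ (perSpace θ))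

instance (θ : Space d) : CompleteSpace (PerH θ) :=
  inferInstanceAs (CompleteSpace (perSpace θ))

/-- The inclusion in the ambient space. -/
noncomputable def embL (θ : Space d) : PerH θ →L[ℂ] Ambient d := (perSpace θ).subtypeL

lemma embL_mem (θ : Space d) (x : PerH θ) : embL θ x ∈ perSpace θ := Subtype.property (p := (· ∈ perSpace θ)) x

/-- The projection of the space of periodic functions on pairs. -/
noncomputable def pairL (θ : Space d) : PerH θ →L[ℂ] PairL2 d :=
  (WithLp.fstL 2 ℂ (PairL2 d) (TraceL2 d)).comp (embL θ)

/-- The trace on `{yₙ = 0}` on the space of periodic functions. -/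
noncomputable def bottomL (θ : Space d) : PerH θ →L[ℂ] SectionL2 d :=
  trace0L.comp (embL θ)

lemma exists_adjoint {E F : Type*} [NormedAddCommGroup E] [InnerProductSpace ℂ E]
    [CompleteSpace E] [NormedAddCommGroup F] [InnerProductSpace ℂ F] [CompleteSpace F]
    (p : E →L[ℂ] F) : ∃ T : F →L[ℂ] E, ∀ v y, ⟪v, T y⟫_ℂ = ⟪p v, y⟫_ℂ :=
  ⟨ContinuousLinearMap.adjoint p, fun v y => ContinuousLinearMap.adjoint_inner_right p v y⟩

lemma pairL_fst (θ : Space d) (x : PerH θ) : (pairL θ x).fst = funL (embL θ x) := rfl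

lemma pairL_snd (θ : Space d) (x : PerH θ) : (pairL θ x).snd = derivL (embL θ x) := rfl

/-- A periodic test function as an element of the Hilbert space. -/
noncomputable def testElem (θ : Space d) {V : Space d → ℂ} (hV : PerTest V) : PerH θ :=
  ⟨embed θ hV, (testSubmodule θ).le_topologicalClosure ⟨V, hV, rfl⟩⟩

/-- The inner product is antilinear in its first argument while the weak formulation is bilinear;
taking the conjugate of the test function reconciles the two. -/
lemma inner_pairL_testElem_conj (θ : Space d) {V : Space d → ℂ} (hV : PerTest V) (y : PairL2 d) :
    ⟪pairL θ (testElem θ hV.conj), y⟫_ℂ =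
      (∫ z in guide d, y.fst z * V z) + ∫ z in guide d, y.snd z * dirDeriv θ V z := by
  have h1 : ⟪pairL θ (testElem θ hV.conj), y⟫_ℂ =
    ⟪(hV.conj.memLp 2).toLp _, y.fst⟫_ℂ + ⟪((hV.conj.dirDeriv θ).memLp 2).toLp _, y.snd⟫_ℂ := rfl
  rw [h1, inner_toLp, inner_toLp]
  congr 1
  · simp
  · refine integral_congr_ae (Eventually.of_forall fun z => ?_)
    simp only
    rw [dirDeriv_conj θ (hV.differentiable z), Complex.conj_conj]

lemma inner_trace0L_testElem_conj (θ : Space d) {V : Space d → ℂ} (hV : PerTest V)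
    (φ : SectionL2 d) :
    ⟪trace0L (embL θ (testElem θ hV.conj)), φ⟫_ℂ =
      ∫ z in face (Fin.last d), φ z * V (facePoint (Fin.last d) 0 z) := by
  have h1 : trace0L (embL θ (testElem θ hV.conj)) = (memLp_face hV.conj.continuous 0 2).toLp _ :=
    rfl
  rw [h1, inner_toLp]
  simp

lemma eq_of_forall_testElem (θ : Space d) {f g : PerH θ → ℂ} (hf : Continuous f)
    (hg : Continuous g) (h : ∀ V, ∀ hV : PerTest V, f (testElem θ hV) = g (testElem θ hV))
    (x : PerH θ) : f x = g x := by
  have hd : Dense (Set.range fun v : testSubmodule θ =>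
      (⟨v, (testSubmodule θ).le_topologicalClosure v.2⟩ : perSpace θ)) := by
    intro x
    rw [closure_subtype]
    have : ((↑) '' Set.range fun v : testSubmodule θ =>
      (⟨v, (testSubmodule θ).le_topologicalClosure v.2⟩ : perSpace θ)) =
      (testSubmodule θ : Set (Ambient d)) := by
      ext y
      constructor
      · rintro ⟨_, ⟨v, rfl⟩, rfl⟩
        exact v.2
      · intro hy
        exact ⟨_, ⟨⟨y, hy⟩, rfl⟩, rfl⟩
    rw [this]
    exact x.2
  refine congrFun (hf.ext_on hd hg ?_) x
  rintro _ ⟨⟨_, V, hV, rfl⟩, rfl⟩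
  exact h V hV

lemma norm_sq_pair (y : PairL2 d) : ‖y‖ ^ 2 = ‖y.fst‖ ^ 2 + ‖y.snd‖ ^ 2 := by
  rw [WithLp.prod_norm_sq_eq_of_L2]

lemma setIntegral_cell_le (U : GuideL2 d) : ∫ y in cell d, ‖U y‖ ^ 2 ≤ ‖U‖ ^ 2 := by
  rw [norm_sq_eq_integral]
  exact setIntegral_mono_set (integrable_norm_sq (Lp.memLp U))
    (Eventually.of_forall fun _ => by positivity) cell_subset_guide.eventuallyLE

/-- Both traces are controlled by the graph norm, so adding them to the norm of the space changes it
only up to equivalence. -/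
theorem exists_norm_le_pairL (θ : Space d) (hθ : 0 < θ (Fin.last d)) :
    ∃ C, 0 < C ∧ ∀ x : PerH θ, ‖x‖ ^ 2 ≤ C * ‖pairL θ x‖ ^ 2 := by
  obtain ⟨C0, hC0, h0⟩ := exists_trace0_bound θ hθ
  obtain ⟨C1, hC1, h1⟩ := exists_trace1_bound θ hθ
  refine ⟨1 + C0 + C1, by positivity, fun x => ?_⟩
  have e : ‖x‖ ^ 2 = ‖(embL θ x)‖ ^ 2 := rfl
  rw [e, norm_sq_ambient, norm_sq_pair, pairL_fst, pairL_snd]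
  have a0 := h0 _ (embL_mem θ x)
  have a1 := h1 _ (embL_mem θ x)
  have b0 := setIntegral_cell_le (funL (embL θ x))
  have b1 := setIntegral_cell_le (derivL (embL θ x))
  nlinarith [mul_le_mul_of_nonneg_left (add_le_add b0 b1) hC0]

/-- The continuous inverse of `pairL`, defined on all periodic weakly differentiable pairs. -/
theorem exists_lift (θ : Space d) (hθ : 0 < θ (Fin.last d)) :
    ∃ R : PairL2 d →L[ℂ] PerH θ, (∀ x, R (pairL θ x) = x) ∧
      ∀ y : PairL2 d, PerWeak θ y.fst y.snd → pairL θ (R y) = y := by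
  obtain ⟨C, hC, h⟩ := exists_norm_le_pairL θ hθ
  set p := pairL θ with hp
  obtain ⟨p', hp'⟩ := exists_adjoint (E := PerH θ) (F := PairL2 d) (pairL θ)
  -- Since `p` is bounded below, `p* p` is invertible and `(p* p)⁻¹ p*` is a left inverse of `p`,
  -- with `p (p* p)⁻¹ p*` the orthogonal projection onto the range.
  obtain ⟨B, hinv, hinv'⟩ := exists_inverse_of_coercive (E := PerH θ) (p'.comp p) (inv_pos.2 hC) fun x => by
    rw [ContinuousLinearMap.comp_apply, hp', inner_self_eq_norm_sq_to_K]
    have := h x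
    rw [inv_mul_le_iff₀ hC]
    simpa using this
  refine ⟨B.comp p', fun x => hinv x, fun y hy => ?_⟩
  set x := (B.comp p') y with hx
  -- The residual is orthogonal to the range of `p`, in particular to all test functions, and
  -- remains a periodic weakly differentiable pair; `ae_eq_zero_of_orthogonal` then forces it to
  -- vanish.
  set r := y - p x with hr
  have hadj : p' r = 0 := by
    rw [hr, map_sub, sub_eq_zero]
    exact (hinv' (p' y)).symm
  have hw : PerWeak θ r.fst r.snd := by
    intro V hV
    have h1 := hy V hV
    have h2 := perSpace_perWeak θ (embL_mem θ x) V hV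
    have hV2 := hV.toPerTest.memLp 2
    have hD2 := (hV.toPerTest.dirDeriv θ).memLp 2
    rw [integral_mul_eq_inner hV2, integral_mul_eq_inner hD2] at h1 h2 ⊢
    have e1 : r.fst = y.fst - funL (embL θ x) := rfl
    have e2 : r.snd = y.snd - derivL (embL θ x) := rfl
    rw [e1, e2, inner_sub_right, inner_sub_right]
    linear_combination h1 - h2
  have ho : ∀ V, PerTest V → (∫ z in guide d, r.fst z * V z) +
      ∫ z in guide d, r.snd z * dirDeriv θ V z = 0 := by
    intro V hV
    rw [← inner_pairL_testElem_conj θ hV, ← hp', hadj]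
    exact inner_zero_right (E := PerH θ) _
  obtain ⟨z1, z2⟩ := ae_eq_zero_of_orthogonal θ hθ (Lp.memLp r.fst) (Lp.memLp r.snd) hw ho
  have hr0 : r = 0 := by
    have e1 : r.fst = 0 := (Lp.eq_zero_iff_ae_eq_zero).2 z1
    have e2 : r.snd = 0 := (Lp.eq_zero_iff_ae_eq_zero).2 z2
    have : ‖r‖ ^ 2 = 0 := by rw [norm_sq_pair, e1, e2]; simp
    simpa using this
  exact (sub_eq_zero.1 hr0).symm

/-! ### Weak solutions and their solution operator -/

/-- The weak formulation of the half-guide problem, tested against periodic functions. -/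
structure IsWeakSol (θ : Space d) (μ ρ : Space d → ℝ) (ω : ℂ) (φ : SectionL2 d)
    (U G : GuideL2 d) : Prop where
  green : ∀ V : Space d → ℂ, PerTest V →
    (∫ y in guide d, U y * dirDeriv θ V y) + (∫ y in guide d, G y * V y) =
      -(θ (Fin.last d) * ∫ z in face (Fin.last d), φ z * V (facePoint (Fin.last d) 0 z))
  flux : PerWeak θ (fun y => (μ y : ℂ) * G y) (fun y => -((ρ y : ℂ) * ω ^ 2 * U y))

lemma IsWeakSol.perWeak {θ : Space d} {μ ρ : Space d → ℝ} {ω : ℂ} {φ : SectionL2 d}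
    {U G : GuideL2 d} (h : IsWeakSol θ μ ρ ω φ U G) : PerWeak θ U G := by
  intro V hV
  obtain ⟨ε, hε, h0⟩ := hV.vanish_bot
  rw [h.green V hV.toPerTest]
  have : ∀ z, V (facePoint (Fin.last d) 0 z) = 0 := fun z =>
    h0 _ (by rw [facePoint_self]; exact hε.le)
  simp [this]

lemma perWeak_congr {θ : Space d} {U G U' G' : Space d → ℂ}
    (hU : U =ᵐ[volume.restrict (guide d)] U') (hG : G =ᵐ[volume.restrict (guide d)] G')
    (h : PerWeak θ U G) : PerWeak θ U' G' := by
  intro V hV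
  rw [← h V hV]
  congr 1
  · refine integral_congr_ae ?_
    filter_upwards [hU] with y hy
    rw [hy]
  · refine integral_congr_ae ?_
    filter_upwards [hG] with y hy
    rw [hy]

/-- Coefficients of the half-guide problem. -/
structure Coeffs (μ ρ : Space d → ℝ) (ω : ℂ) : Prop where
  contμ : Continuous μ
  contρ : Continuous ρ
  bounds : ∃ m M : ℝ, 0 < m ∧ ∀ y, m ≤ μ y ∧ μ y ≤ M ∧ m ≤ ρ y ∧ ρ y ≤ M
  im_pos : 0 < ω.im

namespace Coeffs

variable {μ ρ : Space d → ℝ} {ω : ℂ} (hc : Coeffs μ ρ ω)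
include hc

lemma μ_pos (y : Space d) : 0 < μ y := by
  obtain ⟨m, M, hm, h⟩ := hc.bounds; exact hm.trans_le (h y).1

lemma ρ_pos (y : Space d) : 0 < ρ y := by
  obtain ⟨m, M, hm, h⟩ := hc.bounds; exact hm.trans_le (h y).2.2.1

lemma ω_ne : ω ≠ 0 := by
  rintro rfl; simpa using hc.im_pos

lemma memLp_μ : MemLp (fun y => (μ y : ℂ)) ∞ (volume.restrict (guide d)) := by
  obtain ⟨m, M, hm, h⟩ := hc.bounds
  refine memLp_top_of_bound (Complex.continuous_ofReal.comp hc.contμ).aestronglyMeasurable M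
    (Eventually.of_forall fun y => ?_)
  rw [Complex.norm_real, Real.norm_of_nonneg (hc.μ_pos y).le]
  exact (h y).2.1

lemma memLp_ρ : MemLp (fun y => -((ρ y : ℂ) * ω ^ 2)) ∞ (volume.restrict (guide d)) := by
  obtain ⟨m, M, hm, h⟩ := hc.bounds
  refine memLp_top_of_bound ((Complex.continuous_ofReal.comp
    hc.contρ).mul continuous_const).neg.aestronglyMeasurable (M * ‖ω ^ 2‖)
    (Eventually.of_forall fun y => ?_)
  rw [norm_neg, norm_mul, Complex.norm_real, Real.norm_of_nonneg (hc.ρ_pos y).le]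
  exact mul_le_mul_of_nonneg_right (h y).2.2.2 (norm_nonneg _)

lemma memLp_μ_inv : MemLp (fun y => (((μ y)⁻¹ : ℝ) : ℂ)) ∞ (volume.restrict (guide d)) := by
  obtain ⟨m, M, hm, h⟩ := hc.bounds
  refine memLp_top_of_bound (Complex.continuous_ofReal.comp
    (hc.contμ.inv₀ fun y => (hc.μ_pos y).ne')).aestronglyMeasurable m⁻¹
    (Eventually.of_forall fun y => ?_)
  rw [Complex.norm_real, Real.norm_of_nonneg (inv_pos.2 (hc.μ_pos y)).le]
  exact inv_anti₀ hm (h y).1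

lemma memLp_ρ_inv :
    MemLp (fun y => -(((ρ y)⁻¹ : ℝ) : ℂ) * (ω ^ 2)⁻¹) ∞ (volume.restrict (guide d)) := by
  obtain ⟨m, M, hm, h⟩ := hc.bounds
  refine memLp_top_of_bound ((Complex.continuous_ofReal.comp
    (hc.contρ.inv₀ fun y => (hc.ρ_pos y).ne')).neg.mul continuous_const).aestronglyMeasurable
    (m⁻¹ * ‖(ω ^ 2)⁻¹‖) (Eventually.of_forall fun y => ?_)
  rw [norm_mul, norm_neg, Complex.norm_real, Real.norm_of_nonneg (inv_pos.2 (hc.ρ_pos y)).le]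
  exact mul_le_mul_of_nonneg_right (inv_anti₀ hm (h y).2.2.1) (norm_nonneg _)

/-- The map `(F, F') ↦ (F / μ, -F' / (ρ ω²))`. -/
noncomputable def mulPair : PairL2 d →L[ℂ] PairL2 d :=
  (WithLp.prodContinuousLinearEquiv 2 ℂ (GuideL2 d) (GuideL2 d)).symm.toContinuousLinearMap.comp
    (((mulOp hc.memLp_μ_inv).comp (WithLp.fstL 2 ℂ (GuideL2 d) (GuideL2 d))).prod
      ((mulOp hc.memLp_ρ_inv).comp (WithLp.sndL 2 ℂ (GuideL2 d) (GuideL2 d))))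

lemma mulPair_fst (y : PairL2 d) : (hc.mulPair y).fst = mulOp hc.memLp_μ_inv y.fst := rfl

lemma mulPair_snd (y : PairL2 d) : (hc.mulPair y).snd = mulOp hc.memLp_ρ_inv y.snd := rfl

lemma inner_mulPair (y : PairL2 d) : ∃ α β : ℝ, ⟪y, hc.mulPair y⟫_ℂ = α - β * (ω ^ 2)⁻¹ ∧
    α = ∫ z in guide d, (μ z)⁻¹ * ‖y.fst z‖ ^ 2 ∧
    β = ∫ z in guide d, (ρ z)⁻¹ * ‖y.snd z‖ ^ 2 := by
  refine ⟨_, _, ?_, rfl, rfl⟩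
  have h0 : ⟪y, hc.mulPair y⟫_ℂ = ⟪y.fst, mulOp hc.memLp_μ_inv y.fst⟫_ℂ +
    ⟪y.snd, mulOp hc.memLp_ρ_inv y.snd⟫_ℂ := rfl
  rw [h0, L2.inner_def, L2.inner_def, ← integral_complex_ofReal, ← integral_complex_ofReal,
    ← integral_mul_const, sub_eq_add_neg, ← integral_neg]
  congr 1
  · refine integral_congr_ae ?_
    filter_upwards [coeFn_mulOp hc.memLp_μ_inv y.fst] with z hz
    rw [hz, RCLike.inner_apply, mul_assoc, Complex.mul_conj']
    push_cast; ring
  · refine integral_congr_ae ?_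
    filter_upwards [coeFn_mulOp hc.memLp_ρ_inv y.snd] with z hz
    rw [hz, RCLike.inner_apply, mul_assoc, Complex.mul_conj']
    push_cast; ring

/-- With `α`, `β` the weighted square norms of the two components, the form is `α - β ω⁻²`.
Multiplication by `ω` gives imaginary part `Im ω (α + β / |ω|²)`, and `α`, `β` are at least `M⁻¹`
times the unweighted square norms. -/
lemma exists_coercive : ∃ c : ℝ, 0 < c ∧ ∀ y : PairL2 d, c * ‖y‖ ^ 2 ≤ ‖⟪y, hc.mulPair y⟫_ℂ‖ := by
  obtain ⟨m, M, hm, h⟩ := hc.bounds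
  have hM : 0 < M := hm.trans_le ((h 0).1.trans (h 0).2.1)
  have hω := norm_pos_iff.2 hc.ω_ne
  have him := hc.im_pos
  set k := min 1 (‖ω‖ ^ 2)⁻¹ with hk
  have hk0 : 0 < k := lt_min one_pos (by positivity)
  refine ⟨ω.im / ‖ω‖ * (k * M⁻¹), by positivity, fun y => ?_⟩
  obtain ⟨α, β, e, hα, hβ⟩ := hc.inner_mulPair y
  have hinv : ∀ {f : Space d → ℝ}, Continuous f → (∀ y, m ≤ f y) → ∀ V : GuideL2 d,
      Integrable (fun z => (f z)⁻¹ * ‖V z‖ ^ 2) (volume.restrict (guide d)) := by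
    intro f hf hmf V
    refine (integrable_norm_sq (Lp.memLp V)).bdd_mul (c := m⁻¹)
      (hf.inv₀ fun y => (hm.trans_le (hmf y)).ne').aestronglyMeasurable
      (Eventually.of_forall fun z => ?_)
    rw [Real.norm_of_nonneg (inv_pos.2 (hm.trans_le (hmf z))).le]
    exact inv_anti₀ hm (hmf z)
  have hα1 : M⁻¹ * ‖y.fst‖ ^ 2 ≤ α := by
    rw [hα, norm_sq_eq_integral, ← integral_const_mul]
    refine integral_mono ((integrable_norm_sq (Lp.memLp _)).const_mul _)
      (hinv hc.contμ (fun y => (h y).1) _) fun z => ?_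
    exact mul_le_mul_of_nonneg_right (inv_anti₀ (hc.μ_pos z) (h z).2.1) (by positivity)
  have hβ1 : M⁻¹ * ‖y.snd‖ ^ 2 ≤ β := by
    rw [hβ, norm_sq_eq_integral, ← integral_const_mul]
    refine integral_mono ((integrable_norm_sq (Lp.memLp _)).const_mul _)
      (hinv hc.contρ (fun y => (h y).2.2.1) _) fun z => ?_
    exact mul_le_mul_of_nonneg_right (inv_anti₀ (hc.ρ_pos z) (h z).2.2.2) (by positivity)
  have hα0 : 0 ≤ α := le_trans (by positivity) hα1
  have hβ0 : 0 ≤ β := le_trans (by positivity) hβ1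
  have key : ω.im * (α + β * (‖ω‖ ^ 2)⁻¹) ≤ ‖ω‖ * ‖⟪y, hc.mulPair y⟫_ℂ‖ := by
    rw [e, ← norm_mul]
    refine le_trans (le_of_eq ?_) (Complex.abs_im_le_norm _ |>.trans' (le_abs_self _))
    have : ω * (α - β * (ω ^ 2)⁻¹) = ω * α - β * ω⁻¹ := by
      field_simp [hc.ω_ne]
    rw [this]
    simp only [Complex.sub_im, Complex.mul_im, Complex.ofReal_re, Complex.ofReal_im,
      Complex.inv_im, mul_zero, zero_mul, add_zero, zero_add, Complex.normSq_eq_norm_sq]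
    ring
  have h2 : k * M⁻¹ * ‖y‖ ^ 2 ≤ α + β * (‖ω‖ ^ 2)⁻¹ := by
    rw [norm_sq_pair]
    have k1 : k ≤ 1 := min_le_left _ _
    have k2 : k ≤ (‖ω‖ ^ 2)⁻¹ := min_le_right _ _
    calc k * M⁻¹ * (‖y.fst‖ ^ 2 + ‖y.snd‖ ^ 2)
        = k * (M⁻¹ * ‖y.fst‖ ^ 2) + k * (M⁻¹ * ‖y.snd‖ ^ 2) := by ring
      _ ≤ 1 * α + (‖ω‖ ^ 2)⁻¹ * β := by gcongr
      _ = _ := by ring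
  rw [div_mul_eq_mul_div, div_mul_eq_mul_div, div_le_iff₀ hω, mul_comm _ ‖ω‖]
  refine le_trans ?_ key
  rw [mul_assoc]
  exact mul_le_mul_of_nonneg_left h2 him.le

/-- Solvability of the variational formulation. -/
theorem exists_variational {θ : Space d} (hθ : 0 < θ (Fin.last d)) :
    ∃ K : SectionL2 d →L[ℂ] PerH θ, ∀ x φ, K φ = x ↔ ∀ V, PerTest V →
      (∫ z in guide d, (hc.mulPair (pairL θ x)).fst z * V z) +
        (∫ z in guide d, (hc.mulPair (pairL θ x)).snd z * dirDeriv θ V z) =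
      -(θ (Fin.last d) * ∫ z in face (Fin.last d), φ z * V (facePoint (Fin.last d) 0 z)) := by
  obtain ⟨C, hC, hp⟩ := exists_norm_le_pairL θ hθ
  obtain ⟨c, hc0, hco⟩ := hc.exists_coercive
  obtain ⟨p', hp'⟩ := exists_adjoint (E := PerH θ) (F := PairL2 d) (pairL θ)
  -- The adjoint of the bottom trace represents the boundary term, so the solution is obtained by
  -- applying the inverse of the form operator to `-θₙ T φ`.
  obtain ⟨T, hT⟩ := exists_adjoint (E := PerH θ) (F := SectionL2 d) (bottomL θ)
  obtain ⟨A', hinv, hinv'⟩ := exists_inverse_of_coercive (E := PerH θ)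
      (p'.comp (hc.mulPair.comp (pairL θ))) (div_pos hc0 hC) fun x => by
    have e : ⟪x, (p'.comp (hc.mulPair.comp (pairL θ))) x⟫_ℂ =
        ⟪pairL θ x, hc.mulPair (pairL θ x)⟫_ℂ := hp' _ _
    rw [e]
    refine le_trans ?_ (hco (pairL θ x))
    rw [div_mul_eq_mul_div, div_le_iff₀ hC]
    have := mul_le_mul_of_nonneg_left (hp x) hc0.le
    linarith
  generalize hA : p'.comp (hc.mulPair.comp (pairL θ)) = A at hinv hinv'
  have i1 : ∀ x v, ⟪v, A x⟫_ℂ = ⟪pairL θ v, hc.mulPair (pairL θ x)⟫_ℂ := fun x v => by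
    rw [← hA]; exact hp' _ _
  clear hA
  have i2 : ∀ φ v, ⟪v, (-(θ (Fin.last d) : ℂ)) • T φ⟫_ℂ =
      -(θ (Fin.last d) * ⟪trace0L (embL θ v), φ⟫_ℂ) := fun φ v => by
    have h1 : ⟪v, (-(θ (Fin.last d) : ℂ)) • T φ⟫_ℂ = (-(θ (Fin.last d) : ℂ)) * ⟪v, T φ⟫_ℂ :=
      inner_smul_right (E := PerH θ) _ _ _
    rw [h1, hT, neg_mul]
    rfl
  refine ⟨A'.comp ((-(θ (Fin.last d) : ℂ)) • T), fun x φ => ?_⟩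
  have hK : (A'.comp ((-(θ (Fin.last d) : ℂ)) • T)) φ = A' ((-(θ (Fin.last d) : ℂ)) • T φ) := rfl
  rw [hK]
  have hiff : A' ((-(θ (Fin.last d) : ℂ)) • T φ) = x ↔ A x = (-(θ (Fin.last d) : ℂ)) • T φ :=
    ⟨fun h => by rw [← h, hinv'], fun h => by rw [← h, hinv]⟩
  rw [hiff]
  constructor
  · intro h V hV
    rw [← inner_pairL_testElem_conj θ hV, ← inner_trace0L_testElem_conj θ hV, ← i1, h, i2]
  · intro h
    refine ext_inner_left (E := PerH θ) ℂ fun v => ?_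
    have c1 : Continuous fun v : PerH θ => ⟪v, A x⟫_ℂ :=
      Continuous.inner (E := PerH θ) continuous_id continuous_const
    have c2 : Continuous fun v : PerH θ => ⟪v, (-(θ (Fin.last d) : ℂ)) • T φ⟫_ℂ :=
      Continuous.inner (E := PerH θ) continuous_id continuous_const
    refine eq_of_forall_testElem θ c1 c2 (fun V hV => ?_) v
    -- Testing with the conjugate function turns the bilinear identity into equality of inner
    -- products with the test element of `V`; density extends it to the whole space.
    have hh := h _ hV.conj
    rw [← inner_pairL_testElem_conj θ hV.conj, ← inner_trace0L_testElem_conj θ hV.conj] at hh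
    have e : testElem θ hV.conj.conj = testElem θ hV := by
      have : (fun y => (starRingEnd ℂ) ((starRingEnd ℂ) (V y))) = V := by ext y; simp
      simp only [this]
    rw [e] at hh
    rw [i1, i2]
    exact hh

/-- Exchange of the components of a pair. -/
noncomputable def _root_.HalfGuide.swapL : PairL2 d →L[ℂ] PairL2 d :=
  (WithLp.prodContinuousLinearEquiv 2 ℂ (GuideL2 d) (GuideL2 d)).symm.toContinuousLinearMap.comp
    ((WithLp.sndL 2 ℂ (GuideL2 d) (GuideL2 d)).prod (WithLp.fstL 2 ℂ (GuideL2 d) (GuideL2 d)))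

/-- The solution operator of the weak problem. -/
theorem exists_solution_operator {θ : Space d} (hθ : 0 < θ (Fin.last d)) :
    ∃ S : SectionL2 d →L[ℂ] PairL2 d, ∀ φ U G,
      IsWeakSol θ μ ρ ω φ U G ↔ S φ = WithLp.toLp 2 (U, G) := by
  obtain ⟨R, hR, hlift⟩ := exists_lift θ hθ
  obtain ⟨K, hK⟩ := hc.exists_variational hθ
  -- `K φ` carries the flux pair `(μ G, -ρ ω² U)`. Dividing by the coefficients yields `(G, U)`, and
  -- the swap restores the order.
  refine ⟨swapL.comp (hc.mulPair.comp ((pairL θ).comp K)),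
    fun φ U G => ⟨fun h => ?_, fun h => ?_⟩⟩
  · -- a weak solution is given by the operator
    set F : GuideL2 d := mulOp hc.memLp_μ G with hF
    set F' : GuideL2 d := mulOp hc.memLp_ρ U with hF'
    have hw : PerWeak θ F F' := by
      refine perWeak_congr (coeFn_mulOp hc.memLp_μ G).symm ?_ h.flux
      filter_upwards [coeFn_mulOp hc.memLp_ρ U] with y hy
      rw [hy]; ring
    set x := R (WithLp.toLp 2 (F, F')) with hx
    have hpx : pairL θ x = WithLp.toLp 2 (F, F') := hlift (WithLp.toLp 2 (F, F')) hw
    have e1 : (hc.mulPair (pairL θ x)).fst = G := by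
      rw [mulPair_fst, hpx]
      refine Lp.ext ?_
      filter_upwards [coeFn_mulOp hc.memLp_μ_inv F, coeFn_mulOp hc.memLp_μ G] with y h1 h2
      refine h1.trans ?_
      have h3 : F y = (μ y : ℂ) * G y := h2
      rw [h3]
      have : (μ y : ℂ) ≠ 0 := by exact_mod_cast (hc.μ_pos y).ne'
      push_cast
      field_simp
    have e2 : (hc.mulPair (pairL θ x)).snd = U := by
      rw [mulPair_snd, hpx]
      refine Lp.ext ?_
      filter_upwards [coeFn_mulOp hc.memLp_ρ_inv F', coeFn_mulOp hc.memLp_ρ U] with y h1 h2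
      refine h1.trans ?_
      have h3 : F' y = -((ρ y : ℂ) * ω ^ 2) * U y := h2
      rw [h3]
      have : (ρ y : ℂ) ≠ 0 := by exact_mod_cast (hc.ρ_pos y).ne'
      have := hc.ω_ne
      push_cast
      field_simp
    have hKx : K φ = x := by
      rw [hK]
      intro V hV
      rw [e1, e2, ← h.green V hV, add_comm]
    have : (swapL.comp (hc.mulPair.comp ((pairL θ).comp K))) φ =
      WithLp.toLp 2 ((hc.mulPair (pairL θ (K φ))).snd, (hc.mulPair (pairL θ (K φ))).fst) := rfl
    rw [this, hKx, e1, e2]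
  · -- the operator gives a weak solution
    obtain ⟨x, hx⟩ : ∃ x, K φ = x := ⟨_, rfl⟩
    have h' : (swapL.comp (hc.mulPair.comp ((pairL θ).comp K))) φ =
      WithLp.toLp 2 ((hc.mulPair (pairL θ (K φ))).snd, (hc.mulPair (pairL θ (K φ))).fst) := rfl
    rw [h', hx] at h
    have hU : U = (hc.mulPair (pairL θ x)).snd := (congrArg WithLp.fst h).symm
    have hG : G = (hc.mulPair (pairL θ x)).fst := (congrArg WithLp.snd h).symm
    refine ⟨fun V hV => ?_, ?_⟩
    · rw [hU, hG, add_comm]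
      exact (hK x φ).1 hx V hV
    · refine perWeak_congr ?_ ?_ (perSpace_perWeak θ (embL_mem θ x))
      · rw [hG, mulPair_fst]
        filter_upwards [coeFn_mulOp hc.memLp_μ_inv (pairL θ x).fst] with y hy
        rw [hy]
        have : (μ y : ℂ) ≠ 0 := by exact_mod_cast (hc.μ_pos y).ne'
        have e : (pairL θ x).fst = funL (embL θ x) := rfl
        rw [e]
        push_cast
        field_simp
      · rw [hU, mulPair_snd]
        filter_upwards [coeFn_mulOp hc.memLp_ρ_inv (pairL θ x).snd] with y hy
        rw [hy]
        have : (ρ y : ℂ) ≠ 0 := by exact_mod_cast (hc.ρ_pos y).ne'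
        have := hc.ω_ne
        have e : (pairL θ x).snd = derivL (embL θ x) := rfl
        rw [e]
        push_cast
        field_simp

end Coeffs

/-! ### The propagation operator of the weak problem -/

lemma spectralRadius_lt_one_of_norm_pow_lt {E : Type*} [NormedAddCommGroup E] [NormedSpace ℂ E]
    [CompleteSpace E] (P : E →L[ℂ] E) {n : ℕ} (h : ‖P ^ (n + 1)‖ < 1) :
    spectralRadius ℂ P < 1 := by
  refine (spectrum.spectralRadius_le_pow_nnnorm_pow_one_div ℂ P n).trans_lt ?_
  -- Only an inequality holds in general: the identity of the zero space has norm `0`.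
  have h1 : (‖(1 : E →L[ℂ] E)‖₊ : ℝ≥0∞) ≤ 1 := by
    have : ‖(1 : E →L[ℂ] E)‖ ≤ 1 := ContinuousLinearMap.norm_id_le
    exact_mod_cast this
  have h2 : (‖P ^ (n + 1)‖₊ : ℝ≥0∞) < 1 := by
    have : ‖P ^ (n + 1)‖₊ < 1 := h
    exact_mod_cast this
  have hp : (0 : ℝ) < 1 / (n + 1) := by positivity
  calc _ ≤ (‖P ^ (n + 1)‖₊ : ℝ≥0∞) ^ (1 / (n + 1) : ℝ) * 1 := by
        gcongr
        exact ENNReal.rpow_le_one h1 hp.le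
    _ < 1 := by
        rw [mul_one]
        exact ENNReal.rpow_lt_one h2 hp

/-- An operator is a strict contraction in the long run if it decreases a quadratic functional
comparable to the norm by a definite fraction of the norm. -/
lemma spectralRadius_lt_one_of_dissipation {E : Type*} [NormedAddCommGroup E] [NormedSpace ℂ E]
    [CompleteSpace E] (P : E →L[ℂ] E) (N : E → ℝ) (hN : ∀ x, 0 ≤ N x) {B C : ℝ} (hB : 0 < B)
    (hC : 0 < C) (hNB : ∀ x, N x ≤ B * ‖x‖ ^ 2) (hd : ∀ x, ‖x‖ ^ 2 ≤ C * (N x - N (P x))) :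
    spectralRadius ℂ P < 1 := by
  -- Combining `N x ≤ B ‖x‖²` with `‖x‖² ≤ C (N x - N (P x))` gives `N (P x) ≤ (1 - 1/(CB)) N x`;
  -- the maximum with `0` keeps powers of `q` nonnegative.
  set q := max (1 - 1 / (C * B)) 0 with hq
  have hq0 : 0 ≤ q := le_max_right _ _
  have hq1 : q < 1 := max_lt (by
    have : 0 < 1 / (C * B) := by positivity
    linarith) one_pos
  have hstep : ∀ x, N (P x) ≤ q * N x := by
    intro x
    have h1 : N x / (C * B) ≤ N x - N (P x) := by
      rw [div_le_iff₀ (by positivity)]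
      have := hNB x
      have := mul_le_mul_of_nonneg_left (hd x) hB.le
      linarith
    have h2 : (1 - 1 / (C * B)) * N x ≤ q * N x :=
      mul_le_mul_of_nonneg_right (le_max_left _ _) (hN x)
    have h3 : (1 - 1 / (C * B)) * N x = N x - N x / (C * B) := by ring
    linarith
  have hpow : ∀ (n : ℕ) x, N ((P ^ n) x) ≤ q ^ n * N x := by
    intro n
    induction n with
    | zero => intro x; simp
    | succ n ih =>
      intro x
      rw [pow_succ', mul_apply_eq_comp]
      refine (hstep _).trans ?_
      rw [pow_succ', mul_assoc]
      exact mul_le_mul_of_nonneg_left (ih x) hq0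
  have hbound : ∀ (n : ℕ) x, ‖(P ^ n) x‖ ^ 2 ≤ C * B * q ^ n * ‖x‖ ^ 2 := by
    intro n x
    have h1 : ‖(P ^ n) x‖ ^ 2 ≤ C * N ((P ^ n) x) := by
      refine (hd _).trans (mul_le_mul_of_nonneg_left ?_ hC.le)
      linarith [hN (P ((P ^ n) x))]
    calc _ ≤ C * (q ^ n * (B * ‖x‖ ^ 2)) := h1.trans (mul_le_mul_of_nonneg_left
          ((hpow n x).trans (mul_le_mul_of_nonneg_left (hNB x) (by positivity))) hC.le)
      _ = _ := by ring
  have hlim : Tendsto (fun n : ℕ => C * B * q ^ (n + 1)) atTop (𝓝 0) := by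
    simpa using ((tendsto_add_atTop_iff_nat 1).2
      (tendsto_pow_atTop_nhds_zero_of_lt_one hq0 hq1)).const_mul (C * B)
  -- A factor below `1/4` for squared norms gives operator norm at most `1/2` for the corresponding
  -- power.
  obtain ⟨n, hn⟩ := (hlim.eventually_lt_const (show (0 : ℝ) < 1 / 4 by norm_num)).exists
  refine spectralRadius_lt_one_of_norm_pow_lt P (n := n) ?_
  refine lt_of_le_of_lt (ContinuousLinearMap.opNorm_le_bound _ (by norm_num : (0 : ℝ) ≤ 1 / 2)
    fun x => ?_) (by norm_num)
  refine abs_le_of_sq_le_sq' ?_ (by positivity) |>.2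
  refine (hbound (n + 1) x).trans ?_
  rw [mul_pow]
  have : (0 : ℝ) ≤ ‖x‖ ^ 2 := by positivity
  nlinarith

/-- Shifting upwards a test function that vanishes near the bottom produces one that vanishes for
`yₙ ≤ 1`, so the restriction to `{yₙ > 1}` created by the change of variables is immaterial. -/
lemma PerWeak.comp_add_eLast {θ : Space d} {A B : Space d → ℂ} (h : PerWeak θ A B) :
    PerWeak θ (fun y => A (y + eLast d)) (fun y => B (y + eLast d)) := by
  intro V hV
  have hV' : PerTest₀ fun y => V (y - eLast d) := hV.comp_sub (by simp [eLast])
  have key : ∀ (A F : Space d → ℂ), PerTest₀ F →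
      ∫ y in guide d, A (y + eLast d) * F y = ∫ y in guide d, A y * F (y - eLast d) := by
    intro A F hF
    obtain ⟨ε, hε, h0⟩ := hF.vanish_bot
    rw [integral_shift_mul]
    refine setIntegral_congr_fun measurableSet_guide fun y hy => ?_
    by_cases hu : y ∈ upper d
    · simp [hu]
    · have hle : y (Fin.last d) ≤ 1 := by
        by_contra hlt
        exact hu ⟨hy, not_le.1 hlt⟩
      simp only [Set.indicator_of_notMem hu]
      rw [h0 (y - eLast d) (by simp [eLast]; linarith)]
  have h1 := h _ hV'
  rw [key _ _ (hV.dirDeriv θ), key _ _ hV]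
  have e : ∀ y, dirDeriv θ (fun y => V (y - eLast d)) y = dirDeriv θ V (y - eLast d) := fun y => by
    simpa [sub_eq_add_neg] using dirDeriv_comp_add θ V (-eLast d) y
  simpa only [e] using h1

/-- The lift places `(U, G)` in the closure of the test functions. Its bottom trace must be `φ`,
because it appears in the same position in Green's formula and `θₙ` is nonzero. -/
lemma IsWeakSol.exists_perSpace {θ : Space d} (hθ : 0 < θ (Fin.last d)) {μ ρ : Space d → ℝ} {ω : ℂ}
    {φ : SectionL2 d} {U G : GuideL2 d} (h : IsWeakSol θ μ ρ ω φ U G) {R : PairL2 d →L[ℂ] PerH θ}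
    (hR : ∀ y : PairL2 d, PerWeak θ y.fst y.snd → pairL θ (R y) = y) :
    ∃ x : PerH θ, x = R (WithLp.toLp 2 (U, G)) ∧ pairL θ x = WithLp.toLp 2 (U, G) ∧
      trace0L (embL θ x) = φ := by
  refine ⟨_, rfl, hR (WithLp.toLp 2 (U, G)) h.perWeak, ?_⟩
  set x := R (WithLp.toLp 2 (U, G)) with hx
  have hp : pairL θ x = WithLp.toLp 2 (U, G) := hR (WithLp.toLp 2 (U, G)) h.perWeak
  have hU : funL (embL θ x) = U := congrArg WithLp.fst hp
  have hG : derivL (embL θ x) = G := congrArg WithLp.snd hp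
  have hz := ae_eq_zero_of_forall_perTest_face (Lp.memLp (trace0L (embL θ x) - φ)) fun V hV => by
    have h1 := perSpace_green θ (embL_mem θ x) hV
    rw [hU, hG, h.green V hV] at h1
    have h2 := mul_left_cancel₀ (by exact_mod_cast hθ.ne') (neg_injective h1)
    have hV2 := memLp_face hV.continuous 0 2
    rw [integral_mul_eq_inner hV2] at h2 ⊢
    rw [inner_sub_right, ← integral_mul_eq_inner hV2, h2, integral_mul_eq_inner hV2, sub_self]
  exact sub_eq_zero.1 ((Lp.eq_zero_iff_ae_eq_zero).2 hz)

/-- Green's formula above height `1` supplies the new boundary datum, and periodicity of the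
coefficients preserves the flux equation. -/
lemma IsWeakSol.shift {θ : Space d} {μ ρ : Space d → ℝ} {ω : ℂ}
    (hμ : ∀ y i, μ (y + Pi.single i 1) = μ y) (hρ : ∀ y i, ρ (y + Pi.single i 1) = ρ y)
    {φ : SectionL2 d} {U G : GuideL2 d} (h : IsWeakSol θ μ ρ ω φ U G) {x : PerH θ}
    (hx : pairL θ x = WithLp.toLp 2 (U, G)) :
    IsWeakSol θ μ ρ ω (trace1L (embL θ x)) (HalfGuide.shift U) (HalfGuide.shift G) := by
  have hU : funL (embL θ x) = U := congrArg WithLp.fst hx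
  have hG : derivL (embL θ x) = G := congrArg WithLp.snd hx
  refine ⟨fun V hV => ?_, ?_⟩
  · rw [← hU, ← hG]
    exact perSpace_green_shift θ (embL_mem θ x) hV
  · refine perWeak_congr ?_ ?_ h.flux.comp_add_eLast
    · filter_upwards [coeFn_shift G] with y hy
      rw [hy, hμ]
    · filter_upwards [coeFn_shift U] with y hy
      rw [hy, hρ]

/-- The propagation operator of the weak problem. -/
theorem Coeffs.exists_weak_propagation {θ : Space d} {μ ρ : Space d → ℝ} {ω : ℂ}
    (hc : Coeffs μ ρ ω) (hθ : 0 < θ (Fin.last d))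
    (hμ : ∀ y i, μ (y + Pi.single i 1) = μ y) (hρ : ∀ y i, ρ (y + Pi.single i 1) = ρ y) :
    ∃ P : SectionL2 d →L[ℂ] SectionL2 d,
      (∀ φ U G, IsWeakSol θ μ ρ ω φ U G → IsWeakSol θ μ ρ ω (P φ) (HalfGuide.shift U) (HalfGuide.shift G) ∧
        ∃ x ∈ perSpace θ, funL x = U ∧ derivL x = G ∧ trace0L x = φ ∧ trace1L x = P φ) ∧
      spectralRadius ℂ P < 1 := by
  obtain ⟨S, hS⟩ := hc.exists_solution_operator hθ
  obtain ⟨R, -, hR⟩ := exists_lift θ hθ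
  obtain ⟨C, hC0, hC⟩ := exists_trace0_bound θ hθ
  set P : SectionL2 d →L[ℂ] SectionL2 d := (trace1L.comp (embL θ)).comp (R.comp S) with hP
  have hPφ : ∀ φ U G, IsWeakSol θ μ ρ ω φ U G →
      P φ = trace1L (embL θ (R (WithLp.toLp 2 (U, G)))) := by
    intro φ U G h
    have h1 : P φ = trace1L (embL θ (R (S φ))) := rfl
    rw [h1, (hS φ U G).1 h]
  have hsh : ∀ φ U G, IsWeakSol θ μ ρ ω φ U G →
      IsWeakSol θ μ ρ ω (P φ) (HalfGuide.shift U) (HalfGuide.shift G) := by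
    intro φ U G h
    rw [hPφ φ U G h]
    exact h.shift hμ hρ (hR (WithLp.toLp 2 (U, G)) h.perWeak)
  refine ⟨P, fun φ U G h => ⟨hsh φ U G h, ?_⟩, ?_⟩
  · obtain ⟨x, hx, hp, ht⟩ := h.exists_perSpace hθ hR
    exact ⟨embL θ x, embL_mem θ x, congrArg WithLp.fst hp, congrArg WithLp.snd hp, ht, by
      rw [hPφ φ U G h, hx]⟩
  -- The decreasing functional is the squared graph norm of the solution. As the solution for `P φ`
  -- is the shifted one, the decrease is exactly the contribution of the first cell. The added units
  -- only ensure positive constants.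
  · refine spectralRadius_lt_one_of_dissipation P (fun φ => ‖S φ‖ ^ 2) (fun _ => by positivity)
      (B := ‖S‖ ^ 2 + 1) (C := C + 1) (by positivity) (by positivity) (fun φ => ?_) (fun φ => ?_)
    · have h1 := S.le_opNorm φ
      have h2 : ‖S φ‖ ^ 2 ≤ (‖S‖ * ‖φ‖) ^ 2 := by gcongr
      nlinarith [sq_nonneg ‖φ‖]
    · obtain ⟨U, G, hUG⟩ : ∃ U G, S φ = WithLp.toLp 2 (U, G) := ⟨(S φ).fst, (S φ).snd, rfl⟩
      have hw := (hS φ U G).2 hUG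
      have hw' := (hS _ _ _).1 (hsh φ U G hw)
      obtain ⟨x, hx, hp, ht⟩ := hw.exists_perSpace hθ hR
      have hU : funL (embL θ x) = U := congrArg WithLp.fst hp
      have hG : derivL (embL θ x) = G := congrArg WithLp.snd hp
      have h0 := hC _ (embL_mem θ x)
      rw [ht, hU, hG] at h0
      have a1 := norm_sq_cell_add_shift U
      have a2 := norm_sq_cell_add_shift G
      simp only [hUG, hw', norm_sq_pair, WithLp.toLp_fst, WithLp.toLp_snd]
      have b1 : 0 ≤ ∫ y in cell d, ‖U y‖ ^ 2 := integral_nonneg fun _ => by positivity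
      have b2 : 0 ≤ ∫ y in cell d, ‖G y‖ ^ 2 := integral_nonneg fun _ => by positivity
      have e : ‖U‖ ^ 2 + ‖G‖ ^ 2 - (‖HalfGuide.shift U‖ ^ 2 + ‖HalfGuide.shift G‖ ^ 2) =
        (∫ y in cell d, ‖U y‖ ^ 2) + ∫ y in cell d, ‖G y‖ ^ 2 := by linarith
      rw [e]
      linarith

/-! ### The weighted trace estimate -/

/-- Integration of the derivative of `(τ - t) |v t|²` over `[0, τ]`: the weight removes the value at
`τ`, and keeping the factor `τ` on the left avoids a constant blowing up for short intervals. -/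
lemma one_dim_trace {v v' : ℝ → ℂ} (hv : ∀ t, HasDerivAt v (v' t) t) (hv' : Continuous v')
    {τ : ℝ} (hτ0 : 0 ≤ τ) (hτ1 : τ ≤ 1) :
    τ * ‖v 0‖ ^ 2 ≤ 2 * ∫ t in (0 : ℝ)..τ, (‖v t‖ ^ 2 + ‖v' t‖ ^ 2) := by
  have hvc : Continuous v := continuous_iff_continuousAt.2 fun t => (hv t).continuousAt
  set g' : ℝ → ℝ := fun t => (-1) * ‖v t‖ ^ 2 + (τ - t) * (2 * ⟪v t, v' t⟫_ℝ) with hg'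
  have hg : ∀ t, HasDerivAt (fun t => (τ - t) * ‖v t‖ ^ 2) (g' t) t := by
    intro t
    have h1 : HasDerivAt (fun t => τ - t) (-1) t := by
      simpa using (hasDerivAt_id t).const_sub τ
    exact h1.mul (hv t).norm_sq
  have hgc : Continuous g' := by
    have : Continuous fun t => ⟪v t, v' t⟫_ℝ := hvc.inner hv'
    fun_prop
  have h := intervalIntegral.integral_eq_sub_of_hasDerivAt (fun t _ => hg t)
    (hgc.intervalIntegrable 0 τ)
  simp only [sub_self, zero_mul, sub_zero, zero_sub] at h
  have h2 : τ * ‖v 0‖ ^ 2 = ∫ t in (0 : ℝ)..τ, -g' t := by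
    rw [intervalIntegral.integral_neg, h, neg_neg]
  rw [h2, ← intervalIntegral.integral_const_mul]
  refine intervalIntegral.integral_mono_on hτ0 (hgc.neg.intervalIntegrable _ _)
    (by apply Continuous.intervalIntegrable; fun_prop) fun t ht => ?_
  have hin := abs_le.1 (abs_real_inner_le_norm (v t) (v' t))
  have ht' : 0 ≤ τ - t ∧ τ - t ≤ 1 := ⟨by linarith [ht.2], by linarith [ht.1]⟩
  have hle : (τ - t) * (-(2 * ⟪v t, v' t⟫_ℝ)) ≤ 1 * (2 * (‖v t‖ * ‖v' t‖)) := by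
    calc _ ≤ (τ - t) * (2 * (‖v t‖ * ‖v' t‖)) :=
          mul_le_mul_of_nonneg_left (by linarith [hin.1]) ht'.1
      _ ≤ _ := mul_le_mul_of_nonneg_right ht'.2 (by positivity)
  simp only [hg']
  nlinarith [sq_nonneg (‖v t‖ - ‖v' t‖), sq_nonneg (‖v' t‖)]

/-- A weight on the faces vanishing at the boundary. -/
noncomputable def faceWeight (i : Fin (d + 1)) (z : Fin d → ℝ) : ℝ :=
  min 1 (Metric.infDist z (face i)ᶜ)

lemma continuous_faceWeight (i : Fin (d + 1)) : Continuous (faceWeight i) :=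
  continuous_const.min (Metric.continuous_infDist_pt _)

lemma faceWeight_nonneg (i : Fin (d + 1)) (z : Fin d → ℝ) : 0 ≤ faceWeight i z :=
  le_min zero_le_one Metric.infDist_nonneg

/-- For `d = 0` the complement of the face is empty and `Metric.infDist` takes the value `0` there;
for `d ≥ 1` the origin lies in the complement. -/
lemma faceWeight_pos (hd : 1 ≤ d) {i : Fin (d + 1)} {z : Fin d → ℝ} (hz : z ∈ face i) :
    0 < faceWeight i z := by
  refine lt_min one_pos ?_
  have hne : ((face i)ᶜ : Set (Fin d → ℝ)).Nonempty :=
    ⟨0, fun h => lt_irrefl _ (h ⟨0, hd⟩).1⟩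
  refine ((isOpen_face i).isClosed_compl.notMem_iff_infDist_pos hne).1 ?_
  simpa using hz

/-- The face measure with the weight `faceWeight`. -/
noncomputable def faceMeasure (i : Fin (d + 1)) : Measure (Fin d → ℝ) :=
  (volume.restrict (face i)).withDensity fun z => ENNReal.ofReal (faceWeight i z)

/-- On a compact part of the face the weight has a positive minimum, so weighted convergence implies
`L²_loc` convergence. -/
lemma exists_restrict_le_faceMeasure (hd : 1 ≤ d) (i : Fin (d + 1)) {K : Set (Fin d → ℝ)}
    (hK : IsCompact K) (hKf : K ⊆ face i) :
    ∃ c : ℝ≥0∞, c ≠ ∞ ∧ volume.restrict K ≤ c • faceMeasure i := by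
  rcases K.eq_empty_or_nonempty with rfl | hne
  · exact ⟨0, by simp, by simp⟩
  obtain ⟨z₀, hz₀, hmin⟩ := hK.exists_isMinOn hne (continuous_faceWeight i).continuousOn
  have hpos := faceWeight_pos hd (hKf hz₀)
  refine ⟨(ENNReal.ofReal (faceWeight i z₀))⁻¹, by simpa using hpos, ?_⟩
  refine Measure.le_iff.2 fun s hs => ?_
  rw [Measure.smul_apply, smul_eq_mul, faceMeasure, withDensity_apply _ hs,
    Measure.restrict_restrict hs, Measure.restrict_apply hs]
  have h1 : ENNReal.ofReal (faceWeight i z₀) * volume (s ∩ K) ≤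
      ∫⁻ z in s ∩ face i, ENNReal.ofReal (faceWeight i z) := by
    rw [← setLIntegral_const]
    refine (setLIntegral_mono' (hs.inter hK.measurableSet) fun z hz => ?_).trans
      (lintegral_mono_set (Set.inter_subset_inter_right s hKf))
    exact ENNReal.ofReal_le_ofReal (hmin hz.2)
  have h0 : ENNReal.ofReal (faceWeight i z₀) ≠ 0 := by simpa using hpos
  calc volume (s ∩ K) = (ENNReal.ofReal (faceWeight i z₀))⁻¹ *
        (ENNReal.ofReal (faceWeight i z₀) * volume (s ∩ K)) := by
          rw [← mul_assoc, ENNReal.inv_mul_cancel h0 ENNReal.ofReal_ne_top, one_mul]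
    _ ≤ _ := by gcongr

lemma lintegral_facePoint (i : Fin (d + 1)) {f : Space d → ℝ≥0∞} (hf : Measurable f) :
    ∫⁻ s, ∫⁻ z, f (facePoint i s z) = ∫⁻ y, f y := by
  have h := (volume_preserving_piFinSuccAbove (fun _ : Fin (d + 1) => ℝ) i).symm.lintegral_comp hf
  rw [← h, Measure.volume_eq_prod, lintegral_prod]
  · rfl
  · exact (hf.comp (MeasurableEquiv.measurable _)).aemeasurable

lemma lintegral_comp_affine {F : ℝ → ℝ≥0∞} (hF : Measurable F) (a : ℝ) {c : ℝ} (hc : c ≠ 0) :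
    ∫⁻ t, F (a + c * t) = ENNReal.ofReal |c⁻¹| * ∫⁻ s, F s := by
  have h1 : ∫⁻ t, F (a + c * t) = ∫⁻ s, F (a + s) ∂(Measure.map (c * ·) volume) := by
    exact (lintegral_map (f := fun s => F (a + s)) (hF.comp (measurable_const_add a))
      (measurable_const_mul c)).symm
  rw [h1, Real.map_volume_mul_left hc, lintegral_smul_measure, smul_eq_mul,
    lintegral_add_left_eq_self F a]

/-- Lines in the direction `θ` issued from the hyperplane `yᵢ = a` sweep out the whole space:
Tonelli and a shear along the hyperplane leave the Jacobian `σ θᵢ`. -/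
lemma lintegral_lines_le (θ : Space d) (i : Fin (d + 1)) (hθ : θ i ≠ 0) (a : ℝ) {σ : ℝ} (hσ : σ ≠ 0)
    {f : Space d → ℝ≥0∞} (hf : Measurable f) :
    ∫⁻ z, ∫⁻ t : ℝ, f (facePoint i a z + (σ * t) • θ) =
      ENNReal.ofReal |(σ * θ i)⁻¹| * ∫⁻ y, f y := by
  have hm : Measurable fun p : (Fin d → ℝ) × ℝ => f (facePoint i a p.1 + (σ * p.2) • θ) := by
    refine hf.comp (Continuous.measurable ?_)
    exact ((continuous_facePoint_right i a).comp continuous_fst).add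
      ((continuous_const.mul continuous_snd).smul continuous_const)
  have hm2 : Measurable fun p : ℝ × (Fin d → ℝ) => f (facePoint i p.1 p.2) :=
    hf.comp (continuous_facePoint i).measurable
  rw [lintegral_lintegral_swap hm.aemeasurable]
  simp only [facePoint_add_smul]
  have h1 : ∀ t : ℝ, ∫⁻ z, f (facePoint i (a + σ * t * θ i)
      (z + (σ * t) • fun j => θ (i.succAbove j))) = ∫⁻ z, f (facePoint i (a + (σ * θ i) * t) z) := by
    intro t
    rw [lintegral_add_right_eq_self (fun z => f (facePoint i (a + σ * t * θ i) z))]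
    congr 1; ext z; congr 2; ring
  simp only [h1]
  rw [lintegral_comp_affine (F := fun s => ∫⁻ z, f (facePoint i s z)) hm2.lintegral_prod_right' a
    (mul_ne_zero hσ hθ), lintegral_facePoint i hf]

/-- Before the stated time, the line has moved less than `1` across the face and, parallel to it,
less than the distance from `z` to the complement of the face. -/
lemma line_mem_guide {θ : Space d} (hθ : ∀ i, 0 < θ i) (i : Fin (d + 1)) {a σ : ℝ} (hσ : |σ| = 1)
    (ha : ∀ s, 0 < s → s < 1 → 0 < a + σ * s ∧ (i ≠ Fin.last d → a + σ * s < 1))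
    {z : Fin d → ℝ} {t : ℝ} (ht : 0 < t) (ht' : t < faceWeight i z / (‖θ‖ + 1)) :
    facePoint i a z + (σ * t) • θ ∈ guide d := by
  have hL : 0 < ‖θ‖ + 1 := by positivity
  rw [lt_div_iff₀ hL] at ht'
  have hi : θ i ≤ ‖θ‖ := (le_abs_self _).trans (norm_le_pi_norm θ i)
  rw [facePoint_add_smul, facePoint_mem_guide]
  constructor
  · have h1 : t * θ i < 1 := by
      have := min_le_left 1 (Metric.infDist z (face i)ᶜ)
      unfold faceWeight at ht'
      nlinarith
    have := ha (t * θ i) (mul_pos ht (hθ i)) h1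
    rwa [← mul_assoc] at this
  · refine Metric.ball_infDist_compl_subset (x := z) ?_
    rw [Metric.mem_ball, dist_eq_norm, add_sub_cancel_left, norm_smul, Real.norm_eq_abs, abs_mul,
      hσ, one_mul, abs_of_pos ht]
    have h2 : ‖fun j => θ (i.succAbove j)‖ ≤ ‖θ‖ :=
      (pi_norm_le_iff_of_nonneg (norm_nonneg _)).2 fun j => norm_le_pi_norm θ _
    have := min_le_right 1 (Metric.infDist z (face i)ᶜ)
    unfold faceWeight at ht'
    nlinarith

lemma eLpNorm_two_sq {α : Type*} [MeasurableSpace α] {m : Measure α} (f : α → ℂ) :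
    eLpNorm f 2 m ^ 2 = ∫⁻ x, ‖f x‖ₑ ^ 2 ∂m := by
  have := eLpNorm_nnreal_pow_eq_lintegral (f := f) (μ := m) (p := 2) two_ne_zero
  simpa using this

/-- The trace on a face is controlled, in a weighted space, by the graph norm. -/
theorem exists_weighted_trace_estimate {θ : Space d} (hθ : ∀ i, 0 < θ i) (i : Fin (d + 1)) {a : ℝ}
    (ha : a = 0 ∨ a = 1) :
    ∃ C : ℝ≥0∞, C ≠ ∞ ∧ ∀ V : Space d → ℂ, ContDiff ℝ 1 V →
      eLpNorm (fun z => V (facePoint i a z)) 2 (faceMeasure i) ≤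
        C * (eLpNorm V 2 (volume.restrict (guide d)) +
          eLpNorm (dirDeriv θ V) 2 (volume.restrict (guide d))) := by
  -- The sign orients the line into the cylinder: along `θ` from `yᵢ = 0`, against it from `yᵢ = 1`.
  obtain ⟨σ, hσ, hline⟩ : ∃ σ : ℝ, |σ| = 1 ∧
      ∀ s, 0 < s → s < 1 → 0 < a + σ * s ∧ (i ≠ Fin.last d → a + σ * s < 1) := by
    rcases ha with rfl | rfl
    · exact ⟨1, by simp, fun s h1 h2 => ⟨by linarith, fun _ => by linarith⟩⟩
    · exact ⟨-1, by simp, fun s h1 h2 => ⟨by linarith, fun _ => by linarith⟩⟩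
  have hσ0 : σ ≠ 0 := by rintro rfl; simp at hσ
  set L := ‖θ‖ + 1 with hLdef
  have hL : 1 ≤ L := by rw [hLdef]; linarith [norm_nonneg θ]
  set C₀ : ℝ≥0∞ := ENNReal.ofReal (2 * L) * ENNReal.ofReal |(σ * θ i)⁻¹| with hC₀
  have hC₀t : C₀ ≠ ∞ := ENNReal.mul_ne_top ENNReal.ofReal_ne_top ENNReal.ofReal_ne_top
  refine ⟨C₀ ^ (1 / 2 : ℝ), ENNReal.rpow_ne_top_of_nonneg (by norm_num) hC₀t, fun V hV => ?_⟩
  have hVc := hV.continuous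
  have hDc := continuous_dirDeriv θ hV
  set f : Space d → ℝ≥0∞ := (guide d).indicator fun y => ‖V y‖ₑ ^ 2 + ‖dirDeriv θ V y‖ₑ ^ 2 with hf
  have hfm : Measurable f := by
    refine Measurable.indicator ?_ measurableSet_guide
    exact (hVc.enorm.measurable.pow_const 2).add (hDc.enorm.measurable.pow_const 2)
  have hpt : ∀ z, ENNReal.ofReal (faceWeight i z) * ‖V (facePoint i a z)‖ₑ ^ 2 ≤
      ENNReal.ofReal (2 * L) * ∫⁻ t : ℝ, f (facePoint i a z + (σ * t) • θ) := by
    intro z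
    set w := faceWeight i z with hw
    have hw0 : 0 ≤ w := faceWeight_nonneg i z
    have hw1 : w ≤ 1 := min_le_left _ _
    -- The one-dimensional estimate is applied on the segment of length parameter `τ`, whose
    -- interior stays in the half-cylinder by `line_mem_guide`. Because `τ` is proportional to the
    -- weight, the constant is uniform in `z`.
    set τ := w / L with hτ
    have hτ0 : 0 ≤ τ := by positivity
    have hτ1 : τ ≤ 1 := by rw [hτ, div_le_one (by linarith)]; linarith
    set v : ℝ → ℂ := fun t => V (facePoint i a z + (σ * t) • θ) with hv
    set v' : ℝ → ℂ := fun t => σ * dirDeriv θ V (facePoint i a z + (σ * t) • θ) with hv'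
    have hd1 : ∀ t, HasDerivAt v (v' t) t := by
      intro t
      have h1 := hasDerivAt_line θ (facePoint i a z) (σ * t) (hV.differentiable one_ne_zero _)
      have h2 : HasDerivAt (fun t : ℝ => σ * t) σ t := by
        simpa using (hasDerivAt_id t).const_mul σ
      have := h1.scomp t h2
      rw [Complex.real_smul] at this
      exact this
    have hcv' : Continuous v' := continuous_const.mul (hDc.comp (by fun_prop))
    have hcv : Continuous v := hVc.comp (by fun_prop)
    have h1 := one_dim_trace hd1 hcv' hτ0 hτ1
    have hn : ∀ t, ‖v' t‖ = ‖dirDeriv θ V (facePoint i a z + (σ * t) • θ)‖ := fun t => by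
      rw [hv', norm_mul, Complex.norm_real, Real.norm_eq_abs, hσ, one_mul]
    have hv0 : v 0 = V (facePoint i a z) := by simp [hv]
    rw [hv0] at h1
    have h2 : w * ‖V (facePoint i a z)‖ ^ 2 ≤
        (2 * L) * ∫ t in Set.Ioo 0 τ, (‖v t‖ ^ 2 + ‖v' t‖ ^ 2) := by
      rw [← integral_Ioc_eq_integral_Ioo, ← intervalIntegral.integral_of_le hτ0]
      have e : w = L * τ := by rw [hτ]; field_simp
      rw [e]
      have := mul_le_mul_of_nonneg_left h1 (by linarith : (0 : ℝ) ≤ L)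
      linarith
    have hint : IntegrableOn (fun t => ‖v t‖ ^ 2 + ‖v' t‖ ^ 2) (Set.Ioo 0 τ) :=
      ((by fun_prop : Continuous fun t => ‖v t‖ ^ 2 + ‖v' t‖ ^ 2).integrableOn_Icc).mono_set
        Set.Ioo_subset_Icc_self
    have h3 := ENNReal.ofReal_le_ofReal h2
    rw [ENNReal.ofReal_mul hw0, ENNReal.ofReal_mul (by linarith),
      ofReal_integral_eq_lintegral_ofReal hint (Eventually.of_forall fun t => by positivity)] at h3
    have e1 : ENNReal.ofReal (‖V (facePoint i a z)‖ ^ 2) = ‖V (facePoint i a z)‖ₑ ^ 2 := by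
      rw [ENNReal.ofReal_pow (norm_nonneg _), ofReal_norm]
    rw [e1] at h3
    refine h3.trans (mul_le_mul_right ?_ _)
    calc ∫⁻ t in Set.Ioo 0 τ, ENNReal.ofReal (‖v t‖ ^ 2 + ‖v' t‖ ^ 2)
        = ∫⁻ t in Set.Ioo 0 τ, f (facePoint i a z + (σ * t) • θ) := by
          refine setLIntegral_congr_fun measurableSet_Ioo fun t ht => ?_
          have hmem := line_mem_guide hθ i hσ hline ht.1 ht.2
          simp only [hf, Set.indicator_of_mem hmem, hn]
          rw [ENNReal.ofReal_add (by positivity) (by positivity),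
            ENNReal.ofReal_pow (norm_nonneg _), ENNReal.ofReal_pow (norm_nonneg _), ofReal_norm,
            ofReal_norm]
      _ ≤ _ := setLIntegral_le_lintegral _ _
  have hsq : eLpNorm (fun z => V (facePoint i a z)) 2 (faceMeasure i) ^ 2 ≤
      C₀ * (eLpNorm V 2 (volume.restrict (guide d)) +
          eLpNorm (dirDeriv θ V) 2 (volume.restrict (guide d))) ^ 2 := by
    have hmz : Measurable fun z => ‖V (facePoint i a z)‖ₑ ^ 2 :=
      ((hVc.comp (continuous_facePoint_right i a)).enorm.measurable).pow_const 2
    rw [eLpNorm_two_sq, faceMeasure, lintegral_withDensity_eq_lintegral_mul _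
      (continuous_faceWeight i).measurable.ennreal_ofReal hmz]
    calc _ ≤ ∫⁻ z in face i, ENNReal.ofReal (2 * L) *
            ∫⁻ t : ℝ, f (facePoint i a z + (σ * t) • θ) := lintegral_mono fun z => hpt z
      _ ≤ ∫⁻ z, ENNReal.ofReal (2 * L) * ∫⁻ t : ℝ, f (facePoint i a z + (σ * t) • θ) :=
          setLIntegral_le_lintegral _ _
      _ = C₀ * ∫⁻ y, f y := by
          rw [lintegral_const_mul' _ _ ENNReal.ofReal_ne_top,
            lintegral_lines_le θ i (hθ i).ne' a hσ0 hfm, hC₀, mul_assoc]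
      _ = C₀ * (eLpNorm V 2 (volume.restrict (guide d)) ^ 2 +
          eLpNorm (dirDeriv θ V) 2 (volume.restrict (guide d)) ^ 2) := by
          rw [hf, lintegral_indicator measurableSet_guide, eLpNorm_two_sq, eLpNorm_two_sq,
            lintegral_add_left (hVc.enorm.measurable.pow_const 2)]
      _ ≤ _ := by
          gcongr
          rw [add_sq]
          set x := eLpNorm V 2 (volume.restrict (guide d))
          set y := eLpNorm (dirDeriv θ V) 2 (volume.restrict (guide d))
          calc x ^ 2 + y ^ 2 ≤ x ^ 2 + y ^ 2 + 2 * x * y := le_self_add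
            _ = _ := by ring
  have h := ENNReal.rpow_le_rpow hsq (show (0 : ℝ) ≤ 1 / 2 by norm_num)
  have hroot : ∀ x : ℝ≥0∞, (x ^ 2) ^ (1 / 2 : ℝ) = x := fun x => by
    rw [← ENNReal.rpow_natCast, ← ENNReal.rpow_mul]; norm_num
  rwa [ENNReal.mul_rpow_of_nonneg _ _ (by norm_num), hroot, hroot] at h

/-! ### Consequences for traces -/

/-- `V k` converges to `U` in the directional Sobolev space. -/
def TendstoH1 (θ : Space d) (V : ℕ → Space d → ℂ) (U G : Space d → ℂ) : Prop :=
  Tendsto (fun k => eLpNorm (fun y => V k y - U y) 2 (volume.restrict (guide d))) atTop (𝓝 0) ∧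
  Tendsto (fun k => eLpNorm (fun y => dirDeriv θ (V k) y - G y) 2 (volume.restrict (guide d)))
    atTop (𝓝 0)

lemma tendsto_eLpNorm_restrict (hd : 1 ≤ d) {i : Fin (d + 1)} {f : ℕ → (Fin d → ℝ) → ℂ}
    (h : Tendsto (fun k => eLpNorm (f k) 2 (faceMeasure i)) atTop (𝓝 0)) {K : Set (Fin d → ℝ)}
    (hK : IsCompact K) (hKf : K ⊆ face i) :
    Tendsto (fun k => eLpNorm (f k) 2 (volume.restrict K)) atTop (𝓝 0) := by
  obtain ⟨c, hc, hle⟩ := exists_restrict_le_faceMeasure hd i hK hKf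
  have h2 : Tendsto (fun k => c ^ (1 / (2 : ℝ≥0∞)).toReal * eLpNorm (f k) 2 (faceMeasure i)) atTop
      (𝓝 0) := by
    have h2 := ENNReal.Tendsto.const_mul (a := c ^ (1 / (2 : ℝ≥0∞)).toReal) h
      (Or.inr (ENNReal.rpow_ne_top_of_nonneg ENNReal.toReal_nonneg hc))
    rwa [mul_zero] at h2
  refine tendsto_of_tendsto_of_tendsto_of_le_of_le tendsto_const_nhds h2 (fun _ => zero_le)
    fun k => ?_
  refine (eLpNorm_mono_measure _ hle).trans (le_of_eq ?_)
  rw [eLpNorm_smul_measure_of_ne_top (by simp), smul_eq_mul]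

lemma graphNorm_sub_le {θ : Space d} {V W : ℕ → Space d → ℂ} {U G : Space d → ℂ}
    (hU : AEStronglyMeasurable U (volume.restrict (guide d)))
    (hG : AEStronglyMeasurable G (volume.restrict (guide d)))
    (hV : ∀ k, ContDiff ℝ 1 (V k)) (hW : ∀ k, ContDiff ℝ 1 (W k)) (m n : ℕ) :
    eLpNorm (fun y => V m y - W n y) 2 (volume.restrict (guide d)) +
      eLpNorm (dirDeriv θ fun y => V m y - W n y) 2 (volume.restrict (guide d)) ≤
    (eLpNorm (fun y => V m y - U y) 2 (volume.restrict (guide d)) +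
      eLpNorm (fun y => dirDeriv θ (V m) y - G y) 2 (volume.restrict (guide d))) +
    (eLpNorm (fun y => W n y - U y) 2 (volume.restrict (guide d)) +
      eLpNorm (fun y => dirDeriv θ (W n) y - G y) 2 (volume.restrict (guide d))) := by
  have key : ∀ {A B X : Space d → ℂ}, Continuous A → Continuous B →
      AEStronglyMeasurable X (volume.restrict (guide d)) →
      eLpNorm (fun y => A y - B y) 2 (volume.restrict (guide d)) ≤
        eLpNorm (fun y => A y - X y) 2 (volume.restrict (guide d)) +
        eLpNorm (fun y => B y - X y) 2 (volume.restrict (guide d)) := by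
    intro A B X hA hB hX
    have e : (fun y => A y - B y) = (fun y => A y - X y) - fun y => B y - X y := by
      ext y; simp
    rw [e]
    exact eLpNorm_sub_le (hA.aestronglyMeasurable.sub hX) (hB.aestronglyMeasurable.sub hX)
      one_le_two
  have h1 := key (hV m).continuous (hW n).continuous hU
  have h2 := key (continuous_dirDeriv θ (hV m)) (continuous_dirDeriv θ (hW n)) hG
  have e : (dirDeriv θ fun y => V m y - W n y) =
      fun y => dirDeriv θ (V m) y - dirDeriv θ (W n) y := by
    ext y
    exact dirDeriv_sub θ ((hV m).differentiable one_ne_zero y)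
      ((hW n).differentiable one_ne_zero y)
  rw [e]
  calc _ ≤ _ := add_le_add h1 h2
    _ = _ := by abel

/-- The weighted estimate applied to `V k - W k` shows that the limit of traces does not depend on
the approximating sequence. -/
lemma TendstoH1.trace_sub (hd : 1 ≤ d) {θ : Space d} (hθ : ∀ i, 0 < θ i) {V W : ℕ → Space d → ℂ}
    {U G : Space d → ℂ} (hU : AEStronglyMeasurable U (volume.restrict (guide d)))
    (hG : AEStronglyMeasurable G (volume.restrict (guide d)))
    (hV : ∀ k, ContDiff ℝ 1 (V k)) (hW : ∀ k, ContDiff ℝ 1 (W k))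
    (h1 : TendstoH1 θ V U G) (h2 : TendstoH1 θ W U G) (i : Fin (d + 1)) {a : ℝ}
    (ha : a = 0 ∨ a = 1) {K : Set (Fin d → ℝ)} (hK : IsCompact K) (hKf : K ⊆ face i) :
    Tendsto (fun k => eLpNorm (fun z => V k (facePoint i a z) - W k (facePoint i a z)) 2
      (volume.restrict K)) atTop (𝓝 0) := by
  obtain ⟨C, hC, h⟩ := exists_weighted_trace_estimate hθ i ha
  refine tendsto_eLpNorm_restrict hd ?_ hK hKf
  have hlim := ENNReal.Tendsto.const_mul (a := C) ((h1.1.add h1.2).add (h2.1.add h2.2))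
    (Or.inr hC)
  simp only [add_zero, mul_zero] at hlim
  refine tendsto_of_tendsto_of_tendsto_of_le_of_le tendsto_const_nhds hlim (fun _ => zero_le)
    fun k => ?_
  refine (h (fun y => V k y - W k y) ((hV k).sub (hW k))).trans ?_
  exact mul_le_mul_right (graphNorm_sub_le (θ := θ) hU hG hV hW k k) C

/-- Traces of an approximating sequence are Cauchy in the complete weighted space `L²(faceMeasure
i)`; one limit `g` therefore serves all compact subsets. -/
lemma TendstoH1.exists_trace (hd : 1 ≤ d) {θ : Space d} (hθ : ∀ i, 0 < θ i) {V : ℕ → Space d → ℂ}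
    {U G : Space d → ℂ} (hU : AEStronglyMeasurable U (volume.restrict (guide d)))
    (hG : AEStronglyMeasurable G (volume.restrict (guide d)))
    (hV : ∀ k, ContDiff ℝ 1 (V k)) (hV2 : ∀ k, MemLp (V k) 2 (volume.restrict (guide d)))
    (hDV2 : ∀ k, MemLp (dirDeriv θ (V k)) 2 (volume.restrict (guide d)))
    (h1 : TendstoH1 θ V U G) (i : Fin (d + 1)) {a : ℝ} (ha : a = 0 ∨ a = 1) :
    ∃ g : (Fin d → ℝ) → ℂ, ∀ K : Set (Fin d → ℝ), IsCompact K → K ⊆ face i →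
      MemLp g 2 (volume.restrict K) ∧
      Tendsto (fun k => eLpNorm (fun z => V k (facePoint i a z) - g z) 2 (volume.restrict K))
        atTop (𝓝 0) := by
  obtain ⟨C, hC, h⟩ := exists_weighted_trace_estimate hθ i ha
  have hm : ∀ k, MemLp (fun z => V k (facePoint i a z)) 2 (faceMeasure i) := fun k =>
    ⟨((hV k).continuous.comp (continuous_facePoint_right i a)).aestronglyMeasurable,
      (h _ (hV k)).trans_lt (ENNReal.mul_lt_top hC.lt_top
        (ENNReal.add_lt_top.2 ⟨(hV2 k).2, (hDV2 k).2⟩))⟩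
  have hlim := ENNReal.Tendsto.const_mul (a := C) (h1.1.add h1.2) (Or.inr hC)
  simp only [add_zero, mul_zero] at hlim
  have hcau : CauchySeq fun k => (hm k).toLp _ := by
    refine EMetric.cauchySeq_iff.2 fun ε hε => ?_
    obtain ⟨N, hN⟩ := eventually_atTop.1
      (hlim.eventually_lt_const (ENNReal.half_pos hε.ne'))
    refine ⟨N, fun m hm' n hn => ?_⟩
    rw [Lp.edist_toLp_toLp]
    refine (h (fun y => V m y - V n y) ((hV m).sub (hV n))).trans_lt ?_
    refine (mul_le_mul_right (graphNorm_sub_le hU hG hV hV m n) C).trans_lt ?_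
    rw [mul_add]
    calc _ < ε / 2 + ε / 2 := ENNReal.add_lt_add (hN m hm') (hN n hn)
      _ = ε := ENNReal.add_halves ε
  obtain ⟨g, hg⟩ := cauchySeq_tendsto_of_complete hcau
  refine ⟨g, fun K hK hKf => ⟨?_, ?_⟩⟩
  · obtain ⟨c, hc, hle⟩ := exists_restrict_le_faceMeasure hd i hK hKf
    exact (Lp.memLp g).of_measure_le_smul hc hle
  · refine tendsto_eLpNorm_restrict hd ?_ hK hKf
    have := (Lp.tendsto_Lp_iff_tendsto_eLpNorm'' _ hm g (Lp.memLp g)).1 (by simpa using hg)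
    exact this

/-! ### Uniqueness of weak derivatives and of traces -/

lemma IsTest.contDiff_one {V : Space d → ℂ} (hV : IsTest V) : ContDiff ℝ 1 V :=
  hV.1.of_le (by exact_mod_cast le_top)

lemma IsTest.memLp {V : Space d → ℂ} (hV : IsTest V) (p : ℝ≥0∞) :
    MemLp V p (volume.restrict (guide d)) :=
  (hV.1.continuous.memLp_of_hasCompactSupport hV.2).restrict _

lemma IsTest.dirDeriv (θ : Space d) {V : Space d → ℂ} (hV : IsTest V) :
    IsTest (HalfGuide.dirDeriv θ V) :=
  ⟨contDiff_dirDeriv θ hV.1, hV.2.fderiv_apply ℝ θ⟩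

lemma HasWeakDirDeriv.ae_eq {θ : Space d} {U G G' : Space d → ℂ}
    (hG : MemLp G 2 (volume.restrict (guide d))) (hG' : MemLp G' 2 (volume.restrict (guide d)))
    (h : HasWeakDirDeriv θ U G) (h' : HasWeakDirDeriv θ U G') :
    G =ᵐ[volume.restrict (guide d)] G' := by
  have hX := hG.sub hG'
  have key : ∀ᵐ y ∂volume.restrict (guide d), (G - G') y = 0 := by
    rw [ae_restrict_iff' measurableSet_guide]
    refine isOpen_guide.ae_eq_zero_of_integral_contDiff_smul_eq_zero ?_ ?_
    · refine (locallyIntegrableOn_iff (isOpen_guide.isLocallyClosed)).2 fun K hK hKc => ?_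
      have h1 : MemLp (G - G') 2 (volume.restrict K) :=
        hX.mono_measure (Measure.restrict_mono hK le_rfl)
      have : IsFiniteMeasure (volume.restrict K) := ⟨by simpa using hKc.measure_lt_top⟩
      exact h1.integrable (by norm_num)
    · intro g hg hgc hgs
      have hV : IsTest (fun y : Space d => (g y : ℂ)) :=
        ⟨Complex.ofRealCLM.contDiff.comp hg, hgc.comp_left (g := fun x : ℝ => (x : ℂ)) (by simp)⟩
      have hts : tsupport (fun y : Space d => (g y : ℂ)) ⊆ guide d := by
        refine (closure_mono ?_).trans hgs
        intro y hy
        simpa using hy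
      have e1 := h _ hV hts
      have e2 := h' _ hV hts
      have h0 : ∫ y, g y • (G - G') y = ∫ y in guide d, g y • (G - G') y := by
        symm
        refine setIntegral_eq_integral_of_forall_compl_eq_zero fun y hy => ?_
        have : g y = 0 := by
          by_contra hne
          exact hy (hgs (subset_tsupport _ hne))
        simp [this]
      have e3 : ∫ y in guide d, g y • (G - G') y =
          (∫ y in guide d, G y * (g y : ℂ)) - ∫ y in guide d, G' y * (g y : ℂ) := by
        rw [← integral_sub (integrable_mul_guide hG (hV.memLp 2))
          (integrable_mul_guide hG' (hV.memLp 2))]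
        refine integral_congr_ae (Eventually.of_forall fun y => ?_)
        simp only [Pi.sub_apply, Complex.real_smul]
        ring
      rw [h0, e3, sub_eq_zero]
      exact neg_injective (e1.symm.trans e2)
  filter_upwards [key] with y hy
  exact sub_eq_zero.1 hy

lemma TendstoH1.congr_deriv {θ : Space d} {V : ℕ → Space d → ℂ} {U G G' : Space d → ℂ}
    (h : TendstoH1 θ V U G) (hG : G =ᵐ[volume.restrict (guide d)] G') : TendstoH1 θ V U G' := by
  refine ⟨h.1, h.2.congr fun k => eLpNorm_congr_ae ?_⟩
  filter_upwards [hG] with y hy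
  rw [hy]

lemma tendsto_eLpNorm_add {α : Type*} [MeasurableSpace α] {m : Measure α} {f g : ℕ → α → ℂ}
    (hf : ∀ k, AEStronglyMeasurable (f k) m) (hg : ∀ k, AEStronglyMeasurable (g k) m)
    (h1 : Tendsto (fun k => eLpNorm (f k) 2 m) atTop (𝓝 0))
    (h2 : Tendsto (fun k => eLpNorm (g k) 2 m) atTop (𝓝 0)) :
    Tendsto (fun k => eLpNorm (fun x => f k x + g k x) 2 m) atTop (𝓝 0) := by
  have h := h1.add h2
  rw [add_zero] at h
  exact tendsto_of_tendsto_of_tendsto_of_le_of_le tendsto_const_nhds h (fun _ => zero_le)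
    fun k => eLpNorm_add_le (hf k) (hg k) one_le_two

/-- Every approximating sequence has traces converging to the trace. -/
lemma HasTrace.tendsto (hd : 1 ≤ d) {θ : Space d} (hθ : ∀ i, 0 < θ i) {i : Fin (d + 1)} {a : ℝ}
    (ha : a = 0 ∨ a = 1) {U G : Space d → ℂ} {g : (Fin d → ℝ) → ℂ} (h : HasTrace θ i a U g)
    (hG : HasH1Deriv θ U G) {B : ℕ → Space d → ℂ} (hB : ∀ k, ContDiff ℝ 1 (B k))
    (hBU : TendstoH1 θ B U G) {K : Set (Fin d → ℝ)} (hK : IsCompact K) (hKf : K ⊆ face i) :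
    Tendsto (fun k => eLpNorm (fun z => B k (facePoint i a z) - g z) 2 (volume.restrict K))
      atTop (𝓝 0) := by
  obtain ⟨hg, G', hG', V, hV, h1, h2, h3⟩ := h
  have hVU : TendstoH1 θ V U G :=
    TendstoH1.congr_deriv ⟨h1, h2⟩
      (hG'.weakDeriv.ae_eq hG'.memLp_deriv hG.memLp_deriv hG.weakDeriv)
  have h4 := hBU.trace_sub hd hθ hG.memLp.1 hG.memLp_deriv.1 hB (fun k => (hV k).contDiff_one) hVU
    i ha hK hKf
  have hc : ∀ {W : Space d → ℂ}, ContDiff ℝ 1 W →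
      AEStronglyMeasurable (fun z => W (facePoint i a z)) (volume.restrict K) := fun hW =>
    (hW.continuous.comp (continuous_facePoint_right i a)).aestronglyMeasurable
  have := tendsto_eLpNorm_add (fun k => (hc (hB k)).sub (hc (hV k).contDiff_one))
    (fun k => (hc (hV k).contDiff_one).sub (hg K hK hKf).1) h4 (h3 K hK hKf)
  simpa using this

/-- By the Lindelöf property, countably many compact subsets cover the open face. -/
lemma ae_restrict_face_of_compacts (i : Fin (d + 1)) {p : (Fin d → ℝ) → Prop}
    (h : ∀ K : Set (Fin d → ℝ), IsCompact K → K ⊆ face i → ∀ᵐ z ∂volume.restrict K, p z) :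
    ∀ᵐ z ∂volume.restrict (face i), p z := by
  have hl : ∀ z ∈ face i, ∃ K ∈ 𝓝[face i] z, IsCompact K ∧ K ⊆ face i := fun z hz => by
    obtain ⟨K, hK, hz', hs⟩ := exists_compact_subset (isOpen_face i) hz
    exact ⟨K, mem_nhdsWithin_of_mem_nhds (mem_interior_iff_mem_nhds.1 hz'), hK, hs⟩
  choose! K hK1 hK2 hK3 using hl
  obtain ⟨t, ht, htc, hcov⟩ := TopologicalSpace.countable_cover_nhdsWithin hK1
  have := ae_restrict_biUnion_iff K htc p (μ := volume)
  exact ae_restrict_of_ae_restrict_of_subset hcov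
    (this.2 fun z hz => h _ (hK2 z (ht hz)) (hK3 z (ht hz)))

lemma HasTrace.ae_eq (hd : 1 ≤ d) {θ : Space d} (hθ : ∀ i, 0 < θ i) {i : Fin (d + 1)} {a : ℝ}
    (ha : a = 0 ∨ a = 1) {U : Space d → ℂ} {g g' : (Fin d → ℝ) → ℂ} (h : HasTrace θ i a U g)
    (h' : HasTrace θ i a U g') : g =ᵐ[volume.restrict (face i)] g' := by
  refine ae_restrict_face_of_compacts i fun K hK hKf => ?_
  have h2 := h'
  obtain ⟨hg', G, hG, V, hV, h1, h2', h3⟩ := h2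
  have h4 := h.tendsto hd hθ ha hG (fun k => (hV k).contDiff_one) ⟨h1, h2'⟩ hK hKf
  have hc : ∀ k, AEStronglyMeasurable (fun z => V k (facePoint i a z)) (volume.restrict K) :=
    fun k => ((hV k).1.continuous.comp (continuous_facePoint_right i a)).aestronglyMeasurable
  have h5 := tendsto_eLpNorm_add (fun k => ((hc k).sub (h.1 K hK hKf).1).neg)
    (fun k => (hc k).sub (hg' K hK hKf).1) (by simp only [eLpNorm_neg]; exact h4) (h3 K hK hKf)
  have h6 : eLpNorm (g - g') 2 (volume.restrict K) = 0 := by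
    refine tendsto_nhds_unique (tendsto_const_nhds (f := atTop (α := ℕ))) (h5.congr fun k => ?_)
    congr 1
    ext z
    simp only [Pi.neg_apply, Pi.sub_apply]
    ring
  rw [eLpNorm_eq_zero_iff ((h.1 K hK hKf).1.sub (hg' K hK hKf).1) two_ne_zero] at h6
  filter_upwards [h6] with z hz
  exact sub_eq_zero.1 hz

/-! ### Green's formula for functions with traces -/

lemma tendsto_integral_mul {α : Type*} [MeasurableSpace α] {m : Measure α} {f : ℕ → α → ℂ}
    {g W : α → ℂ} (hf : ∀ k, MemLp (f k) 2 m) (hg : MemLp g 2 m) (hW : MemLp W 2 m)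
    (h : Tendsto (fun k => eLpNorm (fun x => f k x - g x) 2 m) atTop (𝓝 0)) :
    Tendsto (fun k => ∫ x, f k x * W x ∂m) atTop (𝓝 (∫ x, g x * W x ∂m)) := by
  have h1 : Tendsto (fun k => (hf k).toLp _) atTop (𝓝 (hg.toLp _)) :=
    (Lp.tendsto_Lp_iff_tendsto_eLpNorm'' _ hf _ hg).2 h
  have h2 := ((continuous_integral_mul hW).tendsto _).comp h1
  have e : ∀ {F : α → ℂ} (hF : MemLp F 2 m), ∫ x, hF.toLp F x * W x ∂m = ∫ x, F x * W x ∂m := by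
    intro F hF
    refine integral_congr_ae ?_
    filter_upwards [hF.coeFn_toLp] with x hx
    rw [hx]
  rw [e hg] at h2
  exact h2.congr fun k => e (hf k)

lemma setIntegral_eq_of_vanish {i : Fin (d + 1)} {K : Set (Fin d → ℝ)} (hKf : K ⊆ face i)
    {f : (Fin d → ℝ) → ℂ} (h : ∀ z ∈ face i, z ∉ K → f z = 0) :
    ∫ z in face i, f z = ∫ z in K, f z :=
  setIntegral_eq_of_subset_of_forall_sdiff_eq_zero (measurableSet_face i) hKf
    fun z hz => h z hz.1 hz.2

/-- Green's formula against functions vanishing near the edges of the half-cylinder. -/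
theorem TendstoH1.green (θ : Space d) {U G : Space d → ℂ}
    (hU : MemLp U 2 (volume.restrict (guide d))) (hG : MemLp G 2 (volume.restrict (guide d)))
    {B : ℕ → Space d → ℂ} (hB : ∀ k, IsTest (B k)) (hBU : TendstoH1 θ B U G)
    {W : Space d → ℂ} (hW : ContDiff ℝ 1 W) {R : ℝ} (hR : ∀ y, R ≤ y (Fin.last d) → W y = 0)
    (hper : ∀ (i : Fin d) z, W (facePoint i.castSucc 1 z) = W (facePoint i.castSucc 0 z))
    {K : Fin (d + 1) → Set (Fin d → ℝ)} (hK : ∀ i, IsCompact (K i)) (hKf : ∀ i, K i ⊆ face i)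
    (hWK : ∀ i, ∀ z ∈ face i, z ∉ K i → W (facePoint i 0 z) = 0)
    (hlat : ∀ i : Fin d, Tendsto (fun k => eLpNorm (fun z => B k (facePoint i.castSucc 1 z) -
      B k (facePoint i.castSucc 0 z)) 2 (volume.restrict (K i.castSucc))) atTop (𝓝 0))
    {φ : (Fin d → ℝ) → ℂ} (hφ : MemLp φ 2 (volume.restrict (K (Fin.last d))))
    (hbot : Tendsto (fun k => eLpNorm (fun z => B k (facePoint (Fin.last d) 0 z) - φ z) 2
      (volume.restrict (K (Fin.last d)))) atTop (𝓝 0)) :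
    (∫ y in guide d, U y * dirDeriv θ W y) + (∫ y in guide d, G y * W y) =
      -(θ (Fin.last d) * ∫ z in face (Fin.last d), φ z * W (facePoint (Fin.last d) 0 z)) := by
  have hW2 : MemLp W 2 (volume.restrict (guide d)) := memLp_guide hW.continuous hR 2
  have hDW2 : MemLp (dirDeriv θ W) 2 (volume.restrict (guide d)) :=
    memLp_guide (R := R + 1) (continuous_dirDeriv θ hW)
      (fun y hy => dirDeriv_eq_zero_of_le hR (by linarith)) 2
  have hcK : ∀ i, IsFiniteMeasure (volume.restrict (K i)) := fun i =>
    ⟨by simpa using (hK i).measure_lt_top⟩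
  have hKLp : ∀ i (f : (Fin d → ℝ) → ℂ), Continuous f → MemLp f 2 (volume.restrict (K i)) := by
    intro i f hf
    obtain ⟨M, hM⟩ := (hK i).exists_bound_of_continuousOn hf.continuousOn
    exact MemLp.of_bound hf.aestronglyMeasurable M
      ((ae_restrict_iff' (hK i).measurableSet).2 (Eventually.of_forall hM))
  have hcf : ∀ {f : Space d → ℂ} i (a : ℝ), Continuous f → Continuous fun z => f (facePoint i a z) :=
    fun i a hf => hf.comp (continuous_facePoint_right i a)
  have hL : Tendsto (fun k => (∫ y in guide d, B k y * dirDeriv θ W y) +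
      ∫ y in guide d, dirDeriv θ (B k) y * W y) atTop
      (𝓝 ((∫ y in guide d, U y * dirDeriv θ W y) + ∫ y in guide d, G y * W y)) :=
    (tendsto_integral_mul (fun k => (hB k).memLp 2) hU hDW2 hBU.1).add
      (tendsto_integral_mul (fun k => ((hB k).dirDeriv θ).memLp 2) hG hW2 hBU.2)
  have hRt : Tendsto (fun k => (∑ i : Fin d, (θ i.castSucc : ℂ) * ∫ z in K i.castSucc,
        (B k (facePoint i.castSucc 1 z) - B k (facePoint i.castSucc 0 z)) *
          W (facePoint i.castSucc 0 z)) - θ (Fin.last d) * ∫ z in K (Fin.last d),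
        B k (facePoint (Fin.last d) 0 z) * W (facePoint (Fin.last d) 0 z)) atTop
      (𝓝 ((∑ i : Fin d, (θ i.castSucc : ℂ) * ∫ z in K i.castSucc, (0 : ℂ) *
          W (facePoint i.castSucc 0 z)) - θ (Fin.last d) * ∫ z in K (Fin.last d),
        φ z * W (facePoint (Fin.last d) 0 z))) := by
    refine Tendsto.sub (tendsto_finsetSum _ fun i _ => Tendsto.const_mul _ ?_)
      (Tendsto.const_mul _ ?_)
    · refine tendsto_integral_mul (g := fun _ => (0 : ℂ)) (fun k => hKLp _ _ ?_) ?_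
        (hKLp _ _ (hcf _ _ hW.continuous)) (by simpa using hlat i)
      · exact (hcf _ _ (hB k).1.continuous).sub (hcf _ _ (hB k).1.continuous)
      · exact MemLp.zero
    · exact tendsto_integral_mul (fun k => hKLp _ _ (hcf _ _ (hB k).1.continuous)) hφ
        (hKLp _ _ (hcf _ _ hW.continuous)) hbot
  -- For smooth `B k` the divergence theorem applies to `B k * W`. Since `W` vanishes on the faces
  -- outside the compact sets `K i`, the boundary integrals involve only the regions where
  -- convergence of traces is known.
  have heq : ∀ k, (∫ y in guide d, B k y * dirDeriv θ W y) +
      (∫ y in guide d, dirDeriv θ (B k) y * W y) =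
      (∑ i : Fin d, (θ i.castSucc : ℂ) * ∫ z in K i.castSucc,
        (B k (facePoint i.castSucc 1 z) - B k (facePoint i.castSucc 0 z)) *
          W (facePoint i.castSucc 0 z)) - θ (Fin.last d) * ∫ z in K (Fin.last d),
        B k (facePoint (Fin.last d) 0 z) * W (facePoint (Fin.last d) 0 z) := by
    intro k
    have h1 := HalfGuide.integral_dirDeriv θ ((hB k).contDiff_one.mul hW) (R := R)
      fun y hy => by rw [hR y hy, mul_zero]
    have h2 : ∫ y in guide d, dirDeriv θ (fun y => B k y * W y) y =
        (∫ y in guide d, B k y * dirDeriv θ W y) + ∫ y in guide d, dirDeriv θ (B k) y * W y := by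
      rw [← integral_add (integrable_mul_guide ((hB k).memLp 2) hDW2)
        (integrable_mul_guide (((hB k).dirDeriv θ).memLp 2) hW2)]
      refine integral_congr_ae (Eventually.of_forall fun y => ?_)
      simp only
      rw [dirDeriv_mul θ ((hB k).contDiff_one.differentiable one_ne_zero y)
        (hW.differentiable one_ne_zero y), mul_comm (W y)]
    rw [← h2, h1]
    congr 1
    · refine Finset.sum_congr rfl fun i _ => ?_
      congr 1
      have hv : ∀ a : ℝ, (∫ z in face i.castSucc, B k (facePoint i.castSucc a z) *
          W (facePoint i.castSucc 0 z)) = ∫ z in K i.castSucc, B k (facePoint i.castSucc a z) *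
          W (facePoint i.castSucc 0 z) := fun a =>
        setIntegral_eq_of_vanish (hKf _) fun z hz hzK => by rw [hWK _ z hz hzK, mul_zero]
      simp only [hper]
      rw [hv, hv, ← integral_sub]
      · simp only [sub_mul]
      · exact (hKLp _ _ (hcf _ _ (hB k).1.continuous)).integrable_mul
          (hKLp _ _ (hcf _ _ hW.continuous))
      · exact (hKLp _ _ (hcf _ _ (hB k).1.continuous)).integrable_mul
          (hKLp _ _ (hcf _ _ hW.continuous))
    · congr 1
      exact setIntegral_eq_of_vanish (hKf _) fun z hz hzK => by rw [hWK _ z hz hzK, mul_zero]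
  have := tendsto_nhds_unique (hL.congr heq) hRt
  rw [this, setIntegral_eq_of_vanish (hKf (Fin.last d)) fun z hz hzK => by
    rw [hWK _ z hz hzK, mul_zero]]
  simp

/-! ### Cutoff near the edges -/

/-- A smooth bump, `1` on `[-1, 1]` and `0` outside `(-2, 2)`. -/
noncomputable def bump : ContDiffBump (0 : ℝ) := ⟨1, 2, one_pos, one_lt_two⟩

lemma bump_eq_one {s : ℝ} (h : |s| ≤ 1) : bump s = 1 :=
  bump.one_of_mem_closedBall (by simpa [bump] using h)

lemma bump_eq_zero {s : ℝ} (h : 2 ≤ |s|) : bump s = 0 :=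
  bump.zero_of_le_dist (by simpa [bump] using h)

lemma exists_deriv_bump_le : ∃ M, 0 ≤ M ∧ ∀ s, |deriv bump s| ≤ M := by
  obtain ⟨M, hM⟩ := bump.hasCompactSupport.deriv.exists_bound_of_continuous
    ((bump.contDiff (n := 1)).continuous_deriv le_rfl)
  exact ⟨M, (norm_nonneg _).trans (hM 0), hM⟩

lemma hasDerivAt_bump (s : ℝ) : HasDerivAt bump (deriv bump s) s :=
  ((bump.contDiff (n := 1)).differentiable one_ne_zero s).hasDerivAt

lemma deriv_bump_eq_zero_of_abs_le {s : ℝ} (h : |s| ≤ 1) : deriv bump s = 0 := by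
  have : IsLocalMax bump s := Eventually.of_forall fun x => by
    simp only [bump_eq_one h]; exact bump.le_one
  exact this.deriv_eq_zero

/-- A defining function of the faces `{yⱼ = 0}` and `{yⱼ = 1}` (only `{yⱼ = 0}` for `j = n`). -/
noncomputable def margin (j : Fin (d + 1)) (t : ℝ) : ℝ :=
  if j = Fin.last d then t else t * (1 - t)

/-- The derivative of `margin`. -/
noncomputable def margin' (j : Fin (d + 1)) (t : ℝ) : ℝ :=
  if j = Fin.last d then 1 else 1 - 2 * t

lemma hasDerivAt_margin (j : Fin (d + 1)) (t : ℝ) : HasDerivAt (margin j) (margin' j t) t := by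
  unfold margin margin'
  split_ifs with h
  · exact hasDerivAt_id t
  · have := (hasDerivAt_id' t).fun_mul ((hasDerivAt_id' t).const_sub 1)
    have e : (1 : ℝ) * (1 - t) + t * -1 = 1 - 2 * t := by ring
    rwa [e] at this

lemma contDiff_margin (j : Fin (d + 1)) : ContDiff ℝ ((⊤ : ℕ∞) : WithTop ℕ∞) (margin j) := by
  unfold margin
  split_ifs
  · exact contDiff_id
  · exact contDiff_id.mul (contDiff_const.sub contDiff_id)

lemma margin_pos {y : Space d} (hy : y ∈ guide d) (j : Fin (d + 1)) : 0 < margin j (y j) := by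
  unfold margin
  split_ifs with h
  · exact (hy j).1
  · exact mul_pos (hy j).1 (by linarith [(hy j).2 h])

lemma margin_face_pos {i : Fin (d + 1)} {z : Fin d → ℝ} (hz : z ∈ face i) (j : Fin d) :
    0 < margin (i.succAbove j) (z j) := by
  unfold margin
  split_ifs with h
  · exact (hz j).1
  · exact mul_pos (hz j).1 (by linarith [(hz j).2 h])

lemma abs_margin'_le {y : Space d} (hy : y ∈ guide d) (j : Fin (d + 1)) :
    |margin' j (y j)| ≤ 1 := by
  unfold margin'
  split_ifs with h
  · simp
  · rw [abs_le]; constructor <;> linarith [(hy j).1, (hy j).2 h]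

/-- The number of faces at distance less than `ε`, in a smoothed sense. -/
noncomputable def nearFaces (ε : ℝ) (y : Space d) : ℝ := ∑ j, bump (margin j (y j) / ε)

/-- A smooth cutoff vanishing near the edges. -/
noncomputable def edgeCutoff (ε : ℝ) (y : Space d) : ℂ := (bump (nearFaces ε y) : ℝ)

lemma contDiff_edgeCutoff (ε : ℝ) :
    ContDiff ℝ ((⊤ : ℕ∞) : WithTop ℕ∞) (edgeCutoff (d := d) ε) := by
  refine Complex.ofRealCLM.contDiff.comp (bump.contDiff.comp (ContDiff.sum fun j _ => ?_))
  exact bump.contDiff.comp (((contDiff_margin j).comp (contDiff_apply ℝ ℝ j)).div_const ε)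

lemma norm_edgeCutoff_le (ε : ℝ) (y : Space d) : ‖edgeCutoff ε y‖ ≤ 1 := by
  rw [edgeCutoff, Complex.norm_real, Real.norm_of_nonneg bump.nonneg]
  exact bump.le_one

lemma dirDeriv_edgeCutoff (θ : Space d) (ε : ℝ) (y : Space d) :
    dirDeriv θ (edgeCutoff ε) y = ((deriv bump (nearFaces ε y) *
      ∑ j, deriv bump (margin j (y j) / ε) * (margin' j (y j) * θ j / ε) : ℝ) : ℂ) := by
  have h1 := hasDerivAt_line θ (V := edgeCutoff ε) y 0
    ((contDiff_edgeCutoff ε).differentiable (by simp) _)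
  rw [zero_smul, add_zero] at h1
  have h3 : ∀ j, HasDerivAt (fun s : ℝ => bump (margin j ((y + s • θ) j) / ε))
      (deriv bump (margin j (y j) / ε) * (margin' j (y j) * θ j / ε)) 0 := by
    intro j
    have e1 : HasDerivAt (fun s : ℝ => (y + s • θ) j) (θ j) 0 := by
      simpa using ((hasDerivAt_id (0 : ℝ)).mul_const (θ j)).const_add (y j)
    have e2 : HasDerivAt (margin j) (margin' j (y j)) ((y + (0 : ℝ) • θ) j) := by
      rw [zero_smul, add_zero]; exact hasDerivAt_margin j _
    have e3 := (e2.comp 0 e1).div_const ε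
    have e4 : HasDerivAt bump (deriv bump (margin j (y j) / ε))
        (margin j ((y + (0 : ℝ) • θ) j) / ε) := by
      rw [zero_smul, add_zero]; exact hasDerivAt_bump _
    have e5 := e4.comp (0 : ℝ) e3
    exact e5
  have h4 : HasDerivAt (fun s : ℝ => nearFaces ε (y + s • θ))
      (∑ j, deriv bump (margin j (y j) / ε) * (margin' j (y j) * θ j / ε)) 0 :=
    HasDerivAt.fun_sum fun j _ => h3 j
  have h5 : HasDerivAt bump (deriv bump (nearFaces ε y)) (nearFaces ε (y + (0 : ℝ) • θ)) := by
    rw [zero_smul, add_zero]; exact hasDerivAt_bump _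
  have h6 := (h5.comp (0 : ℝ) h4).ofReal_comp
  exact h1.unique h6

/-- The part at height at most `R` of a neighbourhood of the edges. -/
def edgeNhd (d : ℕ) (R ε : ℝ) : Set (Space d) :=
  {y | y ∈ guide d ∧ y (Fin.last d) < R ∧
    ∃ i j, i ≠ j ∧ margin i (y i) ≤ 2 * ε ∧ margin j (y j) ≤ 2 * ε}

/-- Away from the edges at most one term of `nearFaces` is nonzero, so the sum is at most `1` and
the outer bump is on its plateau, where its derivative is zero. Near the edges every term has
derivative `O(1/ε)`. -/
lemma exists_dirDeriv_edgeCutoff_le (θ : Space d) : ∃ C, 0 ≤ C ∧ ∀ ε R : ℝ, 0 < ε → ∀ y ∈ guide d,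
    y (Fin.last d) < R →
    ‖dirDeriv θ (edgeCutoff ε) y‖ ≤ (edgeNhd d R ε).indicator (fun _ => C / ε) y := by
  obtain ⟨M, hM0, hM⟩ := exists_deriv_bump_le
  refine ⟨M * ∑ j, M * |θ j|, mul_nonneg hM0 (Finset.sum_nonneg fun j _ => by positivity),
    fun ε R hε y hy hyR => ?_⟩
  rw [dirDeriv_edgeCutoff, Complex.norm_real, Real.norm_eq_abs, abs_mul]
  by_cases hN : y ∈ edgeNhd d R ε
  · rw [Set.indicator_of_mem hN, mul_div_assoc, Finset.sum_div]
    refine mul_le_mul (hM _) ?_ (abs_nonneg _) hM0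
    refine (Finset.abs_sum_le_sum_abs _ _).trans (Finset.sum_le_sum fun j _ => ?_)
    rw [abs_mul, abs_div, abs_mul, abs_of_pos hε, mul_div_assoc, mul_div_assoc]
    refine mul_le_mul (hM _) ?_ (by positivity) hM0
    exact mul_le_of_le_one_left (by positivity) (abs_margin'_le hy j)
  · rw [Set.indicator_of_notMem hN]
    have h1 : nearFaces ε y ≤ 1 := by
      have hz : ∀ j, 2 * ε < margin j (y j) → bump (margin j (y j) / ε) = 0 := fun j hj => by
        refine bump_eq_zero (le_trans ?_ (le_abs_self _))
        rw [le_div_iff₀ hε]; exact hj.le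
      by_cases h : ∃ i, margin i (y i) ≤ 2 * ε
      · obtain ⟨i, hi⟩ := h
        rw [nearFaces, Finset.sum_eq_single i]
        · exact bump.le_one
        · intro j _ hj
          refine hz j ?_
          by_contra hlt
          exact hN ⟨hy, hyR, i, j, hj.symm, hi, not_lt.1 hlt⟩
        · simp
      · push Not at h
        rw [nearFaces, Finset.sum_eq_zero fun j _ => hz j (h j)]
        exact zero_le_one
    have h0 : 0 ≤ nearFaces ε y := Finset.sum_nonneg fun j _ => bump.nonneg
    rw [deriv_bump_eq_zero_of_abs_le (by rwa [abs_of_nonneg h0])]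
    simp

lemma volume_margin_le (j : Fin (d + 1)) {R ε : ℝ} (hε : 0 < ε) :
    volume (Set.Ioo 0 (topCorner d R j) ∩ {t | margin j t ≤ 2 * ε}) ≤ ENNReal.ofReal (8 * ε) := by
  by_cases hj : j = Fin.last d
  · have : Set.Ioo 0 (topCorner d R j) ∩ {t | margin j t ≤ 2 * ε} ⊆ Set.Ioc 0 (2 * ε) := by
      rintro t ⟨h1, h2⟩
      simp only [margin, hj, if_true, Set.mem_ofPred_eq] at h2
      exact ⟨h1.1, h2⟩
    refine (measure_mono this).trans ?_
    rw [Real.volume_Ioc]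
    exact ENNReal.ofReal_le_ofReal (by linarith)
  · have : Set.Ioo 0 (topCorner d R j) ∩ {t | margin j t ≤ 2 * ε} ⊆
        Set.Ioc 0 (4 * ε) ∪ Set.Ico (1 - 4 * ε) 1 := by
      rintro t ⟨h1, h2⟩
      simp only [margin, hj, if_false, Set.mem_ofPred_eq] at h2
      rw [topCorner_of_ne hj] at h1
      -- On the half of the interval nearer to an end, `t (1 - t)` is at least half the distance to
      -- that end, whence the width `4 ε`.
      rcases le_total t (1 / 2) with h | h
      · exact Or.inl ⟨h1.1, by nlinarith [h1.1]⟩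
      · exact Or.inr ⟨by nlinarith [h1.2], h1.2⟩
    refine (measure_mono this).trans ((measure_union_le _ _).trans ?_)
    rw [Real.volume_Ioc, Real.volume_Ico, ← ENNReal.ofReal_add (by linarith) (by linarith)]
    exact ENNReal.ofReal_le_ofReal (by linarith)

/-- Near an edge two distinct coordinates are each confined to a set of length `O(ε)`, and the
others to bounded intervals; a finite union over pairs of faces gives `O(ε²)`. -/
lemma exists_volume_edgeNhd_le (d : ℕ) (R : ℝ) : ∃ C : ℝ≥0∞, C ≠ ∞ ∧ ∀ ε, 0 < ε →
    volume (edgeNhd d R ε) ≤ C * ENNReal.ofReal ε ^ 2 := by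
  set T : ℝ≥0∞ := ENNReal.ofReal (max R 8) with hT
  refine ⟨∑ _p : Fin (d + 1) × Fin (d + 1), T ^ (d + 1),
    ENNReal.sum_ne_top.2 fun _ _ => ENNReal.pow_ne_top ENNReal.ofReal_ne_top, fun ε hε => ?_⟩
  set A : Fin (d + 1) × Fin (d + 1) → Set (Space d) := fun p => if p.1 = p.2 then ∅ else
    Set.pi Set.univ fun k => if k = p.1 ∨ k = p.2 then
      Set.Ioo 0 (topCorner d R k) ∩ {t | margin k t ≤ 2 * ε} else Set.Ioo 0 (topCorner d R k) with hA
  have hsub : edgeNhd d R ε ⊆ ⋃ p, A p := by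
    rintro y ⟨hy, hyR, i, j, hij, hi, hj⟩
    have hbox : y ∈ guide d ∩ {y | y (Fin.last d) < R} := ⟨hy, hyR⟩
    rw [guide_inter] at hbox
    refine Set.mem_iUnion.2 ⟨(i, j), ?_⟩
    simp only [hA, hij, if_false]
    intro k _
    simp only
    split_ifs with hk
    · refine ⟨hbox k trivial, ?_⟩
      rcases hk with rfl | rfl
      · exact hi
      · exact hj
    · exact hbox k trivial
  refine (measure_mono hsub).trans ((measure_iUnion_fintype_le _ _).trans ?_)
  rw [Finset.sum_mul]
  refine Finset.sum_le_sum fun p _ => ?_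
  simp only [hA]
  split_ifs with hp
  · simp
  rw [volume_pi_pi]
  have hle : ∀ k, volume (if k = p.1 ∨ k = p.2 then
      Set.Ioo 0 (topCorner d R k) ∩ {t | margin k t ≤ 2 * ε} else Set.Ioo 0 (topCorner d R k)) ≤
      T * if k ∈ ({p.1, p.2} : Finset (Fin (d + 1))) then ENNReal.ofReal ε else 1 := by
    intro k
    simp only [Finset.mem_insert, Finset.mem_singleton]
    split_ifs with hk
    · refine (volume_margin_le k hε).trans ?_
      rw [hT, ← ENNReal.ofReal_mul (by positivity)]
      exact ENNReal.ofReal_le_ofReal (mul_le_mul_of_nonneg_right (le_max_right _ _) hε.le)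
    · rw [Real.volume_Ioo, mul_one, sub_zero]
      refine ENNReal.ofReal_le_ofReal ?_
      unfold topCorner
      split_ifs
      · exact le_max_left _ _
      · exact le_max_of_le_right (by norm_num)
  refine (Finset.prod_le_prod' fun k _ => hle k).trans (le_of_eq ?_)
  rw [Finset.prod_mul_distrib, Finset.prod_ite_mem, Finset.univ_inter, Finset.prod_const,
    Finset.prod_const, Finset.card_pair hp]
  simp

lemma measurableSet_edgeNhd (R ε : ℝ) : MeasurableSet (edgeNhd d R ε) := by
  have : edgeNhd d R ε = guide d ∩ ({y | y (Fin.last d) < R} ∩ ⋃ i, ⋃ j, ⋃ _ : i ≠ j,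
      {y | margin i (y i) ≤ 2 * ε} ∩ {y | margin j (y j) ≤ 2 * ε}) := by
    ext y
    simp only [edgeNhd, Set.mem_inter_iff, Set.mem_iUnion, Set.mem_ofPred_eq, exists_prop]
  rw [this]
  have hm : ∀ i : Fin (d + 1), MeasurableSet {y : Space d | margin i (y i) ≤ 2 * ε} := fun i =>
    measurableSet_le ((contDiff_margin i).continuous.measurable.comp (measurable_pi_apply i))
      measurable_const
  refine measurableSet_guide.inter ((measurableSet_lt (measurable_pi_apply _)
    measurable_const).inter ?_)
  exact MeasurableSet.iUnion fun i => MeasurableSet.iUnion fun j => MeasurableSet.iUnion fun _ =>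
    (hm i).inter (hm j)

/-- The compact parts of the faces away from the edges. -/
def innerFace (i : Fin (d + 1)) (R ε : ℝ) : Set (Fin d → ℝ) :=
  {z | z ∈ Set.Icc 0 (topCorner d R ∘ i.succAbove) ∧ ∀ j, ε ≤ margin (i.succAbove j) (z j)}

lemma isCompact_innerFace (i : Fin (d + 1)) (R ε : ℝ) : IsCompact (innerFace i R ε) := by
  have : innerFace i R ε = Set.Icc 0 (topCorner d R ∘ i.succAbove) ∩
      ⋂ j, {z | ε ≤ margin (i.succAbove j) (z j)} := by
    ext z; simp [innerFace]
  rw [this]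
  exact isCompact_Icc.inter_right (isClosed_iInter fun j => isClosed_le continuous_const
    ((contDiff_margin _).continuous.comp (continuous_apply j)))

lemma innerFace_subset (i : Fin (d + 1)) (R : ℝ) {ε : ℝ} (hε : 0 < ε) : innerFace i R ε ⊆ face i := by
  rintro z ⟨h1, h2⟩ j
  have h3 := h2 j
  have h4 : 0 ≤ z j := h1.1 j
  unfold margin at h3
  split_ifs at h3 with h
  · exact ⟨hε.trans_le h3, fun h' => absurd h h'⟩
  · have h0 : z j ≠ 0 := fun h0 => by rw [h0] at h3; linarith
    have hpos : 0 < z j := lt_of_le_of_ne h4 h0.symm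
    refine ⟨hpos, fun _ => ?_⟩
    by_contra hge
    push Not at hge
    nlinarith

/-- The face itself contributes exactly `1` to `nearFaces`. Hence the cutoff takes equal values on
opposite lateral faces, and it vanishes as soon as a second face contributes `1`. -/
lemma edgeCutoff_facePoint {i : Fin (d + 1)} {a : ℝ} (ha : margin i a = 0) (ε : ℝ)
    (z : Fin d → ℝ) : edgeCutoff ε (facePoint i a z) =
      ((bump (1 + ∑ j, bump (margin (i.succAbove j) (z j) / ε)) : ℝ) : ℂ) := by
  rw [edgeCutoff, nearFaces, Fin.sum_univ_succAbove _ i]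
  simp only [facePoint_self, facePoint_succAbove, ha, zero_div]
  rw [bump_eq_one (s := 0) (by simp)]

lemma margin_zero (i : Fin (d + 1)) : margin i 0 = 0 := by
  unfold margin; split_ifs <;> simp

lemma margin_castSucc_one (i : Fin d) : margin i.castSucc 1 = 0 := by
  simp [margin, (Fin.castSucc_lt_last i).ne]

lemma edgeCutoff_eq_zero {i : Fin (d + 1)} {ε : ℝ} (hε : 0 < ε) {z : Fin d → ℝ} (hz : z ∈ face i)
    (h : ∃ j, margin (i.succAbove j) (z j) < ε) : edgeCutoff ε (facePoint i 0 z) = 0 := by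
  obtain ⟨j, hj⟩ := h
  rw [edgeCutoff_facePoint (margin_zero i), bump_eq_zero, Complex.ofReal_zero]
  have h1 : bump (margin (i.succAbove j) (z j) / ε) = 1 := by
    refine bump_eq_one ?_
    rw [abs_of_pos (div_pos (margin_face_pos hz j) hε), div_le_one hε]
    exact hj.le
  have h2 := Finset.single_le_sum (f := fun j => bump (margin (i.succAbove j) (z j) / ε))
    (fun k _ => bump.nonneg) (Finset.mem_univ j)
  simp only [h1] at h2
  refine le_trans ?_ (le_abs_self _)
  linarith

lemma tendsto_bump_margin {t : ℝ} (ht : 0 < t) {ε : ℕ → ℝ} (hε : ∀ m, 0 < ε m)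
    (h : Tendsto ε atTop (𝓝 0)) : ∀ᶠ m in atTop, bump (t / ε m) = 0 := by
  filter_upwards [h.eventually_lt_const (half_pos ht)] with m hm
  refine bump_eq_zero (le_trans ?_ (le_abs_self _))
  rw [le_div_iff₀ (hε m)]
  linarith

lemma eventually_edgeCutoff_eq_one {y : Space d} (hy : y ∈ guide d) {ε : ℕ → ℝ}
    (hε : ∀ m, 0 < ε m) (h : Tendsto ε atTop (𝓝 0)) :
    ∀ᶠ m in atTop, edgeCutoff (ε m) y = 1 := by
  have : ∀ᶠ m in atTop, ∀ j, bump (margin j (y j) / ε m) = 0 :=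
    eventually_all.2 fun j => tendsto_bump_margin (margin_pos hy j) hε h
  filter_upwards [this] with m hm
  rw [edgeCutoff, nearFaces, Finset.sum_eq_zero fun j _ => hm j, bump_eq_one (by simp),
    Complex.ofReal_one]

lemma eventually_edgeCutoff_facePoint_eq_one {i : Fin (d + 1)} {z : Fin d → ℝ} (hz : z ∈ face i)
    {ε : ℕ → ℝ} (hε : ∀ m, 0 < ε m) (h : Tendsto ε atTop (𝓝 0)) :
    ∀ᶠ m in atTop, edgeCutoff (ε m) (facePoint i 0 z) = 1 := by
  have : ∀ᶠ m in atTop, ∀ j, bump (margin (i.succAbove j) (z j) / ε m) = 0 :=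
    eventually_all.2 fun j => tendsto_bump_margin (margin_face_pos hz j) hε h
  filter_upwards [this] with m hm
  rw [edgeCutoff_facePoint (margin_zero i), Finset.sum_eq_zero fun j _ => hm j,
    bump_eq_one (by simp), Complex.ofReal_one]

/-! ### Removing the edges -/

lemma exists_scale : ∃ ε : ℕ → ℝ, (∀ m, 0 < ε m) ∧ Tendsto ε atTop (𝓝 0) :=
  ⟨fun m => 1 / ((m : ℝ) + 1), fun m => by positivity, tendsto_one_div_add_atTop_nhds_zero_nat⟩

/-- The edges have zero capacity. -/
lemma tendsto_integral_dirDeriv_edgeCutoff (θ : Space d) {U V : Space d → ℂ}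
    (hU : MemLp U 2 (volume.restrict (guide d))) (hV : PerTest V) {ε : ℕ → ℝ}
    (hε : ∀ m, 0 < ε m) (hlim : Tendsto ε atTop (𝓝 0)) :
    Tendsto (fun m => ∫ y in guide d, U y * (V y * dirDeriv θ (edgeCutoff (ε m)) y)) atTop
      (𝓝 0) := by
  obtain ⟨R, hR⟩ := hV.vanish
  obtain ⟨M, hM0, hM⟩ := hV.bounded 0
  obtain ⟨C, hC0, hC⟩ := exists_dirDeriv_edgeCutoff_le θ
  obtain ⟨T, hT, hvol⟩ := exists_volume_edgeNhd_le d R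
  have hsub : ∀ m, edgeNhd d R (ε m) ⊆ guide d := fun m y hy => hy.1
  set N : ℕ → Set (Space d) := fun m => edgeNhd d R (ε m) with hN
  have hNm : ∀ m, MeasurableSet (N m) := fun m => measurableSet_edgeNhd R (ε m)
  have hUN : Tendsto (fun m => eLpNorm U 2 (volume.restrict (N m))) atTop (𝓝 0) := by
    have h1 : Tendsto (fun m => volume.restrict (guide d) (N m)) atTop (𝓝 0) := by
      have h2 : Tendsto (fun m => T * ENNReal.ofReal (ε m) ^ 2) atTop (𝓝 0) := by
        have h3 := ENNReal.Tendsto.const_mul (a := T)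
          (((ENNReal.continuous_pow 2).tendsto _).comp (ENNReal.tendsto_ofReal hlim)) (Or.inr hT)
        simpa using h3
      refine tendsto_of_tendsto_of_tendsto_of_le_of_le tendsto_const_nhds h2 (fun _ => zero_le)
        fun m => (Measure.restrict_apply_le _ _).trans (hvol _ (hε m))
    have h3 : ∫⁻ y in guide d, ‖U y‖ₑ ^ 2 ≠ ∞ := by
      rw [← eLpNorm_two_sq]
      exact ENNReal.pow_ne_top hU.2.ne
    have h4 := tendsto_setLIntegral_zero h3 h1
    have h5 := ((ENNReal.continuous_rpow_const (y := 1 / 2)).tendsto _).comp h4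
    simp only [ENNReal.zero_rpow_of_pos (by norm_num : (0 : ℝ) < 1 / 2)] at h5
    refine h5.congr fun m => ?_
    simp only [Function.comp]
    rw [Measure.restrict_restrict (hNm m), Set.inter_eq_self_of_subset_left (hsub m),
      ← eLpNorm_two_sq, ← ENNReal.rpow_natCast, ← ENNReal.rpow_mul]
    norm_num
    rfl
  -- Cauchy–Schwarz on the edge neighbourhood: the factor `1/ε` from the derivative cancels the
  -- factor `ε` from the square root of the volume. What remains is the `L²` norm of `U` on a set of
  -- vanishing measure.
  have hbound : ∀ m, ‖∫ y in guide d, U y * (V y * dirDeriv θ (edgeCutoff (ε m)) y)‖ₑ ≤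
      ENNReal.ofReal (M * C) * T ^ (1 / 2 : ℝ) * eLpNorm U 2 (volume.restrict (N m)) := by
    intro m
    have hpt : ∀ y ∈ guide d, ‖U y * (V y * dirDeriv θ (edgeCutoff (ε m)) y)‖ₑ ≤
        (N m).indicator (fun y => ENNReal.ofReal (M * (C / ε m)) * ‖U y‖ₑ) y := by
      intro y hy
      by_cases hyR : y (Fin.last d) < R
      · have h1 := hC (ε m) R (hε m) y hy hyR
        have h2 := hM y (hy _).1.le
        by_cases hyN : y ∈ N m
        · rw [Set.indicator_of_mem hyN] at h1 ⊢
          rw [enorm_mul, mul_comm]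
          refine mul_le_mul_left ?_ _
          rw [← ofReal_norm]
          refine ENNReal.ofReal_le_ofReal ?_
          rw [norm_mul]
          exact mul_le_mul h2 h1 (norm_nonneg _) hM0
        · rw [Set.indicator_of_notMem hyN] at h1
          rw [norm_le_zero_iff.1 h1]
          simp
      · rw [hR y (not_lt.1 hyR)]
        simp
    have hUm : AEStronglyMeasurable U (volume.restrict (N m)) :=
      hU.1.mono_measure (Measure.restrict_mono (hsub m) le_rfl)
    calc ‖∫ y in guide d, U y * (V y * dirDeriv θ (edgeCutoff (ε m)) y)‖ₑ
        ≤ ∫⁻ y in guide d, ‖U y * (V y * dirDeriv θ (edgeCutoff (ε m)) y)‖ₑ :=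
          enorm_integral_le_lintegral_enorm _
      _ ≤ ∫⁻ y in guide d, (N m).indicator (fun y => ENNReal.ofReal (M * (C / ε m)) * ‖U y‖ₑ) y :=
          setLIntegral_mono' measurableSet_guide hpt
      _ = ENNReal.ofReal (M * (C / ε m)) * eLpNorm U 1 (volume.restrict (N m)) := by
          rw [lintegral_indicator (hNm m), Measure.restrict_restrict (hNm m),
            Set.inter_eq_self_of_subset_left (hsub m), lintegral_const_mul' _ _
            ENNReal.ofReal_ne_top, eLpNorm_one_eq_lintegral_enorm]
      _ ≤ ENNReal.ofReal (M * (C / ε m)) * (eLpNorm U 2 (volume.restrict (N m)) *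
            (T ^ (1 / 2 : ℝ) * ENNReal.ofReal (ε m))) := by
          refine mul_le_mul_right ?_ _
          refine (eLpNorm_le_eLpNorm_mul_rpow_measure_univ one_le_two hUm).trans ?_
          refine mul_le_mul_right ?_ _
          have e : 1 / (1 : ℝ≥0∞).toReal - 1 / (2 : ℝ≥0∞).toReal = 1 / 2 := by norm_num
          rw [e, Measure.restrict_apply_univ]
          refine (ENNReal.rpow_le_rpow (hvol _ (hε m)) (by norm_num)).trans (le_of_eq ?_)
          rw [ENNReal.mul_rpow_of_nonneg _ _ (by norm_num), ← ENNReal.rpow_natCast,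
            ← ENNReal.rpow_mul]
          norm_num
      _ = (ENNReal.ofReal (M * (C / ε m)) * ENNReal.ofReal (ε m)) * T ^ (1 / 2 : ℝ) *
            eLpNorm U 2 (volume.restrict (N m)) := by ring
      _ = _ := by
          rw [← ENNReal.ofReal_mul (mul_nonneg hM0 (div_nonneg hC0 (hε m).le))]
          congr 3
          have := (hε m).ne'
          field_simp
  rw [tendsto_zero_iff_enorm_tendsto_zero]
  have h := ENNReal.Tendsto.const_mul (a := ENNReal.ofReal (M * C) * T ^ (1 / 2 : ℝ)) hUN
    (Or.inr (ENNReal.mul_ne_top ENNReal.ofReal_ne_top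
      (ENNReal.rpow_ne_top_of_nonneg (by norm_num) hT)))
  rw [mul_zero] at h
  exact tendsto_of_tendsto_of_tendsto_of_le_of_le tendsto_const_nhds h (fun _ => zero_le) hbound

lemma tendsto_integral_edgeCutoff {α : Type*} [MeasurableSpace α] {m : Measure α} {f : α → ℂ}
    (hf : Integrable f m) {χ : ℕ → α → ℂ} (hm : ∀ k, AEStronglyMeasurable (χ k) m)
    (hle : ∀ k x, ‖χ k x‖ ≤ 1) (h : ∀ᵐ x ∂m, ∀ᶠ k in atTop, χ k x = 1) :
    Tendsto (fun k => ∫ x, f x * χ k x ∂m) atTop (𝓝 (∫ x, f x ∂m)) := by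
  refine tendsto_integral_of_dominated_convergence (fun x => ‖f x‖) (fun k => hf.1.mul (hm k))
    hf.norm (fun k => Eventually.of_forall fun x => ?_) ?_
  · rw [norm_mul]
    exact mul_le_of_le_one_right (norm_nonneg _) (hle k x)
  · filter_upwards [h] with x hx
    refine tendsto_const_nhds.congr' ?_
    filter_upwards [hx] with k hk
    rw [hk, mul_one]

/-- Green's formula against periodic test functions. -/
theorem TendstoH1.green_perTest (θ : Space d) {U G : Space d → ℂ}
    (hU : MemLp U 2 (volume.restrict (guide d))) (hG : MemLp G 2 (volume.restrict (guide d)))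
    {B : ℕ → Space d → ℂ} (hB : ∀ k, IsTest (B k)) (hBU : TendstoH1 θ B U G)
    (hlat : ∀ i : Fin d, ∀ K, IsCompact K → K ⊆ face i.castSucc →
      Tendsto (fun k => eLpNorm (fun z => B k (facePoint i.castSucc 1 z) -
      B k (facePoint i.castSucc 0 z)) 2 (volume.restrict K)) atTop (𝓝 0))
    {φ : (Fin d → ℝ) → ℂ} (hφ : MemLp φ 2 (volume.restrict (face (Fin.last d))))
    {V : Space d → ℂ} (hV : PerTest V)
    (hbot : (∀ K, IsCompact K → K ⊆ face (Fin.last d) →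
      Tendsto (fun k => eLpNorm (fun z => B k (facePoint (Fin.last d) 0 z) - φ z) 2
      (volume.restrict K)) atTop (𝓝 0)) ∨ ∀ z, V (facePoint (Fin.last d) 0 z) = 0) :
    (∫ y in guide d, U y * dirDeriv θ V y) + (∫ y in guide d, G y * V y) =
      -(θ (Fin.last d) * ∫ z in face (Fin.last d), φ z * V (facePoint (Fin.last d) 0 z)) := by
  classical
  obtain ⟨ε, hε, hlim⟩ := exists_scale
  obtain ⟨R, hR⟩ := hV.vanish
  have hχc : ∀ m, ContDiff ℝ 1 (edgeCutoff (d := d) (ε m)) := fun m =>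
    (contDiff_edgeCutoff (ε m)).of_le (by exact_mod_cast le_top)
  have hgreen : ∀ m, (∫ y in guide d, U y * dirDeriv θ (fun y => V y * edgeCutoff (ε m) y) y) +
      (∫ y in guide d, G y * (V y * edgeCutoff (ε m) y)) =
      -(θ (Fin.last d) * ∫ z in face (Fin.last d), φ z * (V (facePoint (Fin.last d) 0 z) *
        edgeCutoff (ε m) (facePoint (Fin.last d) 0 z))) := by
    intro m
    -- When `V` vanishes on the bottom face, the compact set there may be empty, and nothing is then
    -- required of the bottom traces of the approximating sequence. The flux is in this situation.
    set K : Fin (d + 1) → Set (Fin d → ℝ) := fun i =>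
      if i = Fin.last d ∧ ∀ z, V (facePoint (Fin.last d) 0 z) = 0 then ∅
      else innerFace i R (ε m) with hK
    have hKc : ∀ i, IsCompact (K i) := fun i => by
      simp only [hK]
      split_ifs
      · exact isCompact_empty
      · exact isCompact_innerFace _ _ _
    have hKf : ∀ i, K i ⊆ face i := fun i => by
      simp only [hK]
      split_ifs
      · exact Set.empty_subset _
      · exact innerFace_subset _ _ (hε m)
    refine hBU.green θ hU hG hB (hV.contDiff_one.mul (hχc m)) (R := R)
      (fun y hy => by rw [hR y hy, zero_mul]) (fun i z => ?_) hKc hKf (fun i z hz hzK => ?_)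
      (fun i => hlat i _ (hKc _) (hKf _))
      (hφ.mono_measure (Measure.restrict_mono (hKf _) le_rfl)) ?_
    · have h1 : V (facePoint i.castSucc 1 z) = V (facePoint i.castSucc 0 z) := by
        have := hV.periodic (facePoint i.castSucc 0 z) i
        rwa [facePoint_add_single, zero_add] at this
      rw [h1, edgeCutoff_facePoint (margin_castSucc_one i), edgeCutoff_facePoint (margin_zero _)]
    · simp only [hK] at hzK
      split_ifs at hzK with h
      · obtain ⟨rfl, h0⟩ := h
        rw [h0, zero_mul]
      · by_cases hc : ∃ j, margin (i.succAbove j) (z j) < ε m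
        · rw [edgeCutoff_eq_zero (hε m) hz hc, mul_zero]
        push Not at hc
        -- A point of the face with all margins at least `ε` can leave `innerFace` only through the
        -- top, where `V` vanishes.
        have : ∃ j, i.succAbove j = Fin.last d ∧ R ≤ z j := by
          by_contra hno
          push Not at hno
          refine hzK ⟨⟨fun j => (hz j).1.le, fun j => ?_⟩, hc⟩
          by_cases hj : i.succAbove j = Fin.last d
          · simp only [Function.comp, hj, topCorner_last]
            exact (hno j hj).le
          · simp only [Function.comp, topCorner_of_ne hj]
            exact ((hz j).2 hj).le
        obtain ⟨j, hj, hjR⟩ := this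
        rw [hR, zero_mul]
        rw [← hj, facePoint_succAbove]
        exact hjR
    · rcases hbot with hbot | hbot
      · exact hbot _ (hKc _) (hKf _)
      · have : K (Fin.last d) = ∅ := if_pos ⟨rfl, hbot⟩
        simp [this]
  have hχm : ∀ m, AEStronglyMeasurable (edgeCutoff (d := d) (ε m)) (volume.restrict (guide d)) :=
    fun m => (hχc m).continuous.aestronglyMeasurable
  have hχ1 : ∀ᵐ y ∂volume.restrict (guide d), ∀ᶠ m in atTop, edgeCutoff (ε m) y = 1 :=
    (ae_restrict_iff' measurableSet_guide).2 (Eventually.of_forall fun y hy =>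
      eventually_edgeCutoff_eq_one hy hε hlim)
  have hDV := (hV.dirDeriv θ).memLp 2
  have hVχ : ∀ m, MemLp (fun y => V y * dirDeriv θ (edgeCutoff (ε m)) y) 2
      (volume.restrict (guide d)) := fun m =>
    memLp_guide (R := R) (hV.continuous.mul (continuous_dirDeriv θ (hχc m)))
      (fun y hy => by simp [hR y hy]) 2
  have hDVχ : ∀ m, MemLp (fun y => dirDeriv θ V y * edgeCutoff (ε m) y) 2
      (volume.restrict (guide d)) := fun m => by
    obtain ⟨R', hR'⟩ := (hV.dirDeriv θ).vanish
    exact memLp_guide (R := R') ((hV.dirDeriv θ).continuous.mul (hχc m).continuous)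
      (fun y hy => by simp [hR' y hy]) 2
  have hlim1 : Tendsto (fun m => ∫ y in guide d,
      U y * dirDeriv θ (fun y => V y * edgeCutoff (ε m) y) y) atTop
      (𝓝 (∫ y in guide d, U y * dirDeriv θ V y)) := by
    have h1 := (tendsto_integral_dirDeriv_edgeCutoff θ hU hV hε hlim).add
      (tendsto_integral_edgeCutoff (integrable_mul_guide hU hDV) hχm
        (fun m => norm_edgeCutoff_le (ε m)) hχ1)
    rw [zero_add] at h1
    refine h1.congr fun m => ?_
    simp only [mul_assoc]
    rw [← integral_add (integrable_mul_guide hU (hVχ m)) (integrable_mul_guide hU (hDVχ m))]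
    refine integral_congr_ae (Eventually.of_forall fun y => ?_)
    simp only
    rw [dirDeriv_mul θ (hV.differentiable y) ((hχc m).differentiable one_ne_zero y)]
    ring
  have hlim2 := tendsto_integral_edgeCutoff (integrable_mul_guide hG (hV.memLp 2)) hχm
    (fun m => norm_edgeCutoff_le (ε m)) hχ1
  have hlim3 := tendsto_integral_edgeCutoff (m := volume.restrict (face (Fin.last d)))
    (hφ.integrable_mul (memLp_face hV.continuous 0 2))
    (χ := fun m z => edgeCutoff (ε m) (facePoint (Fin.last d) 0 z))
    (fun m => ((hχc m).continuous.comp (continuous_facePoint_right _ _)).aestronglyMeasurable)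
    (fun m z => norm_edgeCutoff_le (ε m) _)
    ((ae_restrict_iff' (measurableSet_face _)).2 (Eventually.of_forall fun z hz =>
      eventually_edgeCutoff_facePoint_eq_one hz hε hlim))
  have hl := hlim1.add hlim2
  have hr := (hlim3.const_mul (θ (Fin.last d) : ℂ)).neg
  refine tendsto_nhds_unique hl (hr.congr fun m => ?_)
  have := hgreen m
  simp only [← mul_assoc] at this ⊢
  exact this.symm

/-! ### From solutions to weak solutions -/

lemma HasPeriodicTraces.tendsto (hd : 1 ≤ d) {θ : Space d} (hθ : ∀ i, 0 < θ i) {U G : Space d → ℂ}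
    (h : HasPeriodicTraces θ U) (hG : HasH1Deriv θ U G) {B : ℕ → Space d → ℂ}
    (hB : ∀ k, IsTest (B k)) (hBU : TendstoH1 θ B U G) (i : Fin d) {K : Set (Fin d → ℝ)}
    (hK : IsCompact K) (hKf : K ⊆ face i.castSucc) :
    Tendsto (fun k => eLpNorm (fun z => B k (facePoint i.castSucc 1 z) -
      B k (facePoint i.castSucc 0 z)) 2 (volume.restrict K)) atTop (𝓝 0) := by
  obtain ⟨g, h0, h1⟩ := h i
  have t0 := h0.tendsto hd hθ (Or.inl rfl) hG (fun k => (hB k).contDiff_one) hBU hK hKf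
  have t1 := h1.tendsto hd hθ (Or.inr rfl) hG (fun k => (hB k).contDiff_one) hBU hK hKf
  have hc : ∀ k (a : ℝ), AEStronglyMeasurable (fun z => B k (facePoint i.castSucc a z) - g z)
      (volume.restrict K) := fun k a =>
    ((hB k).1.continuous.comp (continuous_facePoint_right _ a)).aestronglyMeasurable.sub
      (h0.1 K hK hKf).1
  have t0' : Tendsto (fun k => eLpNorm (fun z => -(B k (facePoint i.castSucc 0 z) - g z)) 2
      (volume.restrict K)) atTop (𝓝 0) := by
    refine t0.congr fun k => ?_
    exact (eLpNorm_neg (fun z => B k (facePoint i.castSucc 0 z) - g z) 2 _).symm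
  have := tendsto_eLpNorm_add (fun k => hc k 1) (fun k => (hc k 0).neg) t1 t0'
  refine this.congr fun k => ?_
  congr 1
  ext z
  simp only [Pi.neg_apply]
  ring

/-- Both parts of the weak formulation are instances of `TendstoH1.green_perTest`: for `U` with
bottom trace `φ`, and for the flux with test functions vanishing at the bottom. The lateral
conditions cancel the contributions of opposite faces. -/
theorem IsSolution.exists_isWeakSol (hd : 1 ≤ d) {θ : Space d} (hθ : ∀ i, 0 < θ i)
    {μ ρ : Space d → ℝ} {ω : ℂ} (hc : Coeffs μ ρ ω) {φ : SectionL2 d} {U : GuideL2 d}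
    (h : IsSolution θ μ ρ ω φ U) : ∃ G : GuideL2 d, IsWeakSol θ μ ρ ω φ U G := by
  obtain ⟨G, hG, hF, hφ, hper, hperF⟩ := h
  have hGe := hG.memLp_deriv.coeFn_toLp
  refine ⟨hG.memLp_deriv.toLp _, ⟨fun V hV => ?_, ?_⟩⟩
  · have hφ' := hφ
    obtain ⟨-, G', hG', B, hB, h1, h2, -⟩ := hφ'
    have hBU : TendstoH1 θ B U G := TendstoH1.congr_deriv ⟨h1, h2⟩
      (hG'.weakDeriv.ae_eq hG'.memLp_deriv hG.memLp_deriv hG.weakDeriv)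
    have := hBU.green_perTest θ hG.memLp hG.memLp_deriv hB
      (fun i K hK hKf => hper.tendsto hd hθ hG hB hBU i hK hKf) (Lp.memLp φ) hV
      (Or.inl fun K hK hKf => hφ.tendsto hd hθ (Or.inl rfl) hG (fun k => (hB k).contDiff_one)
        hBU hK hKf)
    rw [← this]
    congr 1
    refine integral_congr_ae ?_
    filter_upwards [hGe] with y hy
    rw [hy]
  · refine perWeak_congr (U := fun y => (μ y : ℂ) * G y)
      (G := fun y => -((ρ y : ℂ) * ω ^ 2 * U y)) ?_ EventuallyEq.rfl fun V hV => ?_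
    · filter_upwards [hGe] with y hy
      rw [hy]
    -- A smooth approximating sequence for the flux is part of the statement that it has a lateral
    -- trace; `d ≥ 1` provides a lateral face.
    obtain ⟨g, -, -, G', hG', B, hB, h1, h2, -⟩ := hperF ⟨0, hd⟩
    have hF' : HasH1Deriv θ (fun y => (μ y : ℂ) * G y) (fun y => -((ρ y : ℂ) * ω ^ 2 * U y)) := by
      refine ⟨hG'.memLp, ?_, hF⟩
      refine (Lp.memLp (mulOp hc.memLp_ρ U)).ae_eq ?_
      filter_upwards [coeFn_mulOp hc.memLp_ρ U] with y hy
      rw [hy]; ring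
    have hBU : TendstoH1 θ B _ _ := TendstoH1.congr_deriv ⟨h1, h2⟩
      (hG'.weakDeriv.ae_eq hG'.memLp_deriv hF'.memLp_deriv hF'.weakDeriv)
    obtain ⟨δ, hδ, h0⟩ := hV.vanish_bot
    have := hBU.green_perTest θ hF'.memLp hF'.memLp_deriv hB
      (fun i K hK hKf => hperF.tendsto hd hθ hF' hB hBU i hK hKf) (φ := fun _ => 0) MemLp.zero
      hV.toPerTest (Or.inr fun z => h0 _ (by rw [facePoint_self]; exact hδ.le))
    rw [this]
    simp

/-! ### From weak solutions to solutions -/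

/-- Periodic test functions coincide on the closed half-cylinder with test functions. -/
lemma PerTest.exists_isTest (θ : Space d) {V : Space d → ℂ} (hV : PerTest V) :
    ∃ W : Space d → ℂ, IsTest W ∧
      (∀ y, (∀ j, 0 ≤ y j ∧ (j ≠ Fin.last d → y j ≤ 1)) → W y = V y) ∧
      ∀ y ∈ guide d, HalfGuide.dirDeriv θ W y = HalfGuide.dirDeriv θ V y := by
  obtain ⟨R, hR⟩ := hV.vanish
  let β : ContDiffBump (0 : Space d) :=
    ⟨max R 1, max R 1 + 1, lt_max_of_lt_right one_pos, lt_add_one _⟩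
  have hW : ∀ y : Space d, (∀ j, 0 ≤ y j ∧ (j ≠ Fin.last d → y j ≤ 1)) → (β y : ℂ) * V y = V y := by
    intro y hy
    by_cases hyR : R ≤ y (Fin.last d)
    · rw [hR y hyR, mul_zero]
    · push Not at hyR
      rw [β.one_of_mem_closedBall, Complex.ofReal_one, one_mul]
      rw [mem_closedBall_zero_iff]
      refine (pi_norm_le_iff_of_nonneg β.rIn_pos.le).2 fun j => ?_
      rw [Real.norm_of_nonneg (hy j).1]
      by_cases hj : j = Fin.last d
      · rw [hj]; exact hyR.le.trans (le_max_left _ _)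
      · exact ((hy j).2 hj).trans (le_max_right _ _)
  refine ⟨fun y => (β y : ℂ) * V y, ⟨?_, ?_⟩, hW, fun y hy => ?_⟩
  · exact (Complex.ofRealCLM.contDiff.comp β.contDiff).mul hV.smooth
  · exact (β.hasCompactSupport.comp_left (g := fun x : ℝ => (x : ℂ)) (by simp)).mul_right
  · have : (fun y => (β y : ℂ) * V y) =ᶠ[𝓝 y] V := by
      filter_upwards [isOpen_guide.mem_nhds hy] with x hx
      exact hW x fun j => ⟨(hx j).1.le, fun hj => ((hx j).2 hj).le⟩
    rw [HalfGuide.dirDeriv, HalfGuide.dirDeriv, this.fderiv_eq]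

lemma facePoint_closed {i : Fin (d + 1)} {a : ℝ} (ha : a = 0 ∨ a = 1) {z : Fin d → ℝ}
    (hz : z ∈ face i) (k : Fin (d + 1)) :
    0 ≤ facePoint i a z k ∧ (k ≠ Fin.last d → facePoint i a z k ≤ 1) := by
  rcases Fin.eq_self_or_eq_succAbove i k with rfl | ⟨j, rfl⟩
  · rw [facePoint_self]
    rcases ha with rfl | rfl <;> simp
  · rw [facePoint_succAbove]
    exact ⟨(hz j).1.le, fun h => ((hz j).2 h).le⟩

lemma tendsto_eLpNorm_of_tendsto_toLp {α : Type*} [MeasurableSpace α] {m : Measure α}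
    {f : ℕ → α → ℂ} (hf : ∀ k, MemLp (f k) 2 m) {g : Lp ℂ 2 m}
    (h : Tendsto (fun k => (hf k).toLp _) atTop (𝓝 g)) :
    Tendsto (fun k => eLpNorm (fun x => f k x - g x) 2 m) atTop (𝓝 0) :=
  (Lp.tendsto_Lp_iff_tendsto_eLpNorm'' _ hf g (Lp.memLp g)).1 (by simpa using h)

/-- An element of the closure is a limit of periodic test functions, and these can be made compactly
supported without altering them on the closed half-cylinder. Equality on opposite faces therefore
survives. -/
theorem exists_isTest_tendsto (θ : Space d) {x : Ambient d} (hx : x ∈ perSpace θ) :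
    ∃ W : ℕ → Space d → ℂ, (∀ k, IsTest (W k)) ∧ TendstoH1 θ W (funL x) (derivL x) ∧
      (∀ k (i : Fin d), ∀ z ∈ face i.castSucc,
        W k (facePoint i.castSucc 1 z) = W k (facePoint i.castSucc 0 z)) ∧
      Tendsto (fun k => eLpNorm (fun z => W k (facePoint (Fin.last d) 0 z) - trace0L x z) 2
        (volume.restrict (face (Fin.last d)))) atTop (𝓝 0) ∧
      Tendsto (fun k => eLpNorm (fun z => W k (facePoint (Fin.last d) 1 z) - trace1L x z) 2
        (volume.restrict (face (Fin.last d)))) atTop (𝓝 0) := by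
  obtain ⟨v, hv, hlim⟩ := mem_closure_iff_seq_limit.1 (show x ∈ closure (testSubmodule θ : Set _)
    from hx)
  choose V hV hVe using hv
  choose W hW hWV hWD using fun k => (hV k).exists_isTest θ
  have hl : ∀ {F : Type} [TopologicalSpace F] (L : Ambient d → F), Continuous L →
      Tendsto (fun k => L (embed θ (hV k))) atTop (𝓝 (L x)) := fun L hL => by
    have := (hL.tendsto x).comp hlim
    exact this.congr fun k => by simp only [Function.comp, hVe]
  have hface : ∀ (a : ℝ), a = 0 ∨ a = 1 → ∀ k (g : (Fin d → ℝ) → ℂ),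
      eLpNorm (fun z => V k (facePoint (Fin.last d) a z) - g z) 2
        (volume.restrict (face (Fin.last d))) =
      eLpNorm (fun z => W k (facePoint (Fin.last d) a z) - g z) 2
        (volume.restrict (face (Fin.last d))) := fun a ha k g => by
    refine eLpNorm_congr_ae ((ae_restrict_iff' (measurableSet_face _)).2
      (Eventually.of_forall fun z hz => ?_))
    simp only
    rw [hWV k _ (facePoint_closed ha hz)]
  refine ⟨W, hW, ⟨?_, ?_⟩, fun k i z hz => ?_, ?_, ?_⟩
  · refine (tendsto_eLpNorm_of_tendsto_toLp (fun k => (hV k).memLp 2)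
      (hl funL funL.continuous)).congr fun k => eLpNorm_congr_ae
        ((ae_restrict_iff' measurableSet_guide).2 (Eventually.of_forall fun y hy => ?_))
    simp only
    rw [hWV k y fun j => ⟨(hy j).1.le, fun hj => ((hy j).2 hj).le⟩]
  · refine (tendsto_eLpNorm_of_tendsto_toLp (fun k => ((hV k).dirDeriv θ).memLp 2)
      (hl derivL derivL.continuous)).congr fun k => eLpNorm_congr_ae
        ((ae_restrict_iff' measurableSet_guide).2 (Eventually.of_forall fun y hy => ?_))
    simp only
    rw [hWD k y hy]
  · rw [hWV k _ (facePoint_closed (Or.inr rfl) hz), hWV k _ (facePoint_closed (Or.inl rfl) hz)]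
    have := (hV k).periodic (facePoint i.castSucc 0 z) i
    rwa [facePoint_add_single, zero_add] at this
  · exact (tendsto_eLpNorm_of_tendsto_toLp (fun k => memLp_face (hV k).continuous 0 2)
      (hl trace0L trace0L.continuous)).congr fun k => hface 0 (Or.inl rfl) k _
  · exact (tendsto_eLpNorm_of_tendsto_toLp (fun k => memLp_face (hV k).continuous 1 2)
      (hl trace1L trace1L.continuous)).congr fun k => hface 1 (Or.inr rfl) k _

lemma hasH1Deriv_of_mem_perSpace (θ : Space d) {x : Ambient d} (hx : x ∈ perSpace θ) :
    HasH1Deriv θ (funL x) (derivL x) :=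
  ⟨Lp.memLp _, Lp.memLp _, (perSpace_perWeak θ hx).hasWeakDirDeriv⟩

theorem hasTrace_of_mem_perSpace (θ : Space d) {x : Ambient d} (hx : x ∈ perSpace θ) :
    HasTrace θ (Fin.last d) 0 (funL x) (trace0L x) ∧
      HasTrace θ (Fin.last d) 1 (funL x) (trace1L x) := by
  obtain ⟨W, hW, hWx, -, h0, h1⟩ := exists_isTest_tendsto θ hx
  have key : ∀ (a : ℝ) (g : SectionL2 d), Tendsto (fun k => eLpNorm (fun z =>
      W k (facePoint (Fin.last d) a z) - g z) 2 (volume.restrict (face (Fin.last d)))) atTop (𝓝 0) →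
      HasTrace θ (Fin.last d) a (funL x) g := fun a g h =>
    ⟨fun K hK hKf => (Lp.memLp g).mono_measure (Measure.restrict_mono hKf le_rfl), derivL x,
      hasH1Deriv_of_mem_perSpace θ hx, W, hW, hWx.1, hWx.2, fun K hK hKf =>
      tendsto_of_tendsto_of_tendsto_of_le_of_le tendsto_const_nhds h (fun _ => zero_le)
        fun k => eLpNorm_mono_measure _ (Measure.restrict_mono hKf le_rfl)⟩
  exact ⟨key 0 _ h0, key 1 _ h1⟩

/-- The approximating functions have identical values on opposite faces, so a limit of the traces on
one face is also a limit on the other. -/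
theorem hasPeriodicTraces_of_mem_perSpace (hd : 1 ≤ d) {θ : Space d} (hθ : ∀ i, 0 < θ i)
    {x : Ambient d} (hx : x ∈ perSpace θ) : HasPeriodicTraces θ (funL x) := by
  intro i
  obtain ⟨W, hW, hWx, hper, -, -⟩ := exists_isTest_tendsto θ hx
  obtain ⟨g, hg⟩ := hWx.exists_trace hd hθ (Lp.memLp _).1 (Lp.memLp _).1
    (fun k => (hW k).contDiff_one) (fun k => (hW k).memLp 2) (fun k => ((hW k).dirDeriv θ).memLp 2)
    i.castSucc (a := 0) (Or.inl rfl)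
  have hH := hasH1Deriv_of_mem_perSpace θ hx
  refine ⟨g, ⟨fun K hK hKf => (hg K hK hKf).1, derivL x, hH, W, hW, hWx.1, hWx.2,
    fun K hK hKf => (hg K hK hKf).2⟩, ⟨fun K hK hKf => (hg K hK hKf).1, derivL x, hH, W, hW, hWx.1,
    hWx.2, fun K hK hKf => (hg K hK hKf).2.congr fun k => eLpNorm_congr_ae
      ((ae_restrict_iff' hK.measurableSet).2 (Eventually.of_forall fun z hz => ?_))⟩⟩
  simp only
  rw [hper k i z (hKf hz)]

lemma HasH1Deriv.congr_left {θ : Space d} {U U' G : Space d → ℂ} (h : HasH1Deriv θ U G)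
    (e : U =ᵐ[volume.restrict (guide d)] U') : HasH1Deriv θ U' G := by
  refine ⟨h.memLp.ae_eq e, h.memLp_deriv, fun V hV hs => ?_⟩
  rw [← h.weakDeriv V hV hs]
  refine integral_congr_ae ?_
  filter_upwards [e] with y hy
  rw [hy]

lemma HasTrace.congr_left {θ : Space d} {i : Fin (d + 1)} {a : ℝ} {U U' : Space d → ℂ}
    {g : (Fin d → ℝ) → ℂ} (h : HasTrace θ i a U g) (e : U =ᵐ[volume.restrict (guide d)] U') :
    HasTrace θ i a U' g := by
  obtain ⟨h0, G, hG, V, hV, h1, h2, h3⟩ := h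
  refine ⟨h0, G, hG.congr_left e, V, hV, h1.congr fun k => eLpNorm_congr_ae ?_, h2, h3⟩
  filter_upwards [e] with y hy
  rw [hy]

lemma HasPeriodicTraces.congr_left {θ : Space d} {U U' : Space d → ℂ} (h : HasPeriodicTraces θ U)
    (e : U =ᵐ[volume.restrict (guide d)] U') : HasPeriodicTraces θ U' := fun i => by
  obtain ⟨g, h0, h1⟩ := h i
  exact ⟨g, h0.congr_left e, h1.congr_left e⟩

/-- Both `(U, G)` and the flux pair `(μ G, -ρ ω² U)` are periodic weakly differentiable, hence lie
in `perSpace θ` by `exists_lift`; all required traces and their periodicity follow from membership.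
-/
theorem IsWeakSol.isSolution (hd : 1 ≤ d) {θ : Space d} (hθ : ∀ i, 0 < θ i)
    {μ ρ : Space d → ℝ} {ω : ℂ} (hc : Coeffs μ ρ ω) {φ : SectionL2 d} {U G : GuideL2 d}
    (h : IsWeakSol θ μ ρ ω φ U G) : IsSolution θ μ ρ ω φ U := by
  obtain ⟨R, -, hR⟩ := exists_lift θ (hθ _)
  obtain ⟨x, -, hp, ht⟩ := h.exists_perSpace (hθ _) hR
  have hx := embL_mem θ x
  have hU : funL (embL θ x) = U := congrArg WithLp.fst hp
  have hG : derivL (embL θ x) = G := congrArg WithLp.snd hp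
  have hH := hasH1Deriv_of_mem_perSpace θ hx
  have hT := (hasTrace_of_mem_perSpace θ hx).1
  have hP := hasPeriodicTraces_of_mem_perSpace hd hθ hx
  rw [hU, hG] at hH
  rw [hU, ht] at hT
  rw [hU] at hP
  refine ⟨G, hH, h.flux.hasWeakDirDeriv, hT, hP, ?_⟩
  have hF : PerWeak θ (mulOp hc.memLp_μ G) (mulOp hc.memLp_ρ U) := by
    refine perWeak_congr (coeFn_mulOp hc.memLp_μ G).symm ?_ h.flux
    filter_upwards [coeFn_mulOp hc.memLp_ρ U] with y hy
    rw [hy]; ring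
  have hq := hR (WithLp.toLp 2 (mulOp hc.memLp_μ G, mulOp hc.memLp_ρ U)) hF
  have hQ := hasPeriodicTraces_of_mem_perSpace hd hθ
    (embL_mem θ (R (WithLp.toLp 2 (mulOp hc.memLp_μ G, mulOp hc.memLp_ρ U))))
  rw [show funL (embL θ (R (WithLp.toLp 2 (mulOp hc.memLp_μ G, mulOp hc.memLp_ρ U)))) =
    mulOp hc.memLp_μ G from congrArg WithLp.fst hq] at hQ
  exact hQ.congr_left (coeFn_mulOp hc.memLp_μ G)

/-! ### The propagation operator -/

lemma measurePreserving_translate (ℓ : ℕ) :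
    MeasurePreserving (fun y : Space d => y + ℓ • eLast d) (volume : Measure (Space d)) volume :=
  measurePreserving_add_right _ _

lemma add_nsmul_eLast_mem_guide {y : Space d} (hy : y ∈ guide d) (ℓ : ℕ) :
    y + ℓ • eLast d ∈ guide d := by
  induction ℓ with
  | zero => simpa using hy
  | succ ℓ ih =>
    rw [succ_nsmul, ← add_assoc]
    exact upper_subset_guide (add_eLast_mem_upper.2 ih)

lemma ae_guide_translate (ℓ : ℕ) {p : Space d → Prop}
    (h : ∀ᵐ y ∂volume.restrict (guide d), p y) :
    ∀ᵐ y ∂volume.restrict (guide d), p (y + ℓ • eLast d) := by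
  rw [ae_restrict_iff' measurableSet_guide] at h ⊢
  filter_upwards [(measurePreserving_translate ℓ).quasiMeasurePreserving.ae h] with y hy hg
  exact hy (add_nsmul_eLast_mem_guide hg ℓ)

lemma ae_eq_of_shift {U : ℕ → GuideL2 d} (h : ∀ ℓ, U (ℓ + 1) = shift (U ℓ)) (ℓ : ℕ) :
    ∀ᵐ y ∂volume.restrict (guide d), U 0 (y + ℓ • eLast d) = U ℓ y := by
  induction ℓ with
  | zero => simp
  | succ ℓ ih =>
    have h1 := ae_guide_translate 1 ih
    filter_upwards [h1, coeFn_shift (U ℓ)] with y hy hs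
    rw [h, hs, succ_nsmul, add_comm (ℓ • eLast d), ← add_assoc]
    simpa using hy

end HalfGuide

/-! ### The half-guide problem and its propagation operator -/

theorem mainTheorem3 (d : ℕ) (hd : 1 ≤ d)
    (θ : HalfGuide.Space d) (hθ : ∀ i, 0 < θ i)
    (μ ρ : HalfGuide.Space d → ℝ)
    (hμ_cont : Continuous μ) (hρ_cont : Continuous ρ)
    (hμ_per : ∀ y i, μ (y + Pi.single i 1) = μ y)
    (hρ_per : ∀ y i, ρ (y + Pi.single i 1) = ρ y)
    (μ₀ μ₁ ρ₀ ρ₁ : ℝ) (hμ₀ : 0 < μ₀) (hρ₀ : 0 < ρ₀)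
    (hμ : ∀ y, μ₀ ≤ μ y ∧ μ y ≤ μ₁) (hρ : ∀ y, ρ₀ ≤ ρ y ∧ ρ y ≤ ρ₁)
    (ω : ℂ) (hω : 0 < ω.im) :
    (∀ φ : HalfGuide.SectionL2 d, ∃! U : HalfGuide.GuideL2 d,
      HalfGuide.IsSolution θ μ ρ ω φ U) ∧
    (∃! P : HalfGuide.SectionL2 d →L[ℂ] HalfGuide.SectionL2 d,
      HalfGuide.IsPropagationOperator θ μ ρ ω P) ∧
    ∀ P : HalfGuide.SectionL2 d →L[ℂ] HalfGuide.SectionL2 d,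
      HalfGuide.IsPropagationOperator θ μ ρ ω P →
      (∀ (φ : HalfGuide.SectionL2 d) (ℓ : ℕ) (U V : HalfGuide.GuideL2 d),
        HalfGuide.IsSolution θ μ ρ ω φ U → HalfGuide.IsSolution θ μ ρ ω ((P ^ ℓ) φ) V →
        ∀ᵐ y ∂(volume.restrict (HalfGuide.guide d)),
          U (y + Pi.single (Fin.last d) (ℓ : ℝ)) = V y) ∧
      spectralRadius ℂ P < 1 := by
  have hθn := hθ (Fin.last d)
  have hc : HalfGuide.Coeffs μ ρ ω := by
    refine ⟨hμ_cont, hρ_cont, ⟨min μ₀ ρ₀, max μ₁ ρ₁, lt_min hμ₀ hρ₀, fun y => ⟨?_, ?_, ?_, ?_⟩⟩, hω⟩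
    · exact (min_le_left _ _).trans (hμ y).1
    · exact (hμ y).2.trans (le_max_left _ _)
    · exact (min_le_right _ _).trans (hρ y).1
    · exact (hρ y).2.trans (le_max_right _ _)
  obtain ⟨S, hS⟩ := hc.exists_solution_operator hθn
  obtain ⟨P, hP, hPrad⟩ := hc.exists_weak_propagation hθn hμ_per hρ_per
  have hweak : ∀ φ, HalfGuide.IsWeakSol θ μ ρ ω φ (S φ).fst (S φ).snd := fun φ =>
    (hS φ _ _).2 rfl
  -- The two formulations being equivalent, the first component of `S φ` is the only solution with
  -- datum `φ`.
  have hsol : ∀ φ U, HalfGuide.IsSolution θ μ ρ ω φ U ↔ U = (S φ).fst := by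
    refine fun φ U => ⟨fun h => ?_, ?_⟩
    · obtain ⟨G, hG⟩ := h.exists_isWeakSol hd hθ hc
      exact (congrArg WithLp.fst ((hS φ U G).1 hG)).symm
    · rintro rfl
      exact (hweak φ).isSolution hd hθ hc
  have htrace : ∀ φ, HalfGuide.HasTrace θ (Fin.last d) 1 (S φ).fst (P φ) := by
    intro φ
    obtain ⟨-, x, hx, hU, -, -, ht⟩ := hP φ _ _ (hweak φ)
    have := (HalfGuide.hasTrace_of_mem_perSpace θ hx).2
    rwa [hU, ht] at this
  -- A propagation operator is determined on each `φ`, because a solution exists and its trace on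
  -- `yₙ = 1` is unique almost everywhere.
  have huniq : ∀ Q, HalfGuide.IsPropagationOperator θ μ ρ ω Q → Q = P := by
    intro Q hQ
    ext1 φ
    exact Lp.ext ((hQ φ _ ((hsol φ _).2 rfl)).ae_eq hd hθ (Or.inr rfl) (htrace φ))
  refine ⟨fun φ => ⟨(S φ).fst, (hsol φ _).2 rfl, fun U hU => (hsol φ U).1 hU⟩,
    ⟨P, fun φ U hU => ?_, huniq⟩, fun Q hQ => ?_⟩
  · rw [(hsol φ U).1 hU]
    exact htrace φ
  obtain rfl := huniq Q hQ
  refine ⟨fun φ ℓ U V hU hV => ?_, hPrad⟩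
  -- The shifted solution is a weak solution with datum `Q ((Q ^ ℓ) φ)`, and `S` returns the only
  -- one.
  have hshift : ∀ ℓ : ℕ, (S ((Q ^ (ℓ + 1)) φ)).fst = HalfGuide.shift (S ((Q ^ ℓ) φ)).fst := by
    intro ℓ
    rw [pow_succ']
    exact congrArg WithLp.fst ((hS _ _ _).1 (hP _ _ _ (hweak ((Q ^ ℓ) φ))).1)
  have h := HalfGuide.ae_eq_of_shift (U := fun ℓ => (S ((Q ^ ℓ) φ)).fst) hshift ℓ
  rw [(hsol _ _).1 hV, (hsol _ _).1 hU]
  have e : Pi.single (Fin.last d) (ℓ : ℝ) = ℓ • HalfGuide.eLast d := by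
    rw [HalfGuide.eLast, ← Pi.single_smul, nsmul_eq_mul, mul_one]
  rw [e]
  exact h
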